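/- **Setting.** A structure over a finite schema of relation and function symbols has a domain $[n]=\{0,\dots,n-1\}$, $n\ge 1$, with its natural order and (partial) addition and multiplication; functions may be partial, $\bot$ meaning "undefined". An atom with an argument $\bot$ is false (except that $\bot=\bot$ holds), and a function applied to $\bot$ yields $\bot$. A function $g:\mathbb N\to\mathbb N$ is *FO-definable* if one first-order formula over $\le,+,\times$ defines, in $[n]$ for every $n$, the element $g(n)$ (no element if $g(n)\ge n$). A *Procedural-DynFO program* consists of an auxiliary schema, finitely many *supplementary instances* (each with its own Procedural-DynFO program, over the same domain), for each change operation $\delta$ and each auxiliary symbol $R$ at most one update rule, and for each query operation one query rule. * *Terms* are built from $\bot$, variables, $+$, $\times$, auxiliary and previously assigned function symbols, **if** $C$ **then** $t_1$ **else** $t_2$, functional queries $\mathrm{inst}.Q(\bar y)$ to supplementary instances, and **unique**$(z\le g(n)\mid C)$ (exactly one domain element $z\le g(n)$ must satisfy $C$). *Conditions* are built from atoms (equality, $\le$, auxiliary and previously assigned relation symbols), relational queries $\mathrm{inst}.Q(\bar y)$, Boolean connectives and **exists**$(z\le g(n)\mid C)$. All $g$ are FO-definable. * *Instructions* are assignments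 $f(\bar y)\gets t$ and $R(\bar y)\gets C$ to symbols outside the auxiliary schema, sequences, conditional branches, and parallel branches **for** $z\le g(n)$ **pardo** $P$, where the head of every assignment inside $P$ has $z$ among its arguments. All branches of a parallel branch start from the values before it, and their changes are merged; they must not change a value in different ways. * An *update rule* $\pi$ has the form "on change $\delta(\bar p)$ with $P_1$: update $R$ at $(t_1(\bar p,\bar x),\dots,t_k(\bar p,\bar x))$, for all $x_1\le g_1(n),\dots,x_\ell\le g_\ell(n)$, by $P_2$". The initial procedure $P_1$ is executed once, does not use $\bar x$, and may also, outside parallel branches, invoke change operations of supplementary instances; the main procedure $P_2$ is executed independently for every $\bar x$, and each of its execution paths ends with a return statement, outside parallel branches. All of this is evaluated on the old auxiliary structure. For a relation $R$, a tuple is put into $R$ if some execution of $P_2$ with this head returns true, and is removed if there are such executions but all return false; for a function the returned value is the new value, and executions with the same head must agree. Assignments, updates and change invocations at tuples that contain $\bot$ have no effect. A *query rule* is a main procedure with free variables $\bar p$. * The rules for one change operation are all evaluated on the old state. For each change operation and each supplementary instance at most one update rule invokes change operations for that instance. The *work-bounding function* $w$ (a function of $n$) is defined as follows, where $\hat g(n)=\max(1,g(n))$: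 * $w(t)=1$ for variables and constants; $w(f(\bar t))=w(R(\bar t))=\max(1,w(t_1),\dots,w(t_k))$ for function terms and atoms; $w(\text{if }C\text{ then }t_1\text{ else }t_2)=\max(w(C),w(t_1),w(t_2))$; the maximum of $w$ over the parts for Boolean combinations; $w(\textbf{unique}(z\le g(n)\mid C))=w(\textbf{exists}(z\le g(n)\mid C))=\hat g(n)\cdot w(C)$; $w(\mathrm{inst}.Q(\bar y))=\max(1,w(\bar y),w(\pi'))$, where $\pi'$ is the query rule for $Q$ of the instance; * for assignments the maximum of $w$ over the argument terms and the right-hand side; $w(\text{if }C\text{ then }P'\text{ else }P'')=\max(w(C),w(P'),w(P''))$; $w(P';P'')=\max(w(P'),w(P''))$; $w$ of the empty instruction is $1$; $w(\textbf{for }z\le g(n)\textbf{ pardo }P')=\hat g(n)\cdot w(P')$; $w(\textbf{return }e)=w(e)$; $w(\mathrm{inst}.\delta(\bar y))=\max(1,w(\bar y),w(\pi_1),\dots,w(\pi_m))$, where $\pi_1,\dots,\pi_m$ are the update rules for $\delta$ of the instance; * $w(\pi)=\max\bigl(w(P_1),\ \hat g_1(n)\cdots \hat g_\ell(n)\cdot\max(w(P_2),w(t_1),\dots,w(t_k))\bigr)$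 for update rules, and $w(\pi)=w(P)$ for a query rule with procedure $P$. A *CRAM program* is one finite program executed synchronously by $p(n)$ processors that know their number, with local registers and a shared memory of natural numbers; concurrent reads are allowed, and concurrent writes to a cell if all processors write the same value. Processors have unit-cost addition, subtraction, multiplication, division, comparison, memory access and conditional jumps, and may load $n$, constants, and sums and products of these and of values $\min(g(n),n)$ of FO-definable functions; $p(n)$ is such a number as well. The *work* is the total number of steps of all processors. A state (the auxiliary structure and the states of all supplementary instances) is stored as one array per symbol. **Proposition.** For every update rule $\pi$ of a Procedural-DynFO program there are a CRAM program and constants $T,C$ such that for all $n\ge1$, all states over $[n]$ and all parameters $\bar a$ for which the effect of $\pi$ is defined: started with a memory that contains the state and $\bar a$ and is zero elsewhere, the CRAM program halts after at most $T$ steps, without write conflicts, with work at most $C\cdot w(\pi)(n)$, and the memory then contains the state that results from applying $\pi$. Likewise, for every query rule $\pi$ there is such a CRAM program, with time at most $T$ and work at most $C\cdot w(\pi)(n)$, that leaves the stored state unchanged and writes the answer to the query into an output cell. -/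

import Mathlib

/-! # Numeric functions definable in first-order logic with order, addition, multiplication -/

/-- The relation symbols `≤` (binary) and the graphs of `+` and `×` (ternary). -/
inductive ArithRel : ℕ → Type
  | le : ArithRel 2
  | add : ArithRel 3
  | mul : ArithRel 3

/-- The first-order language of `≤`, `+`, `×`. -/
def arithLang : FirstOrder.Language := ⟨fun _ => Empty, ArithRel⟩

/-- The domain `[n] = {0, …, n-1}` as a structure: `≤` and the arithmetic of `ℕ` cut off at `n`. -/
@[reducible] def arithStructure (n : ℕ) : arithLang.Structure (Fin n) where
  funMap := fun f _ => nomatch f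
  RelMap := fun r v => match r, v with
    | ArithRel.le, v => v 0 ≤ v 1
    | ArithRel.add, v => (v 0 : ℕ) + (v 1 : ℕ) = (v 2 : ℕ)
    | ArithRel.mul, v => (v 0 : ℕ) * (v 1 : ℕ) = (v 2 : ℕ)

/-- A first-order definable function `g : ℕ → ℕ`: one formula singles out, in the domain `[n]`
for every `n`, the element `g n` (and no element if `g n ≥ n`). -/
structure NumFun where
  toFun : ℕ → ℕ
  definable : ∃ φ : arithLang.Formula (Fin 1), ∀ (n : ℕ) (a : Fin n),
    (letI := arithStructure n; φ.Realize (fun _ => a)) ↔ (a : ℕ) = toFun n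

/-! # Syntax of procedures -/

/-- The two sorts of symbols, queries and expressions: Boolean valued (relations, conditions)
and element valued (functions, terms). -/
inductive Srt
  | rel
  | fn

/-- A finite schema: finitely many relation symbols and function symbols, with arities. -/
structure Schema where
  num : Srt → ℕ
  arity : (s : Srt) → Fin (num s) → ℕ

/-- The operations of a dynamic problem: change operations, and relational and functional query
operations, with the lengths of their parameter tuples. -/
structure Interface where
  chg : ℕ
  chgArity : Fin chg → ℕ
  qry : Schema

/-- The symbols a procedure may use: those of the auxiliary schema, those it assigns itself, and
the operations of the supplementary instances. -/
structure Ctx where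
  aux : Schema
  tmp : Schema
  k : ℕ
  sub : Fin k → Interface

/-- Terms (`Expr Γ m .fn`) and conditions (`Expr Γ m .rel`) over `m` variables. The binders
`unique` and `ex` range over the domain elements `z ≤ g(n)`; the bound variable is the last one. -/
inductive Expr (Γ : Ctx) : ℕ → Srt → Type
  | bot {m : ℕ} : Expr Γ m .fn
  | var {m : ℕ} (v : Fin m) : Expr Γ m .fn
  | add {m : ℕ} (a b : Expr Γ m .fn) : Expr Γ m .fn
  | mul {m : ℕ} (a b : Expr Γ m .fn) : Expr Γ m .fn
  | sym {m : ℕ} (s : Srt) (f : Fin (Γ.aux.num s))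
      (args : Fin (Γ.aux.arity s f) → Expr Γ m .fn) : Expr Γ m s
  | loc {m : ℕ} (s : Srt) (f : Fin (Γ.tmp.num s))
      (args : Fin (Γ.tmp.arity s f) → Expr Γ m .fn) : Expr Γ m s
  | ask {m : ℕ} (i : Fin Γ.k) (s : Srt) (q : Fin ((Γ.sub i).qry.num s))
      (args : Fin ((Γ.sub i).qry.arity s q) → Expr Γ m .fn) : Expr Γ m s
  | ite {m : ℕ} (c : Expr Γ m .rel) (t e : Expr Γ m .fn) : Expr Γ m .fn
  | unique {m : ℕ} (g : NumFun) (c : Expr Γ (m + 1) .rel) : Expr Γ m .fn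
  | eq {m : ℕ} (a b : Expr Γ m .fn) : Expr Γ m .rel
  | le {m : ℕ} (a b : Expr Γ m .fn) : Expr Γ m .rel
  | neg {m : ℕ} (c : Expr Γ m .rel) : Expr Γ m .rel
  | and {m : ℕ} (c d : Expr Γ m .rel) : Expr Γ m .rel
  | or {m : ℕ} (c d : Expr Γ m .rel) : Expr Γ m .rel
  | ex {m : ℕ} (g : NumFun) (c : Expr Γ (m + 1) .rel) : Expr Γ m .rel

/-- Instructions without return statements and change invocations: assignments (to symbols outside
the auxiliary schema), conditional branches, and parallel branches over all `z ≤ g(n)`. -/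
inductive Cmd (Γ : Ctx) : ℕ → Type
  | skip {m : ℕ} : Cmd Γ m
  | assign {m : ℕ} (s : Srt) (f : Fin (Γ.tmp.num s))
      (args : Fin (Γ.tmp.arity s f) → Expr Γ m .fn) (e : Expr Γ m s) : Cmd Γ m
  | seq {m : ℕ} (c d : Cmd Γ m) : Cmd Γ m
  | ite {m : ℕ} (b : Expr Γ m .rel) (c d : Cmd Γ m) : Cmd Γ m
  | par {m : ℕ} (g : NumFun) (c : Cmd Γ (m + 1)) : Cmd Γ m

/-- Initial procedures: they may also invoke change operations of supplementary instances,
but not inside parallel branches. -/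
inductive Init (Γ : Ctx) (m : ℕ) : Type
  | cmd (c : Cmd Γ m) : Init Γ m
  | change (i : Fin Γ.k) (δ : Fin (Γ.sub i).chg)
      (args : Fin ((Γ.sub i).chgArity δ) → Expr Γ m .fn) : Init Γ m
  | seq (c d : Init Γ m) : Init Γ m
  | ite (b : Expr Γ m .rel) (c d : Init Γ m) : Init Γ m

/-- Main procedures: every execution path ends with a return statement of the right sort, and no
return statement is inside a parallel branch. -/
inductive Body (Γ : Ctx) (m : ℕ) (s : Srt) : Type
  | ret (e : Expr Γ m s) : Body Γ m s
  | step (c : Cmd Γ m) (B : Body Γ m s) : Body Γ m s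
  | ite (b : Expr Γ m .rel) (B C : Body Γ m s) : Body Γ m s

section Scoping
variable {Γ : Ctx}

/-- In the scope of parallel branches that bind the variables in `L`, the head of every assignment
has all of these variables among its arguments. -/
def Cmd.Scoped : {m : ℕ} → Cmd Γ m → Finset (Fin m) → Prop
  | _, .skip, _ => True
  | _, .assign _ _ args _, L => ∀ v ∈ L, ∃ i, args i = .var v
  | _, .seq c d, L => c.Scoped L ∧ d.Scoped L
  | _, .ite _ c d, L => c.Scoped L ∧ d.Scoped L
  | m, .par _ c, L => c.Scoped (insert (Fin.last m) (L.map Fin.castSuccEmb))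

def Init.Scoped {m : ℕ} : Init Γ m → Prop
  | .cmd c => c.Scoped ∅
  | .change _ _ _ => True
  | .seq c d => c.Scoped ∧ d.Scoped
  | .ite _ c d => c.Scoped ∧ d.Scoped

def Body.Scoped {m : ℕ} {s : Srt} : Body Γ m s → Prop
  | .ret _ => True
  | .step c B => c.Scoped ∅ ∧ B.Scoped
  | .ite _ B C => B.Scoped ∧ C.Scoped

/-- The initial procedure contains a change invocation for the supplementary instance `i`. -/
def Init.Invokes {m : ℕ} (i : Fin Γ.k) : Init Γ m → Prop
  | .cmd _ => False
  | .change j _ _ => j = i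
  | .seq c d => c.Invokes i ∨ d.Invokes i
  | .ite _ c d => c.Invokes i ∨ d.Invokes i

end Scoping

/-- An update rule `on change δ(p̄) with init; update f at head(p̄, x̄) where x̄ ≤ bound(n) by body`
for the auxiliary symbol `f` of sort `s`; `p` is the length of `p̄` and `l` that of `x̄`. The
variables `0, …, p-1` are `p̄` and the variables `p, …, p+l-1` are `x̄`. -/
structure UpdRule (aux : Schema) {k : ℕ} (J : Fin k → Interface) (p : ℕ)
    (s : Srt) (f : Fin (aux.num s)) where
  tmp : Schema
  init : Init ⟨aux, tmp, k, J⟩ p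
  l : ℕ
  bound : Fin l → NumFun
  head : Fin (aux.arity s f) → Expr ⟨aux, tmp, k, J⟩ (p + l) .fn
  body : Body ⟨aux, tmp, k, J⟩ (p + l) s
  init_scoped : init.Scoped
  body_scoped : body.Scoped

/-- A query rule `on query Q(p̄): body`; it invokes no change operations. -/
structure QryRule (aux : Schema) {k : ℕ} (J : Fin k → Interface) (p : ℕ) (s : Srt) where
  tmp : Schema
  body : Body ⟨aux, tmp, k, J⟩ p s
  body_scoped : body.Scoped

/-- The rule contains a change invocation for the supplementary instance `i`. -/
def UpdRule.Invokes {aux : Schema} {k : ℕ} {J : Fin k → Interface} {p : ℕ} {s : Srt}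
    {f : Fin (aux.num s)} (r : UpdRule aux J p s f) (i : Fin k) : Prop :=
  Init.Invokes (Γ := ⟨aux, r.tmp, k, J⟩) i r.init

/-- A dynamic program offering the operations `I`: an auxiliary schema, supplementary instances
with their own programs, for each change operation and auxiliary symbol an update rule (or `none`
if the change operation leaves the symbol alone), and a query rule for each query operation. -/
inductive Prog : Interface → Type
  | mk {I : Interface} (aux : Schema) (k : ℕ) (J : Fin k → Interface)
      (sub : (i : Fin k) → Prog (J i))
      (upd : (δ : Fin I.chg) → (s : Srt) → (f : Fin (aux.num s)) →
        Option (UpdRule aux J (I.chgArity δ) s f))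
      (qry : (s : Srt) → (q : Fin (I.qry.num s)) → QryRule aux J (I.qry.arity s q) s) : Prog I

/-- For each change operation and each supplementary instance, at most one update rule
invokes change operations for that instance (in the program and in all supplementary ones). -/
def Prog.WellFormed : {I : Interface} → Prog I → Prop
  | _, .mk aux _ _ sub upd _ =>
    (∀ δ i s f s' f' r r', upd δ s f = some r → upd δ s' f' = some r' →
      r.Invokes i → r'.Invokes i →
      (⟨s, f⟩ : (s : Srt) × Fin (aux.num s)) = ⟨s', f'⟩) ∧
    ∀ i, (sub i).WellFormed

/-! # Semantics -/

/-- Values: truth values, and domain elements or `⊥` (which is `none`). -/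
@[reducible] def Val (n : ℕ) : Srt → Type
  | .rel => Bool
  | .fn => Option (Fin n)

/-- The value of an undefined atom or term. -/
def Val.default (n : ℕ) : (s : Srt) → Val n s
  | .rel => false
  | .fn => (none : Option (Fin n))

/-- Structures with domain `[n]` over a schema; functions may be partial. -/
def Struct (A : Schema) (n : ℕ) : Type :=
  (s : Srt) → (f : Fin (A.num s)) → (Fin (A.arity s f) → Fin n) → Val n s

/-- The structure with empty relations and nowhere defined functions. -/
def Struct.empty (A : Schema) (n : ℕ) : Struct A n := fun s _ _ => Val.default n s

/-- The operations of a dynamic data structure with states in `S`. A result `none` means that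
the procedure has no proper meaning on the arguments at hand. -/
structure Sem (n : ℕ) (I : Interface) (S : Type) where
  query : S → (s : Srt) → (q : Fin (I.qry.num s)) → (Fin (I.qry.arity s q) → Fin n) →
    Option (Val n s)
  change : S → (δ : Fin I.chg) → (Fin (I.chgArity δ) → Fin n) → Option S

/-- A tuple of defined entries, if all entries are defined. -/
def tuple {α : Type} {k : ℕ} (e : Fin k → Option α) : Option (Fin k → α) :=
  if h : ∀ i, (e i).isSome then some fun i => (e i).get (h i) else none

/-- The domain element `a`, or `⊥` if `a` is not in the domain. -/
def toDom (n a : ℕ) : Option (Fin n) := if h : a < n then some ⟨a, h⟩ else none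

noncomputable section Semantics
open scoped Classical

variable {n : ℕ} {Γ : Ctx} {S : Fin Γ.k → Type}

/-- Evaluation of terms and conditions, in a context given by the supplementary instances `O`
and their states `θ`, the auxiliary structure `σ`, the values `τ` of the assigned
symbols and the values `env` of the variables. The outer `Option` is `none` iff the evaluation
meets a `unique`-expression that does not have exactly one witness, or a query without meaning.
An atom with an argument `⊥` is false (but `⊥ = ⊥` is true), a function applied to `⊥` is `⊥`. -/
def Expr.eval (O : (i : Fin Γ.k) → Sem n (Γ.sub i) (S i)) (σ : Struct Γ.aux n)
    (θ : (i : Fin Γ.k) → S i) (τ : Struct Γ.tmp n) :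
    {m : ℕ} → {s : Srt} → Expr Γ m s → (Fin m → Fin n) → Option (Val n s)
  | _, _, .bot, _ => some (none : Option (Fin n))
  | _, _, .var v, env => some (some (env v))
  | _, _, .add a b, env =>
    match a.eval O σ θ τ env, b.eval O σ θ τ env with
    | some (some x), some (some y) => some (toDom n (x + y))
    | some _, some _ => some (none : Option (Fin n))
    | _, _ => none
  | _, _, .mul a b, env =>
    match a.eval O σ θ τ env, b.eval O σ θ τ env with
    | some (some x), some (some y) => some (toDom n (x * y))
    | some _, some _ => some (none : Option (Fin n))
    | _, _ => none
  | _, _, .sym s f args, env =>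
    (tuple fun i => (args i).eval O σ θ τ env).map fun v =>
      match tuple (α := Fin n) v with
      | some a => σ s f a
      | none => Val.default n s
  | _, _, .loc s f args, env =>
    (tuple fun i => (args i).eval O σ θ τ env).map fun v =>
      match tuple (α := Fin n) v with
      | some a => τ s f a
      | none => Val.default n s
  | _, _, .ask i s q args, env =>
    (tuple fun j => (args j).eval O σ θ τ env).bind fun v =>
      match tuple (α := Fin n) v with
      | some a => (O i).query (θ i) s q a
      | none => some (Val.default n s)
  | _, _, .ite c t e, env =>
    match c.eval O σ θ τ env with
    | some true => t.eval O σ θ τ env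
    | some false => e.eval O σ θ τ env
    | none => none
  | _, _, .unique g c, env =>
    if h : (∀ z : Fin n, (z : ℕ) ≤ g.toFun n → (c.eval O σ θ τ (Fin.snoc env z)).isSome) ∧
        ∃! z : Fin n, (z : ℕ) ≤ g.toFun n ∧ c.eval O σ θ τ (Fin.snoc env z) = some true
    then some (some h.2.choose) else none
  | _, _, .eq a b, env =>
    match a.eval O σ θ τ env, b.eval O σ θ τ env with
    | some x, some y => some (decide (x = y))
    | _, _ => none
  | _, _, .le a b, env =>
    match a.eval O σ θ τ env, b.eval O σ θ τ env with
    | some (some x), some (some y) => some (decide (x ≤ y))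
    | some _, some _ => some false
    | _, _ => none
  | _, _, .neg c, env =>
    match c.eval O σ θ τ env with
    | some x => some (Bool.not x)
    | none => none
  | _, _, .and c d, env =>
    match c.eval O σ θ τ env, d.eval O σ θ τ env with
    | some x, some y => some (Bool.and x y)
    | _, _ => none
  | _, _, .or c d, env =>
    match c.eval O σ θ τ env, d.eval O σ θ τ env with
    | some x, some y => some (Bool.or x y)
    | _, _ => none
  | _, _, .ex g c, env =>
    if ∀ z : Fin n, (z : ℕ) ≤ g.toFun n → (c.eval O σ θ τ (Fin.snoc env z)).isSome
    then some (decide (∃ z : Fin n, (z : ℕ) ≤ g.toFun n ∧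
      c.eval O σ θ τ (Fin.snoc env z) = some true))
    else none

/-- The value of a tuple of terms: `some none` if some entry is `⊥`. -/
def evalArgs (O : (i : Fin Γ.k) → Sem n (Γ.sub i) (S i)) (σ : Struct Γ.aux n)
    (θ : (i : Fin Γ.k) → S i) (τ : Struct Γ.tmp n) {m k : ℕ} (env : Fin m → Fin n)
    (args : Fin k → Expr Γ m .fn) : Option (Option (Fin k → Fin n)) :=
  (tuple fun i => (args i).eval O σ θ τ env).map fun v => tuple (α := Fin n) v

/-- Change the value of one symbol at one tuple. -/
def Struct.set {A : Schema} (τ : Struct A n) (s : Srt) (f : Fin (A.num s))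
    (a : Fin (A.arity s f) → Fin n) (v : Val n s) : Struct A n :=
  Function.update τ s (Function.update (τ s) f (Function.update (τ s f) a v))

/-- The common result of parallel branches `z ≤ b` that started in `τ` and ended in `ρ z`: every
value changed by a branch is taken over. There is no result if two branches change
a value in different ways. -/
def mergeBranches {A : Schema} (b : ℕ) (τ : Struct A n) (ρ : Fin n → Struct A n) :
    Option (Struct A n) :=
  if ∀ (z z' : Fin n) (s : Srt) (f : Fin (A.num s)) (a : Fin (A.arity s f) → Fin n),
      (z : ℕ) ≤ b → (z' : ℕ) ≤ b → ρ z s f a ≠ τ s f a → ρ z' s f a ≠ τ s f a →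
      ρ z s f a = ρ z' s f a
  then some fun s f a =>
    if h : ∃ z : Fin n, (z : ℕ) ≤ b ∧ ρ z s f a ≠ τ s f a then ρ h.choose s f a else τ s f a
  else none

/-- Execution of instructions. All branches of a parallel branch start from the values before it.
An assignment to a tuple that contains `⊥` has no effect. -/
def Cmd.exec (O : (i : Fin Γ.k) → Sem n (Γ.sub i) (S i)) (σ : Struct Γ.aux n)
    (θ : (i : Fin Γ.k) → S i) :
    {m : ℕ} → Cmd Γ m → (Fin m → Fin n) → Struct Γ.tmp n → Option (Struct Γ.tmp n)
  | _, .skip, _, τ => some τ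
  | _, .assign s f args e, env, τ =>
    match evalArgs O σ θ τ env args, e.eval O σ θ τ env with
    | some (some a), some v => some (τ.set s f a v)
    | some none, some _ => some τ
    | _, _ => none
  | _, .seq c d, env, τ => (c.exec O σ θ env τ).bind fun τ' => d.exec O σ θ env τ'
  | _, .ite b c d, env, τ =>
    match b.eval O σ θ τ env with
    | some true => c.exec O σ θ env τ
    | some false => d.exec O σ θ env τ
    | none => none
  | _, .par g c, env, τ =>
    if ∀ z : Fin n, (z : ℕ) ≤ g.toFun n → (c.exec O σ θ (Fin.snoc env z) τ).isSome
    then mergeBranches (g.toFun n) τ fun z => (c.exec O σ θ (Fin.snoc env z) τ).getD τ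
    else none

/-- Execution of an initial procedure; it also acts on the states of the supplementary instances.
A change invocation with an argument `⊥` has no effect. -/
def Init.exec (O : (i : Fin Γ.k) → Sem n (Γ.sub i) (S i)) (σ : Struct Γ.aux n) {m : ℕ}
    (env : Fin m → Fin n) :
    Init Γ m → ((i : Fin Γ.k) → S i) × Struct Γ.tmp n →
      Option (((i : Fin Γ.k) → S i) × Struct Γ.tmp n)
  | .cmd c, (θ, τ) => (c.exec O σ θ env τ).map fun τ' => (θ, τ')
  | .change i δ args, (θ, τ) =>
    match evalArgs O σ θ τ env args with
    | some (some a) => ((O i).change (θ i) δ a).map fun x => (Function.update θ i x, τ)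
    | some none => some (θ, τ)
    | none => none
  | .seq c d, x => (c.exec O σ env x).bind fun y => d.exec O σ env y
  | .ite b c d, x =>
    match b.eval O σ x.1 x.2 env with
    | some true => c.exec O σ env x
    | some false => d.exec O σ env x
    | none => none

/-- The value returned by a main procedure. -/
def Body.run (O : (i : Fin Γ.k) → Sem n (Γ.sub i) (S i)) (σ : Struct Γ.aux n)
    (θ : (i : Fin Γ.k) → S i) {m : ℕ} {s : Srt} (env : Fin m → Fin n) :
    Body Γ m s → Struct Γ.tmp n → Option (Val n s)
  | .ret e, τ => e.eval O σ θ τ env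
  | .step c B, τ => (c.exec O σ θ env τ).bind fun τ' => B.run O σ θ env τ'
  | .ite b B C, τ =>
    match b.eval O σ θ τ env with
    | some true => B.run O σ θ env τ
    | some false => C.run O σ θ env τ
    | none => none

/-- The new value at a tuple whose old value is `old` and for which the evaluations of the main
procedure with this tuple as head return the set `V` of values. For a relation, the tuple
is in the new relation if `true` is returned at least once; for a function, the
returned values have to agree. -/
def combine : (s : Srt) → Val n s → Set (Val n s) → Option (Val n s)
  | .rel, old, V => some (if true ∈ V then true else if false ∈ V then false else old)
  | .fn, old, V =>
    if V = ∅ then some old else if h : ∃ v, V = {v} then some h.choose else none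

end Semantics

noncomputable section RuleSemantics
open scoped Classical

variable {n : ℕ} {aux : Schema} {k : ℕ} {J : Fin k → Interface} {S : Fin k → Type}

/-- The effect of an update rule with parameters `a`, all of it evaluated on the old auxiliary
structure `σ`: the new interpretation of the updated symbol and the new states of the supplementary
instances. The initial procedure is executed once, the main procedure once
(and independently) for every tuple `b` that satisfies the constraint. -/
def UpdRule.eval {p : ℕ} {s : Srt} {f : Fin (aux.num s)} (r : UpdRule aux J p s f)
    (O : (i : Fin k) → Sem n (J i) (S i)) (σ : Struct aux n) (θ : (i : Fin k) → S i)
    (a : Fin p → Fin n) :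
    Option (((Fin (aux.arity s f) → Fin n) → Val n s) × ((i : Fin k) → S i)) :=
  (r.init.exec (Γ := ⟨aux, r.tmp, k, J⟩) O σ a (θ, Struct.empty r.tmp n)).bind fun x =>
    let hd := fun b : Fin r.l → Fin n =>
      evalArgs (Γ := ⟨aux, r.tmp, k, J⟩) O σ x.1 x.2 (Fin.append a b) r.head
    let bd := fun b : Fin r.l → Fin n =>
      r.body.run (Γ := ⟨aux, r.tmp, k, J⟩) O σ x.1 (Fin.append a b) x.2
    let ok := fun b : Fin r.l → Fin n => ∀ i, (b i : ℕ) ≤ (r.bound i).toFun n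
    let new := fun c => combine s (σ s f c) {v | ∃ b, ok b ∧ hd b = some (some c) ∧ bd b = some v}
    if h : (∀ b, ok b → (hd b).isSome ∧ (bd b).isSome) ∧ ∀ c, (new c).isSome
    then some (fun c => (new c).get (h.2 c), x.1) else none

/-- The effect of a single update rule on the whole state. -/
def UpdRule.apply {p : ℕ} {s : Srt} {f : Fin (aux.num s)} (r : UpdRule aux J p s f)
    (O : (i : Fin k) → Sem n (J i) (S i)) (st : Struct aux n × ((i : Fin k) → S i))
    (a : Fin p → Fin n) : Option (Struct aux n × ((i : Fin k) → S i)) :=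
  (r.eval O st.1 st.2 a).map fun y =>
    (Function.update st.1 s (Function.update (st.1 s) f y.1), y.2)

/-- The answer of a query rule. -/
def QryRule.eval {p : ℕ} {s : Srt} (r : QryRule aux J p s)
    (O : (i : Fin k) → Sem n (J i) (S i)) (st : Struct aux n × ((i : Fin k) → S i))
    (a : Fin p → Fin n) : Option (Val n s) :=
  r.body.run (Γ := ⟨aux, r.tmp, k, J⟩) O st.1 st.2 a (Struct.empty r.tmp n)

/-- The effect of a change operation with the update rules `upd`: all rules are evaluated on the
old state; every symbol is taken from its rule, every supplementary instance from the rule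
that invokes change operations for it. -/
def applyRules {p : ℕ}
    (upd : (s : Srt) → (f : Fin (aux.num s)) → Option (UpdRule aux J p s f))
    (O : (i : Fin k) → Sem n (J i) (S i)) (st : Struct aux n × ((i : Fin k) → S i))
    (a : Fin p → Fin n) : Option (Struct aux n × ((i : Fin k) → S i)) :=
  if ∀ s f r, upd s f = some r → (r.eval O st.1 st.2 a).isSome then
    some
      (fun s f =>
        match (upd s f).bind fun r => r.eval O st.1 st.2 a with
        | some y => y.1
        | none => st.1 s f,
      fun i =>
        if h : ∃ (x : (s : Srt) × Fin (aux.num s)) (r : UpdRule aux J p x.1 x.2),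
            upd x.1 x.2 = some r ∧ r.Invokes i
        then match (upd h.choose.1 h.choose.2).bind fun r => r.eval O st.1 st.2 a with
          | some y => y.2 i
          | none => st.2 i
        else st.2 i)
  else none

end RuleSemantics

/-- The states of a program over the domain `[n]`: an auxiliary structure and the states of the
supplementary instances (over the same domain). -/
@[reducible] def Prog.State (n : ℕ) : {I : Interface} → Prog I → Type
  | _, .mk aux k _ sub _ _ => Struct aux n × ((i : Fin k) → (sub i).State n)

/-- The meaning of the operations of a program. -/
noncomputable def Prog.sem (n : ℕ) : {I : Interface} → (P : Prog I) → Sem n I (P.State n)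
  | _, .mk _ _ _ sub upd qry =>
    { query := fun st s q a => (qry s q).eval (fun i => (sub i).sem n) st a
      change := fun st δ a => applyRules (upd δ) (fun i => (sub i).sem n) st a }

/-! # The work-bounding function -/

/-- Bounds for the query and change operations of a program. -/
structure WorkBound (I : Interface) where
  qry : (s : Srt) → Fin (I.qry.num s) → ℕ
  chg : Fin I.chg → ℕ

/-- `max(1, u₁, …, u_k)`. -/
def maxOne {k : ℕ} (u : Fin k → ℕ) : ℕ := max 1 (Finset.univ.sup u)

section WorkBounds
variable {Γ : Ctx} (n : ℕ) (W : (i : Fin Γ.k) → WorkBound (Γ.sub i))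

def Expr.work : {m : ℕ} → {s : Srt} → Expr Γ m s → ℕ
  | _, _, .bot => 1
  | _, _, .var _ => 1
  | _, _, .add a b => max a.work b.work
  | _, _, .mul a b => max a.work b.work
  | _, _, .sym _ _ args => maxOne fun i => (args i).work
  | _, _, .loc _ _ args => maxOne fun i => (args i).work
  | _, _, .ask i s q args => max (maxOne fun j => (args j).work) ((W i).qry s q)
  | _, _, .ite c t e => max c.work (max t.work e.work)
  | _, _, .unique g c => max 1 (g.toFun n) * c.work
  | _, _, .eq a b => max a.work b.work
  | _, _, .le a b => max a.work b.work
  | _, _, .neg c => c.work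
  | _, _, .and c d => max c.work d.work
  | _, _, .or c d => max c.work d.work
  | _, _, .ex g c => max 1 (g.toFun n) * c.work

def Cmd.work : {m : ℕ} → Cmd Γ m → ℕ
  | _, .skip => 1
  | _, .assign _ _ args e => max (maxOne fun i => (args i).work n W) (e.work n W)
  | _, .seq c d => max c.work d.work
  | _, .ite b c d => max (b.work n W) (max c.work d.work)
  | _, .par g c => max 1 (g.toFun n) * c.work

def Init.work {m : ℕ} : Init Γ m → ℕ
  | .cmd c => c.work n W
  | .change i δ args => max (maxOne fun j => (args j).work n W) ((W i).chg δ)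
  | .seq c d => max c.work d.work
  | .ite b c d => max (b.work n W) (max c.work d.work)

def Body.work {m : ℕ} {s : Srt} : Body Γ m s → ℕ
  | .ret e => e.work n W
  | .step c B => max (c.work n W) B.work
  | .ite b B C => max (b.work n W) (max B.work C.work)

end WorkBounds

/-- `max (w(P₁), g₁(n) ⋯ g_l(n) · w(P₂))`, where the head terms are counted with `P₂`. -/
def UpdRule.work (n : ℕ) {aux : Schema} {k : ℕ} {J : Fin k → Interface} {p : ℕ} {s : Srt}
    {f : Fin (aux.num s)} (W : (i : Fin k) → WorkBound (J i)) (r : UpdRule aux J p s f) : ℕ :=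
  max (r.init.work (Γ := ⟨aux, r.tmp, k, J⟩) n W)
    ((∏ i, max 1 ((r.bound i).toFun n)) *
      max (maxOne fun j => (r.head j).work (Γ := ⟨aux, r.tmp, k, J⟩) n W)
        (r.body.work (Γ := ⟨aux, r.tmp, k, J⟩) n W))

def QryRule.work (n : ℕ) {aux : Schema} {k : ℕ} {J : Fin k → Interface} {p : ℕ} {s : Srt}
    (W : (i : Fin k) → WorkBound (J i)) (r : QryRule aux J p s) : ℕ :=
  r.body.work (Γ := ⟨aux, r.tmp, k, J⟩) n W

/-- The bounds for all operations of a program; for a change operation the maximum over its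
update rules. -/
def Prog.work (n : ℕ) : {I : Interface} → Prog I → WorkBound I
  | _, .mk aux _ _ sub upd qry =>
    { qry := fun s q => (qry s q).work n fun i => (sub i).work n
      chg := fun δ =>
        let w := fun (s : Srt) (f : Fin (aux.num s)) =>
          match upd δ s f with
          | some r => r.work n fun i => (sub i).work n
          | none => 0
        max (Finset.univ.sup (w .rel)) (Finset.univ.sup (w .fn)) }

/-! # CRAMs -/

/-- Numbers that depend on the domain size `n`: constants, the values of definable functions (cut
off at `n`, so `g(n) = n` yields `n` itself), and sums and products of such. -/
inductive NumExpr
  | lit (c : ℕ)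
  | num (g : NumFun)
  | add (a b : NumExpr)
  | mul (a b : NumExpr)

def NumExpr.eval (n : ℕ) : NumExpr → ℕ
  | .lit c => c
  | .num g => min (g.toFun n) n
  | .add a b => a.eval n + b.eval n
  | .mul a b => a.eval n * b.eval n

/-- The arithmetical operations of a processor: truncated subtraction, division rounded down;
`lt` yields `1` or `0`. -/
inductive ArithOp
  | add
  | sub
  | mul
  | div
  | lt

def ArithOp.eval : ArithOp → ℕ → ℕ → ℕ
  | .add, a, b => a + b
  | .sub, a, b => a - b
  | .mul, a, b => a * b
  | .div, a, b => a / b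
  | .lt, a, b => if a < b then 1 else 0

/-- Instructions of a processor with registers `R 0, R 1, …` and shared memory `M`. -/
inductive Instr
  /-- `R r := e(n)` -/
  | const (r : ℕ) (e : NumExpr)
  /-- `R r :=` number of the processor -/
  | pid (r : ℕ)
  /-- `R r := R a op R b` -/
  | arith (op : ArithOp) (r a b : ℕ)
  /-- `R r := M (R a)` -/
  | load (r a : ℕ)
  /-- `M (R a) := R r` -/
  | store (a r : ℕ)
  /-- if `R r = 0` go to line `l` -/
  | jumpZero (r l : ℕ)

/-- A CRAM program: one finite program, executed synchronously by `procs(n)` processors. A processor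
halts when it leaves the program. -/
structure CRAM where
  procs : NumExpr
  code : List Instr

/-- Program counter and registers of a processor. -/
structure ProcState where
  pc : ℕ
  reg : ℕ → ℕ

structure Config (p : ℕ) where
  mem : ℕ → ℕ
  proc : Fin p → ProcState

/-- The effect of an instruction on the processor number `i`. -/
def Instr.next (n i : ℕ) (mem : ℕ → ℕ) (x : ProcState) : Instr → ProcState
  | .const r e => ⟨x.pc + 1, Function.update x.reg r (e.eval n)⟩
  | .pid r => ⟨x.pc + 1, Function.update x.reg r i⟩
  | .arith op r a b => ⟨x.pc + 1, Function.update x.reg r (op.eval (x.reg a) (x.reg b))⟩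
  | .load r a => ⟨x.pc + 1, Function.update x.reg r (mem (x.reg a))⟩
  | .store _ _ => ⟨x.pc + 1, x.reg⟩
  | .jumpZero r l => ⟨if x.reg r = 0 then l else x.pc + 1, x.reg⟩

/-- The address and the value written by an instruction, if any. -/
def Instr.write (x : ProcState) : Instr → Option (ℕ × ℕ)
  | .store a r => some (x.reg a, x.reg r)
  | _ => none

namespace CRAM
variable (M : CRAM) (n : ℕ)

/-- The processor has not halted. -/
def Active (x : ProcState) : Prop := x.pc < M.code.length

def writeOf (x : ProcState) : Option (ℕ × ℕ) := M.code[x.pc]?.bind fun ins => ins.write x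

/-- Processors that write to the same cell in the same step write the same value. -/
def Legal {p : ℕ} (c : Config p) : Prop :=
  ∀ (i j : Fin p) (x v v' : ℕ),
    M.writeOf (c.proc i) = some (x, v) → M.writeOf (c.proc j) = some (x, v') → v = v'

open scoped Classical in
/-- One synchronous step; all reads precede all writes. -/
noncomputable def step {p : ℕ} (c : Config p) : Config p where
  mem := fun x =>
    if h : ∃ v, ∃ i, M.writeOf (c.proc i) = some (x, v) then h.choose else c.mem x
  proc := fun i =>
    match M.code[(c.proc i).pc]? with
    | some ins => ins.next n i c.mem (c.proc i)
    | none => c.proc i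

/-- The configuration after `t` steps, starting with memory `mem`. -/
noncomputable def run (mem : ℕ → ℕ) (t : ℕ) : Config (M.procs.eval n) :=
  (M.step n)^[t] ⟨mem, fun _ => ⟨0, fun _ => 0⟩⟩

open scoped Classical in
/-- The number of computation steps of all processors during the first `t` steps. -/
noncomputable def workUpTo (mem : ℕ → ℕ) (t : ℕ) : ℕ :=
  ∑ u ∈ Finset.range t, (Finset.univ.filter fun i => M.Active ((M.run n mem u).proc i)).card

/-- Started with memory `mem`, the program halts legally with memory `mem'`, after at
most `T` steps and with work at most `W`. -/
def Computes (mem mem' : ℕ → ℕ) (T W : ℕ) : Prop :=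
  ∃ t ≤ T, (∀ u < t, M.Legal (M.run n mem u)) ∧
    (∀ i, ¬ M.Active ((M.run n mem t).proc i)) ∧
    (M.run n mem t).mem = mem' ∧ M.workUpTo n mem t ≤ W

end CRAM

/-! # Memory layout -/

/-- Truth values are stored as `0`, `1`; `⊥` is stored as `0` and the element `v` as `v + 1`. -/
def Val.code {n : ℕ} : {s : Srt} → Val n s → ℕ
  | .rel, v => match v with
    | true => 1
    | false => 0
  | .fn, v => match v with
    | none => 0
    | some (x : Fin n) => (x : ℕ) + 1

/-- Memory is divided into banks: cell `j` of bank `b` has the address `Nat.pair b j`. Bank `0`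
contains the output (cell `0`) and the parameters (cell `j + 1` for parameter `j`). -/
def outAddr : ℕ := Nat.pair 0 0

def paramAddr (j : ℕ) : ℕ := Nat.pair 0 (j + 1)

/-- The address of the entry at tuple `a` of symbol `f` of the instance with number `c`. Every
symbol has a bank of its own, in which tuples are numbered in base `n`. -/
def symAddr {n k : ℕ} (c : ℕ) (s : Srt) (f : ℕ) (a : Fin k → Fin n) : ℕ :=
  Nat.pair (Nat.pair c (Nat.pair (match s with | .rel => 0 | .fn => 1) f) + 1)
    (∑ i, (a i : ℕ) * n ^ (i : ℕ))

/-- In the encoding of the state `st` of an instance with number `c`, the cell `x` has the value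
`v`. The `i`-th supplementary instance of the instance `c` has the number `Nat.pair c i + 1`. -/
def Prog.Holds (n : ℕ) : {I : Interface} → (P : Prog I) → (c : ℕ) → P.State n → ℕ → ℕ → Prop
  | _, .mk aux _ _ sub _ _, c, st, x, v =>
    (∃ (s : Srt) (f : Fin (aux.num s)) (a : Fin (aux.arity s f) → Fin n),
      x = symAddr c s f a ∧ v = (st.1 s f a).code) ∨
    ∃ i, (sub i).Holds n (Nat.pair c i + 1) (st.2 i) x v

/-- The memory contains the state `st` of the main instance (which has number `0`). -/
def Prog.Stores {n : ℕ} {I : Interface} (P : Prog I) (st : P.State n) (mem : ℕ → ℕ) : Prop :=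
  ∀ x v, P.Holds n 0 st x v → mem x = v

/-- The memory contains exactly the state `st` and the parameters `a`; all other cells are `0`. -/
def Prog.Input {n : ℕ} {I : Interface} (P : Prog I) (st : P.State n) {k : ℕ} (a : Fin k → Fin n)
    (mem : ℕ → ℕ) : Prop :=
  P.Stores st mem ∧ (∀ j : Fin k, mem (paramAddr j) = a j) ∧
    ∀ x, (∀ v, ¬ P.Holds n 0 st x v) → (∀ j : Fin k, x ≠ paramAddr j) → mem x = 0

/-! Every rule is compiled to jump-free code. Its unit is the `Kernel`: for all `i < N(n)` with
nonzero mask, store a value in a cell of one fixed bank. All processors execute the same instruction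
at the same time, and those that are switched off write `0` to a dummy cell. The time is the length
of the code, a constant, and the work is at most this length times the number of processors
(`CRAM.computes_ofKernels`). What remains is to find, for each rule, a fixed list of kernels whose
sizes are `O(w(π))`.

Parallelism is organised by vectors of contexts: `Amb` is the static description of such a vector,
`Ghost` its meaning. A bounded variable multiplies the number of contexts by `min(g(n), n) + 1 ≤ 2 *
max(1, g(n))`, which is the factor in the work-bounding function up to `2`; the nesting depth is
fixed by the program. A conditional only restricts the mask, so that a branch that is not taken, and
that may be meaningless, is not evaluated. The result of a term is a static expression, read at the
number of the context. Quantifiers need a real write: witnesses write into the cell of the context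
they belong to, without conflict because the value is constant (`eClaim_ex`) or the witness is
unique (`eClaim_unique`).

A structure may have far more entries than the work permits, hence none is ever copied. Assigned
symbols are seen through a view, an expression in the context and the address; an assignment puts a
fresh bank on top of the old view. Beside it, a log of size `O(work)` lists all places where the
view may have changed. Parallel branches are merged by visiting the logs only (`cClaim_par`), and
the merge condition of the semantics excludes conflicts. Changes of the stored state are treated in
the same way, by a `Delta`.

In an update rule the initial procedure runs in a single context and the main procedure in one
context for every tuple `x̄`, followed by writes at the heads (`ruleBlk`). The supplementary
instances are handled by induction on the program, with `QClaim` (queries, in many contexts at once)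
and `ChgClaim` (changes, in one context). The banks of different instances are disjoint, and
well-formedness assigns every bank to at most one rule of a change operation, so the results of all
rules fit together (`chgClaim_mk`). Only at the very end are the logged cells copied into the state
(`Blk.exists_cram_commit`).

`Blk` is the logic in which all this is expressed: kernels and static results are chosen before `n`
and the state, which enter as ghost values. Blocks are composed by `Blk.bind`, and `Blk.write` is
the one primitive that contributes kernels to a block. -/

/-! # Straight-line programs on a CRAM -/

/-- Expressions a processor can evaluate without jumps. -/
inductive RExp
  | num (e : NumExpr)
  | pid
  | op (o : ArithOp) (a b : RExp)
  | load (a : RExp)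

namespace RExp

def eval (n i : ℕ) (mem : ℕ → ℕ) : RExp → ℕ
  | num e => e.eval n
  | pid => i
  | op o a b => o.eval (a.eval n i mem) (b.eval n i mem)
  | load a => mem (a.eval n i mem)

/-- Code that leaves the value in register `r` and does not change the registers below `r`. -/
def code : RExp → ℕ → List Instr
  | num e, r => [.const r e]
  | pid, r => [.pid r]
  | op o a b, r => a.code r ++ (b.code (r + 1) ++ [.arith o r r (r + 1)])
  | load a, r => a.code r ++ [.load r r]

/-- The pairing function on `ℕ` as an expression. -/
def pair (a b : RExp) : RExp :=
  .op .add (.op .mul (.op .lt a b) (.op .add (.op .mul b b) a))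
    (.op .mul (.op .sub (.num (.lit 1)) (.op .lt a b)) (.op .add (.op .add (.op .mul a a) a) b))

theorem eval_pair (n i : ℕ) (mem : ℕ → ℕ) (a b : RExp) :
    (pair a b).eval n i mem = Nat.pair (a.eval n i mem) (b.eval n i mem) := by
  simp only [pair, eval, ArithOp.eval, NumExpr.eval, Nat.pair]
  split_ifs <;> simp

end RExp

namespace CRAM
variable {M : CRAM} {n p : ℕ}

/-- The code contains the block `is` at line `q`. -/
def CodeAt (M : CRAM) (q : ℕ) (is : List Instr) : Prop :=
  ∀ k, k < is.length → M.code[q + k]? = is[k]?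

theorem CodeAt.left {q : ℕ} {is js : List Instr} (h : M.CodeAt q (is ++ js)) : M.CodeAt q is := by
  intro k hk
  rw [h k (by simp; omega), List.getElem?_append_left hk]

theorem CodeAt.right {q : ℕ} {is js : List Instr} (h : M.CodeAt q (is ++ js)) :
    M.CodeAt (q + is.length) js := by
  intro k hk
  rw [add_assoc, h (is.length + k) (by simp; omega), List.getElem?_append_right (by omega)]
  simp

theorem CodeAt.head {q : ℕ} {ins : Instr} {is : List Instr} (h : M.CodeAt q (ins :: is)) :
    M.code[q]? = some ins := by
  simpa using h 0 (by simp)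

/-- `c'` is reached from `c` in `t` steps without write conflicts. -/
def Reach (M : CRAM) (n : ℕ) (c c' : Config p) (t : ℕ) : Prop :=
  (M.step n)^[t] c = c' ∧ ∀ u < t, M.Legal ((M.step n)^[u] c)

theorem Reach.trans {c c' c'' : Config p} {t t' : ℕ} (h : M.Reach n c c' t)
    (h' : M.Reach n c' c'' t') : M.Reach n c c'' (t + t') := by
  refine ⟨by rw [add_comm, Function.iterate_add_apply, h.1, h'.1], fun u hu => ?_⟩
  by_cases hut : u < t
  · exact h.2 u hut
  · obtain ⟨v, rfl⟩ := Nat.exists_eq_add_of_le (not_lt.1 hut)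
    rw [add_comm, Function.iterate_add_apply, h.1]
    exact h'.2 v (by omega)

theorem Reach.cast {c c' : Config p} {t t' : ℕ} (h : M.Reach n c c' t) (e : t = t') :
    M.Reach n c c' t' := e ▸ h

/-- Without writes a step is legal for trivial reasons and leaves the memory alone. -/
theorem reach_quiet {c : Config p} {q : ℕ} {ins : Instr} (hc : M.code[q]? = some ins)
    (hpc : ∀ i, (c.proc i).pc = q) (hw : ∀ x, ins.write x = none) :
    M.Reach n c ⟨c.mem, fun i => ins.next n i c.mem (c.proc i)⟩ 1 := by
  have hwo : ∀ i, M.writeOf (c.proc i) = none := fun i => by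
    simp [writeOf, hpc, hc, hw]
  refine ⟨?_, fun u hu => ?_⟩
  · simp [step, hpc, hc, hwo]
  · obtain rfl : u = 0 := by omega
    intro i j x v v' h
    simp [hwo] at h

/-- Since there are no jumps, all processors stay at the same line. The registers from `r` on serve
as an evaluation stack. -/
theorem reach_exp (e : RExp) : ∀ (r q : ℕ) (c : Config p), M.CodeAt q (e.code r) →
    (∀ i, (c.proc i).pc = q) →
    ∃ c', M.Reach n c c' (e.code r).length ∧ c'.mem = c.mem ∧
      ∀ i, (c'.proc i).pc = q + (e.code r).length ∧ (c'.proc i).reg r = e.eval n i c.mem ∧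
        ∀ r' < r, (c'.proc i).reg r' = (c.proc i).reg r' := by
  induction e with
  | num e =>
    intro r q c hc hpc
    refine ⟨_, reach_quiet hc.head hpc fun _ => rfl, rfl, fun i => ⟨?_, ?_, fun r' hr => ?_⟩⟩
    · simp [Instr.next, hpc, RExp.code]
    · simp [Instr.next, RExp.eval]
    · simp [Instr.next, hr.ne]
  | pid =>
    intro r q c hc hpc
    refine ⟨_, reach_quiet hc.head hpc fun _ => rfl, rfl, fun i => ⟨?_, ?_, fun r' hr => ?_⟩⟩
    · simp [Instr.next, hpc, RExp.code]
    · simp [Instr.next, RExp.eval]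
    · simp [Instr.next, hr.ne]
  | op o a b iha ihb =>
    intro r q c hc hpc
    obtain ⟨c1, h1, hm1, hp1⟩ := iha r q c hc.left hpc
    -- The value of `a` in register `r` survives, because the code for `b` only touches registers
    -- from `r + 1` on.
    obtain ⟨c2, h2, hm2, hp2⟩ := ihb (r + 1) _ c1 hc.right.left fun i => (hp1 i).1
    refine ⟨_, (h1.trans (h2.trans (reach_quiet hc.right.right.head (fun i => (hp2 i).1)
      fun _ => rfl))).cast (by simp [RExp.code]), ?_, ?_⟩
    · simp [hm1, hm2]
    · intro i
      refine ⟨?_, ?_, fun r' hr => ?_⟩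
      · simp [Instr.next, hp2, RExp.code]; omega
      · simp [Instr.next, RExp.eval, hp2, hp1, hm1]
      · simp [Instr.next, hr.ne]
        rw [(hp2 i).2.2 _ (by omega), (hp1 i).2.2 _ hr]
  | load a iha =>
    intro r q c hc hpc
    obtain ⟨c1, h1, hm1, hp1⟩ := iha r q c hc.left hpc
    refine ⟨_, (h1.trans (reach_quiet hc.right.head (fun i => (hp1 i).1)
      fun _ => rfl)).cast (by simp [RExp.code]), ?_, ?_⟩
    · simp [hm1]
    · intro i
      refine ⟨?_, ?_, fun r' hr => ?_⟩
      · simp [Instr.next, hp1, RExp.code]; omega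
      · simp [Instr.next, RExp.eval, hp1, hm1]
      · simp [Instr.next, hr.ne]
        rw [(hp1 i).2.2 _ hr]

/-- Code for "every processor stores `val` at `addr`". -/
def storeCode (addr val : RExp) : List Instr :=
  addr.code 0 ++ (val.code 1 ++ [.store 0 1])

/-- Legality is implied by `hw`: processors with the same address all write the value that the one
function `mem'` has there. -/
theorem reach_store (addr val : RExp) (q : ℕ) (c : Config p) (mem' : ℕ → ℕ)
    (hc : M.CodeAt q (storeCode addr val)) (hpc : ∀ i, (c.proc i).pc = q)
    (hw : ∀ i < p, mem' (addr.eval n i c.mem) = val.eval n i c.mem)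
    (hn : ∀ x, (∀ i < p, addr.eval n i c.mem ≠ x) → mem' x = c.mem x) :
    ∃ c', M.Reach n c c' (storeCode addr val).length ∧ c'.mem = mem' ∧
      ∀ i, (c'.proc i).pc = q + (storeCode addr val).length := by
  obtain ⟨c1, h1, hm1, hp1⟩ := reach_exp (n := n) addr 0 q c hc.left hpc
  obtain ⟨c2, h2, hm2, hp2⟩ := reach_exp (n := n) val 1 _ c1 hc.right.left fun i => (hp1 i).1
  have hins := hc.right.right.head
  have hwo : ∀ i : Fin p, M.writeOf (c2.proc i) =
      some (addr.eval n i c.mem, val.eval n i c.mem) := fun i => by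
    simp [writeOf, hp2, hins, Instr.write, hp1, hm1]
  have hstep : M.Reach n c2 (M.step n c2) 1 := by
    refine ⟨rfl, fun u hu => ?_⟩
    obtain rfl : u = 0 := by omega
    intro i j x v v' h h'
    simp only [Function.iterate_zero, id_eq, hwo, Option.some.injEq, Prod.mk.injEq] at h h'
    rw [← h.2, ← h'.2, ← hw i i.2, ← hw j j.2, h.1, h'.1]
  refine ⟨_, (h1.trans (h2.trans hstep)).cast (by simp [storeCode]), ?_, ?_⟩
  · funext x
    simp only [step]
    split_ifs with h
    · obtain ⟨i, hi⟩ := h.choose_spec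
      rw [hwo] at hi
      simp only [Option.some.injEq, Prod.mk.injEq] at hi
      rw [← hi.2, ← hw i i.2, hi.1]
    · rw [hn x fun i hi hx => h ⟨_, ⟨i, hi⟩, by rw [hwo, hx]⟩, hm2, hm1]
  · intro i
    simp [step, hp2, hins, Instr.next, storeCode]
    omega

end CRAM

/-! # Kernels: masked parallel stores on banked memory -/

/-- Memory divided into banks: bank number, cell number. -/
abbrev BMem := ℕ → ℕ → ℕ

/-- Expressions over numbered variables that read memory banks with fixed numbers. -/
inductive SExp
  | num (e : NumExpr)
  | var (k : ℕ)
  | op (o : ArithOp) (a b : SExp)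
  | load (b : ℕ) (e : SExp)

namespace SExp

def eval (n : ℕ) (m : BMem) (ρ : ℕ → ℕ) : SExp → ℕ
  | num e => e.eval n
  | var k => ρ k
  | op o a b => o.eval (a.eval n m ρ) (b.eval n m ρ)
  | load b e => m b (e.eval n m ρ)

def subst (σ : ℕ → SExp) : SExp → SExp
  | num e => num e
  | var k => σ k
  | op o a b => op o (a.subst σ) (b.subst σ)
  | load b e => load b (e.subst σ)

theorem eval_subst (n : ℕ) (m : BMem) (ρ : ℕ → ℕ) (σ : ℕ → SExp) (e : SExp) :
    (e.subst σ).eval n m ρ = e.eval n m fun k => (σ k).eval n m ρ := by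
  induction e with
  | num e => rfl
  | var k => rfl
  | op o a b iha ihb => simp [subst, eval, iha, ihb]
  | load b e ih => simp [subst, eval, ih]

/-- The expression with all variables read as the number of the processor. -/
def raw : SExp → RExp
  | num e => .num e
  | var _ => .pid
  | op o a b => .op o a.raw b.raw
  | load b e => .load (.pair (.num (.lit b)) e.raw)

theorem eval_raw (n i : ℕ) (mem : ℕ → ℕ) (e : SExp) :
    e.raw.eval n i mem = e.eval n (fun b x => mem (Nat.pair b x)) fun _ => i := by
  induction e with
  | num e => rfl
  | var k => rfl
  | op o a b iha ihb => simp [raw, eval, RExp.eval, iha, ihb]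
  | load b e ih => simp [raw, eval, RExp.eval, RExp.eval_pair, ih, NumExpr.eval]

end SExp

/-- The numbers of the banks for intermediate results; bank `0` of these is a dummy target. -/
def tmpBank (k : ℕ) : ℕ := Nat.pair 0 (Nat.pair 2 k) + 1

/-- For all `i < N(n)` with `mask ≠ 0`, write `val` into cell `cell` of bank `b`. -/
structure Kernel where
  b : ℕ
  N : NumExpr
  mask : SExp
  cell : SExp
  val : SExp

namespace Kernel

/-- Processor number `i` writes. -/
def On (k : Kernel) (n : ℕ) (m : BMem) (i : ℕ) : Prop :=
  i < k.N.eval n ∧ k.mask.eval n m (fun _ => i) ≠ 0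

/-- The requirement is a relation rather than a function on memories: if two active processors want
different values in one cell, no `m'` qualifies, so the existence of `m'` contains the absence of
write conflicts. -/
def Step (p n : ℕ) (k : Kernel) (m m' : BMem) : Prop :=
  (∀ i < p, k.On n m i →
    m' k.b (k.cell.eval n m fun _ => i) = k.val.eval n m fun _ => i) ∧
  ∀ b x, (b = k.b → ∀ i < p, k.On n m i → k.cell.eval n m (fun _ => i) ≠ x) → m' b x = m b x

def flag (k : Kernel) : RExp :=
  .op .mul (.op .lt .pid (.num k.N)) (.op .lt (.num (.lit 0)) k.mask.raw)

/-- Masking without jumps: the flag is `0` or `1` and selects between the real target and the dummy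
cell by multiplication. -/
def addr (k : Kernel) : RExp :=
  .op .add (.op .mul k.flag (.pair (.num (.lit k.b)) k.cell.raw))
    (.op .mul (.op .sub (.num (.lit 1)) k.flag) (.num (.lit (Nat.pair (tmpBank 0) 0))))

def value (k : Kernel) : RExp := .op .mul k.flag k.val.raw

def code (k : Kernel) : List Instr := CRAM.storeCode k.addr k.value

open scoped Classical in
theorem eval_flag (k : Kernel) (n i : ℕ) (mem : ℕ → ℕ) :
    k.flag.eval n i mem = if k.On n (fun b x => mem (Nat.pair b x)) i then 1 else 0 := by
  simp only [flag, RExp.eval, ArithOp.eval, NumExpr.eval, SExp.eval_raw, On, Nat.pos_iff_ne_zero]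
  by_cases h : i < k.N.eval n <;>
    by_cases h' : k.mask.eval n (fun b x => mem (Nat.pair b x)) (fun _ => i) = 0 <;> simp [h, h']

end Kernel

/-- Execution of a list of kernels. -/
def Runs (p n : ℕ) : List Kernel → BMem → BMem → Prop
  | [], m, m' => m' = m
  | k :: ks, m, m' => ∃ m₁, k.Step p n m m₁ ∧ Runs p n ks m₁ m'

theorem Runs.append {p n : ℕ} {ks ls : List Kernel} : ∀ {m m' m'' : BMem},
    Runs p n ks m m' → Runs p n ls m' m'' → Runs p n (ks ++ ls) m m'' := by
  induction ks with
  | nil => intro m m' m'' h h'; cases h; exact h'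
  | cons k ks ih => rintro m m' m'' ⟨m₁, h₁, h⟩ h'; exact ⟨m₁, h₁, ih h h'⟩

namespace CRAM

/-- The invariant is that the dummy cell contains `0`. All idle processors write `0` there, so they
neither conflict with each other nor change the memory. -/
theorem reach_kernels {M : CRAM} {n p : ℕ} (ks : List Kernel) :
    ∀ (q : ℕ) (c : Config p) (m m' : BMem), (∀ k ∈ ks, k.b ≠ tmpBank 0) →
    M.CodeAt q (ks.flatMap Kernel.code) → (∀ i, (c.proc i).pc = q) →
    (∀ b x, c.mem (Nat.pair b x) = m b x) → m (tmpBank 0) 0 = 0 → Runs p n ks m m' →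
    ∃ c', M.Reach n c c' (ks.flatMap Kernel.code).length ∧ (∀ b x, c'.mem (Nat.pair b x) = m' b x) ∧
      ∀ i, (c'.proc i).pc = q + (ks.flatMap Kernel.code).length := by
  induction ks with
  | nil =>
    rintro q c m m' - - hpc hm - h
    cases h
    exact ⟨c, ⟨rfl, by simp⟩, hm, by simpa using hpc⟩
  | cons k ks ih =>
    rintro q c m m' hb hc hpc hm h0 ⟨m₁, h₁, h⟩
    rw [List.flatMap_cons] at hc ⊢
    have hk := hb k (by simp)
    have hcm : (fun b x => c.mem (Nat.pair b x)) = m := by funext b x; exact hm b x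
    have haddr : ∀ i, (k.On n m i → k.addr.eval n i c.mem =
        Nat.pair k.b (k.cell.eval n m fun _ => i)) ∧
        (¬ k.On n m i → k.addr.eval n i c.mem = Nat.pair (tmpBank 0) 0) := fun i => by
      simp only [Kernel.addr, RExp.eval, ArithOp.eval, Kernel.eval_flag, RExp.eval_pair,
        NumExpr.eval, SExp.eval_raw]
      rw [hcm]
      constructor <;> intro h <;> simp [h]
    have hval : ∀ i, (k.On n m i → k.value.eval n i c.mem = k.val.eval n m fun _ => i) ∧
        (¬ k.On n m i → k.value.eval n i c.mem = 0) := fun i => by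
      simp only [Kernel.value, RExp.eval, ArithOp.eval, Kernel.eval_flag, SExp.eval_raw]
      rw [hcm]
      constructor <;> intro h <;> simp [h]
    have h10 : m₁ (tmpBank 0) 0 = 0 := by
      rw [h₁.2 _ _ fun h => absurd h.symm hk, h0]
    obtain ⟨c1, hr, hm1, hp1⟩ := reach_store (n := n) k.addr k.value q c
      (fun x => m₁ x.unpair.1 x.unpair.2) hc.left hpc
      (fun i hi => by
        by_cases hon : k.On n m i
        · rw [(haddr i).1 hon, (hval i).1 hon]
          simpa using h₁.1 i hi hon
        · rw [(haddr i).2 hon, (hval i).2 hon]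
          simpa using h10)
      -- A cell that no processor addresses is in particular not the target of an active one, so the
      -- kernel leaves it unchanged.
      (fun x hx => by
        rw [h₁.2, ← hm, Nat.pair_unpair]
        intro hbx i hi hon he
        apply hx i hi
        rw [(haddr i).1 hon, ← hbx, he, Nat.pair_unpair])
    obtain ⟨c2, hr2, hm2, hp2⟩ := ih (q + k.code.length) c1 m₁ m'
      (fun k hk => hb k (by simp [hk])) hc.right hp1 (by simp [hm1]) h10 h
    refine ⟨c2, ?_, hm2, fun i => ?_⟩
    · rw [List.length_append]; exact hr.trans hr2
    · rw [hp2, List.length_append, add_assoc]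

/-- The CRAM program that executes the kernels with `Q(n)` processors. -/
def ofKernels (Q : NumExpr) (ks : List Kernel) : CRAM := ⟨Q, ks.flatMap Kernel.code⟩

/-- All processors leave the code at the same moment, after as many steps as the code has lines; in
every step at most `Q(n)` of them work. -/
theorem computes_ofKernels (Q : NumExpr) (ks : List Kernel) (n : ℕ) (mem : ℕ → ℕ) (m' : BMem)
    (hb : ∀ k ∈ ks, k.b ≠ tmpBank 0) (h0 : mem (Nat.pair (tmpBank 0) 0) = 0)
    (h : Runs (Q.eval n) n ks (fun b x => mem (Nat.pair b x)) m') :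
    (ofKernels Q ks).Computes n mem (fun x => m' x.unpair.1 x.unpair.2)
      (ks.flatMap Kernel.code).length ((ks.flatMap Kernel.code).length * Q.eval n) := by
  obtain ⟨c, hr, hm, hp⟩ := reach_kernels (M := ofKernels Q ks) (n := n) ks 0
    ⟨mem, fun _ : Fin (Q.eval n) => ⟨0, fun _ => 0⟩⟩ _ m' hb (by intro k _; simp [ofKernels])
    (fun _ => rfl) (fun _ _ => rfl) h0 h
  refine ⟨_, le_rfl, hr.2, ?_, ?_, ?_⟩
  · intro i
    have : (ofKernels Q ks).run n mem (ks.flatMap Kernel.code).length = c := hr.1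
    rw [this, Active, hp i]
    simp [ofKernels]
  · have : (ofKernels Q ks).run n mem (ks.flatMap Kernel.code).length = c := hr.1
    rw [this]
    funext x
    rw [← hm, Nat.pair_unpair]
  · refine (Finset.sum_le_card_nsmul _ _ (Q.eval n) fun u _ => ?_).trans (by simp)
    exact (Finset.card_le_univ _).trans (by rw [Fintype.card_fin]; exact le_rfl)

end CRAM

/-! # Expressions: derived forms and the banks they read -/

/-- The sequence `x, y, y, …`. -/
def two {α : Type} (x y : α) : ℕ → α
  | 0 => x
  | _ + 1 => y

@[simp] theorem two_zero {α : Type} (x y : α) : two x y 0 = x := rfl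
@[simp] theorem two_one {α : Type} (x y : α) : two x y 1 = y := rfl

/-- The function `g(n) = n`, which has no value in the domain. -/
def NumFun.ident : NumFun where
  toFun := fun n => n
  definable := ⟨⊥, fun n a => by
    simp only [FirstOrder.Language.Formula.realize_bot, false_iff]
    exact a.2.ne⟩

/-- The domain size. -/
def NumExpr.size : NumExpr := .num NumFun.ident

/-- The number of candidates for a `z ≤ g(n)`. -/
def NumExpr.range (g : NumFun) : NumExpr := .add (.num g) (.lit 1)

def NumExpr.pow (e : NumExpr) : ℕ → NumExpr
  | 0 => .lit 1
  | k + 1 => .mul (e.pow k) e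

@[simp] theorem NumExpr.eval_size (n : ℕ) : NumExpr.size.eval n = n := min_self n

@[simp] theorem NumExpr.eval_pow (e : NumExpr) (n k : ℕ) : (e.pow k).eval n = e.eval n ^ k := by
  induction k with
  | zero => rfl
  | succ k ih => simp [NumExpr.pow, NumExpr.eval, ih, pow_succ]

namespace SExp

def lit (c : ℕ) : SExp := .num (.lit c)

/-- `a` if `c ≠ 0`, otherwise `b`. -/
def cond (c a b : SExp) : SExp :=
  .op .add (.op .mul (.op .lt (lit 0) c) a)
    (.op .mul (.op .sub (lit 1) (.op .lt (lit 0) c)) b)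

def pair (a b : SExp) : SExp :=
  cond (.op .lt a b) (.op .add (.op .mul b b) a) (.op .add (.op .add (.op .mul a a) a) b)

def mod (a b : SExp) : SExp := .op .sub a (.op .mul b (.op .div a b))

/-- `1` if `a ≠ b`, otherwise `0`. -/
def ne (a b : SExp) : SExp := .op .add (.op .lt a b) (.op .lt b a)

/-- Substitute `a` for all variables. -/
def at' (e a : SExp) : SExp := e.subst fun _ => a

/-- Substitute `a` for variable `0` and `b` for the other variables. -/
def app (e a b : SExp) : SExp := e.subst (two a b)

section
variable (n : ℕ) (m : BMem) (ρ : ℕ → ℕ)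

@[simp] theorem eval_num (e : NumExpr) : (num e).eval n m ρ = e.eval n := rfl
@[simp] theorem eval_var (k : ℕ) : (var k).eval n m ρ = ρ k := rfl
@[simp] theorem eval_load (b : ℕ) (e : SExp) : (load b e).eval n m ρ = m b (e.eval n m ρ) := rfl
@[simp] theorem eval_lit (c : ℕ) : (lit c).eval n m ρ = c := rfl
@[simp] theorem eval_add (a b : SExp) :
    (op .add a b).eval n m ρ = a.eval n m ρ + b.eval n m ρ := rfl
@[simp] theorem eval_sub (a b : SExp) :
    (op .sub a b).eval n m ρ = a.eval n m ρ - b.eval n m ρ := rfl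
@[simp] theorem eval_mul (a b : SExp) :
    (op .mul a b).eval n m ρ = a.eval n m ρ * b.eval n m ρ := rfl
@[simp] theorem eval_div (a b : SExp) :
    (op .div a b).eval n m ρ = a.eval n m ρ / b.eval n m ρ := rfl
@[simp] theorem eval_lt (a b : SExp) :
    (op .lt a b).eval n m ρ = if a.eval n m ρ < b.eval n m ρ then 1 else 0 := rfl

@[simp] theorem eval_cond (c a b : SExp) : (cond c a b).eval n m ρ =
    if c.eval n m ρ = 0 then b.eval n m ρ else a.eval n m ρ := by
  by_cases h : c.eval n m ρ = 0 <;> simp [cond, h, Nat.pos_iff_ne_zero]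

@[simp] theorem eval_pair (a b : SExp) :
    (pair a b).eval n m ρ = Nat.pair (a.eval n m ρ) (b.eval n m ρ) := by
  by_cases h : a.eval n m ρ < b.eval n m ρ <;> simp [pair, h, Nat.pair]

@[simp] theorem eval_mod (a b : SExp) :
    (mod a b).eval n m ρ = a.eval n m ρ % b.eval n m ρ := by
  simp [mod, Nat.mod_eq_sub]

@[simp] theorem eval_ne (a b : SExp) :
    (ne a b).eval n m ρ = if a.eval n m ρ = b.eval n m ρ then 0 else 1 := by
  rcases lt_trichotomy (a.eval n m ρ) (b.eval n m ρ) with h | h | h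
  · simp [ne, h, h.ne, h.le]
  · simp [ne, h]
  · simp [ne, h, h.ne', h.le]

@[simp] theorem eval_at (e a : SExp) :
    (e.at' a).eval n m ρ = e.eval n m fun _ => a.eval n m ρ := eval_subst ..

@[simp] theorem eval_app (e a b : SExp) :
    (e.app a b).eval n m ρ = e.eval n m (two (a.eval n m ρ) (b.eval n m ρ)) := by
  rw [app, eval_subst]
  congr 1
  funext k
  cases k <;> rfl

end

/-- The expression does not read the banks for intermediate results from number `ctr` on. -/
def Below (ctr : ℕ) : SExp → Prop
  | num _ => True
  | var _ => True
  | op _ a b => a.Below ctr ∧ b.Below ctr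
  | load b e => (∀ k, ctr ≤ k → b ≠ tmpBank k) ∧ e.Below ctr

theorem Below.mono {ctr ctr' : ℕ} (h : ctr ≤ ctr') {e : SExp} (he : e.Below ctr) :
    e.Below ctr' := by
  induction e with
  | num e => trivial
  | var k => trivial
  | op o a b iha ihb => exact ⟨iha he.1, ihb he.2⟩
  | load b e ih => exact ⟨fun k hk => he.1 k (h.trans hk), ih he.2⟩

variable {ctr : ℕ}

@[simp] theorem below_num (e : NumExpr) : (num e).Below ctr := trivial
@[simp] theorem below_var (k : ℕ) : (var k).Below ctr := trivial
@[simp] theorem below_lit (c : ℕ) : (lit c).Below ctr := trivial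
@[simp] theorem below_op (o : ArithOp) (a b : SExp) :
    (op o a b).Below ctr ↔ a.Below ctr ∧ b.Below ctr := Iff.rfl
@[simp] theorem below_load (b : ℕ) (e : SExp) :
    (load b e).Below ctr ↔ (∀ k, ctr ≤ k → b ≠ tmpBank k) ∧ e.Below ctr := Iff.rfl
@[simp] theorem below_cond (c a b : SExp) :
    (cond c a b).Below ctr ↔ c.Below ctr ∧ a.Below ctr ∧ b.Below ctr := by
  simp only [cond, below_op, below_lit]; tauto
@[simp] theorem below_pair (a b : SExp) : (pair a b).Below ctr ↔ a.Below ctr ∧ b.Below ctr := by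
  simp only [pair, below_cond, below_op]; tauto
@[simp] theorem below_mod (a b : SExp) : (mod a b).Below ctr ↔ a.Below ctr ∧ b.Below ctr := by
  simp only [mod, below_op]; tauto
@[simp] theorem below_ne (a b : SExp) : (ne a b).Below ctr ↔ a.Below ctr ∧ b.Below ctr := by
  simp only [ne, below_op]; tauto

theorem Below.subst {σ : ℕ → SExp} (hσ : ∀ k, (σ k).Below ctr) {e : SExp} (he : e.Below ctr) :
    (e.subst σ).Below ctr := by
  induction e with
  | num e => trivial
  | var k => exact hσ k
  | op o a b iha ihb => exact ⟨iha he.1, ihb he.2⟩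
  | load b e ih => exact ⟨he.1, ih he.2⟩

theorem Below.at {e a : SExp} (he : e.Below ctr) (ha : a.Below ctr) : (e.at' a).Below ctr :=
  he.subst fun _ => ha

theorem Below.app {e a b : SExp} (he : e.Below ctr) (ha : a.Below ctr) (hb : b.Below ctr) :
    (e.app a b).Below ctr :=
  he.subst fun k => by cases k <;> assumption

end SExp

/-- The memories agree outside of the banks for intermediate results from number `ctr` on. -/
def Agree (ctr : ℕ) (m m' : BMem) : Prop :=
  ∀ b, (∀ k, ctr ≤ k → b ≠ tmpBank k) → m' b = m b

theorem Agree.mono {ctr ctr' : ℕ} (h : ctr ≤ ctr') {m m' : BMem} (ha : Agree ctr' m m') :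
    Agree ctr m m' := fun b hb => ha b fun k hk => hb k (h.trans hk)

/-- This is why values need not be stored: an expression keeps its meaning while later kernels write
to banks from number `ctr` on. -/
theorem SExp.Below.eval_eq {ctr n : ℕ} {m m' : BMem} {ρ : ℕ → ℕ} {e : SExp} (he : e.Below ctr)
    (h : Agree ctr m m') : e.eval n m' ρ = e.eval n m ρ := by
  induction e with
  | num e => rfl
  | var k => rfl
  | op o a b iha ihb => simp [SExp.eval, iha he.1, ihb he.2]
  | load b e ih => simp [SExp.eval, ih he.2, h b he.1]

theorem tmpBank_injective : Function.Injective tmpBank := fun a b h => by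
  simpa [tmpBank] using h

theorem below_load_tmpBank {ctr k : ℕ} {e : SExp} :
    (SExp.load (tmpBank k) e).Below ctr ↔ k < ctr ∧ e.Below ctr := by
  rw [SExp.below_load]
  refine and_congr_left fun _ => ⟨fun h => ?_, fun h j hj hjk => ?_⟩
  · by_contra hk
    exact h k (by omega) rfl
  · have := tmpBank_injective hjk
    omega

/-! # Execution of kernels with a common target -/

section
open scoped Classical

/-- The kernels write into the banks in `S` and, by `hr`, do not depend on these banks, so their
order is irrelevant. By `hF` the written value is a function of the target cell, so there are no
conflicts and rewriting a cell does no harm. -/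
theorem runs_of_target (p n : ℕ) (F : ℕ → ℕ → ℕ) (S : Set ℕ) (m₀ : BMem) (ks : List Kernel)
    (hS : ∀ k ∈ ks, k.b ∈ S) (hp : ∀ k ∈ ks, k.N.eval n ≤ p)
    (hr : ∀ m : BMem, (∀ b ∉ S, m b = m₀ b) → ∀ k ∈ ks, ∀ i, (k.On n m i ↔ k.On n m₀ i) ∧
      k.cell.eval n m (fun _ => i) = k.cell.eval n m₀ (fun _ => i) ∧
      k.val.eval n m (fun _ => i) = k.val.eval n m₀ (fun _ => i))
    (hF : ∀ k ∈ ks, ∀ i, k.On n m₀ i →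
      k.val.eval n m₀ (fun _ => i) = F k.b (k.cell.eval n m₀ fun _ => i)) :
    ∀ m : BMem, (∀ b ∉ S, m b = m₀ b) → ∃ m', Runs p n ks m m' ∧ (∀ b ∉ S, m' b = m₀ b) ∧
      ∀ b x, m' b x = if ∃ k ∈ ks, k.b = b ∧ ∃ i, k.On n m₀ i ∧ k.cell.eval n m₀ (fun _ => i) = x
        then F b x else m b x := by
  induction ks with
  | nil => exact fun m hm => ⟨m, rfl, hm, by simp⟩
  | cons k ks ih =>
    intro m hm
    obtain ⟨m', h1, h2, h3⟩ := ih (fun k hk => hS k (by simp [hk])) (fun k hk => hp k (by simp [hk]))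
      (fun m hm k hk => hr m hm k (by simp [hk])) (fun k hk => hF k (by simp [hk]))
      -- The memory after the first kernel.
      (fun b x => if k.b = b ∧ ∃ i, k.On n m₀ i ∧ k.cell.eval n m₀ (fun _ => i) = x
        then F b x else m b x)
      (fun b hb => by
        have : k.b ≠ b := fun h => hb (h ▸ hS k (by simp))
        simp [this, hm b hb])
    refine ⟨m', ⟨_, ⟨fun i hi hon => ?_, fun b x hx => ?_⟩, h1⟩, h2, fun b x => ?_⟩
    · obtain ⟨e1, e2, e3⟩ := hr m hm k (by simp) i
      rw [e2, e3, if_pos ⟨rfl, i, e1.1 hon, rfl⟩, hF k (by simp) i (e1.1 hon)]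
    · refine if_neg ?_
      rintro ⟨rfl, i, hon, hi⟩
      obtain ⟨e1, e2, e3⟩ := hr m hm k (by simp) i
      exact hx rfl i (hon.1.trans_le (hp k (by simp))) (e1.2 hon) (e2.trans hi)
    · rw [h3]
      by_cases hc : ∃ k ∈ ks, k.b = b ∧ ∃ i, k.On n m₀ i ∧ k.cell.eval n m₀ (fun _ => i) = x
      · rw [if_pos hc, if_pos]
        obtain ⟨k', hk', h⟩ := hc
        exact ⟨k', by simp [hk'], h⟩
      · rw [if_neg hc]
        refine if_congr ?_ rfl rfl
        refine ⟨fun h => ⟨k, by simp, h⟩, ?_⟩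
        rintro ⟨k', hk', h⟩
        rcases List.mem_cons.1 hk' with rfl | hk'
        · exact h
        · exact absurd ⟨k', hk', h⟩ hc

end

/-! # Program blocks -/

/-- The property depends only on the banks that are not for intermediate results from `ctr` on. -/
def Stable {G : ℕ → Type} (ctr : ℕ) (P : ∀ n, G n → BMem → Prop) : Prop :=
  ∀ n g m m', Agree ctr m m' → P n g m → P n g m'

/-- Clean banks matter because `0` is read as "nothing was written here". -/
def Fresh (ctr : ℕ) (m : BMem) : Prop := ∀ k, ctr ≤ k → ∀ x, m (tmpBank k) x = 0

/-- There is a list of kernels which, for all ghost values `g`, leads from `Pre` to `Post`, where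
`Post` refers to a static result with the property `Good`. It uses banks for intermediate results
from number `ctr` on and `O(W)` processors. -/
def Blk (ctr : ℕ) (W : ℕ → ℕ) {G : ℕ → Type} {D : Type} (Pre : ∀ n, G n → BMem → Prop)
    (Good : ℕ → D → Prop) (Post : D → ∀ n, G n → BMem → Prop) : Prop :=
  ∃ (ctr' : ℕ) (ks : List Kernel) (Q : NumExpr) (C : ℕ) (d : D), ctr ≤ ctr' ∧
    (∀ k ∈ ks, ∃ j, ctr ≤ j ∧ j < ctr' ∧ k.b = tmpBank j) ∧ (∀ n, Q.eval n ≤ C * W n) ∧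
    Good ctr' d ∧ Stable ctr' (Post d) ∧
    ∀ n g p m, 1 ≤ n → Q.eval n ≤ p → Fresh ctr m → Pre n g m →
      ∃ m', Runs p n ks m m' ∧ Post d n g m'

theorem Runs.bank_eq {p n b : ℕ} {ks : List Kernel} : ∀ {m m' : BMem}, Runs p n ks m m' →
    (∀ k ∈ ks, k.b ≠ b) → m' b = m b := by
  induction ks with
  | nil => rintro m m' h -; cases h; rfl
  | cons k ks ih =>
    rintro m m' ⟨m₁, h₁, h⟩ hb
    rw [ih h fun k hk => hb k (by simp [hk])]
    funext x
    exact h₁.2 b x fun h => absurd h.symm (hb k (by simp))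

section
variable {ctr ctr' p n : ℕ} {ks : List Kernel} {m m' : BMem}

theorem Runs.agree (h : Runs p n ks m m')
    (hk : ∀ k ∈ ks, ∃ j, ctr ≤ j ∧ j < ctr' ∧ k.b = tmpBank j) : Agree ctr m m' :=
  fun b hb => h.bank_eq fun k hks hkb => by
    obtain ⟨j, hj, -, e⟩ := hk k hks
    exact hb j hj (hkb ▸ e)

theorem Runs.fresh (h : Runs p n ks m m')
    (hk : ∀ k ∈ ks, ∃ j, ctr ≤ j ∧ j < ctr' ∧ k.b = tmpBank j) (hc : ctr ≤ ctr')
    (hf : Fresh ctr m) : Fresh ctr' m' := fun l hl x => by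
  rw [h.bank_eq, hf l (hc.trans hl)]
  intro k hks hkb
  obtain ⟨j, -, hj, e⟩ := hk k hks
  have := tmpBank_injective (hkb.symm.trans e)
  omega

end

section
variable {ctr : ℕ} {W W₁ : ℕ → ℕ} {G G₁ : ℕ → Type} {D D₁ : Type}
  {Pre : ∀ n, G n → BMem → Prop} {Good : ℕ → D → Prop} {Post : D → ∀ n, G n → BMem → Prop}
  {Pre₁ : ∀ n, G₁ n → BMem → Prop} {Good₁ : ℕ → D₁ → Prop} {Post₁ : D₁ → ∀ n, G₁ n → BMem → Prop}

theorem Stable.mono {ctr' : ℕ} (h : Stable ctr Pre) (hc : ctr ≤ ctr') : Stable ctr' Pre :=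
  fun n g m m' ha => h n g m m' (ha.mono hc)

theorem Stable.and {P P' : ∀ n, G n → BMem → Prop} (h : Stable ctr P) (h' : Stable ctr P') :
    Stable ctr fun n g m => P n g m ∧ P' n g m :=
  fun n g m m' ha hp => ⟨h n g m m' ha hp.1, h' n g m m' ha hp.2⟩

theorem Stable.all {ι : Type} {P : ι → ∀ n, G n → BMem → Prop} (h : ∀ i, Stable ctr (P i)) :
    Stable ctr fun n g m => ∀ i, P i n g m :=
  fun n g m m' ha hp i => h i n g m m' ha (hp i)

/-- No kernels at all: the result can be written down as an expression. -/
theorem Blk.pure (d : D) (hg : Good ctr d) (hs : Stable ctr (Post d))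
    (h : ∀ n g m, 1 ≤ n → Pre n g m → Post d n g m) : Blk ctr W Pre Good Post :=
  ⟨ctr, [], .lit 0, 0, d, le_rfl, by simp, by simp [NumExpr.eval], hg, hs,
    fun n g p m hn _ _ hp => ⟨m, rfl, h n g m hn hp⟩⟩

/-- Sequential composition. The second block starts at the counter where the first one stopped, so
it finds fresh banks and cannot destroy the first result. The map `φ` derives the ghost values of
the first block, and `K` absorbs the constant factors from binders. -/
theorem Blk.bind (h₁ : Blk ctr W₁ Pre₁ Good₁ Post₁) (φ : ∀ n, G n → G₁ n) (hs : Stable ctr Pre)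
    (hpre : ∀ n g m, 1 ≤ n → Pre n g m → Pre₁ n (φ n g) m) (K : ℕ) (hW : ∀ n, W₁ n ≤ K * W n)
    (h₂ : ∀ c₁ d₁, ctr ≤ c₁ → Good₁ c₁ d₁ →
      Stable c₁ (fun n g m => Post₁ d₁ n (φ n g) m) →
      Blk c₁ W (fun n g m => Pre n g m ∧ Post₁ d₁ n (φ n g) m) Good Post) :
    Blk ctr W Pre Good Post := by
  obtain ⟨c₁, ks, Q, C, d₁, hc, hk, hQ, hg, hst, hrun⟩ := h₁
  obtain ⟨c₂, ks₂, Q₂, C₂, d₂, hc₂, hk₂, hQ₂, hg₂, hst₂, hrun₂⟩ := h₂ c₁ d₁ hc hg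
    fun n g m m' ha h => hst n _ m m' ha h
  -- Numbers of processors are added, since `NumExpr` has no maximum; this costs only a constant
  -- factor.
  refine ⟨c₂, ks ++ ks₂, .add Q Q₂, C * K + C₂, d₂, hc.trans hc₂, ?_, ?_, hg₂, hst₂, ?_⟩
  · intro k hks
    rcases List.mem_append.1 hks with h | h
    · obtain ⟨j, h1, h2, h3⟩ := hk k h
      exact ⟨j, h1, h2.trans_le hc₂, h3⟩
    · obtain ⟨j, h1, h2, h3⟩ := hk₂ k h
      exact ⟨j, hc.trans h1, h2, h3⟩
  · intro n
    have := Nat.mul_le_mul_left C (hW n)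
    simp only [NumExpr.eval]
    calc Q.eval n + Q₂.eval n ≤ C * W₁ n + C₂ * W n := add_le_add (hQ n) (hQ₂ n)
      _ ≤ C * (K * W n) + C₂ * W n := by omega
      _ = (C * K + C₂) * W n := by ring
  · intro n g p m hn hp hf hpr
    simp only [NumExpr.eval] at hp
    obtain ⟨m₁, hr₁, hp₁⟩ := hrun n (φ n g) p m hn (by omega) hf (hpre n g m hn hpr)
    obtain ⟨m₂, hr₂, hp₂⟩ := hrun₂ n g p m₁ hn (by omega) (hr₁.fresh hk hc hf)
      ⟨hs n g m m₁ (hr₁.agree hk) hpr, hp₁⟩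
    exact ⟨m₂, hr₁.append hr₂, hp₂⟩

/-- Adaption of a block to a weaker bound, other ghost values, and another result. -/
theorem Blk.conseq (h₁ : Blk ctr W₁ Pre₁ Good₁ Post₁) (φ : ∀ n, G n → G₁ n) (hs : Stable ctr Pre)
    (hpre : ∀ n g m, 1 ≤ n → Pre n g m → Pre₁ n (φ n g) m) (K : ℕ) (hW : ∀ n, W₁ n ≤ K * W n)
    (f : D₁ → D) (hg : ∀ c d, ctr ≤ c → Good₁ c d → Good c (f d))
    (hst : ∀ c d, ctr ≤ c → Good₁ c d → Stable c (Post (f d)))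
    (hpost : ∀ d c n g m, 1 ≤ n → ctr ≤ c → Good₁ c d → Pre n g m → Post₁ d n (φ n g) m →
      Post (f d) n g m) :
    Blk ctr W Pre Good Post :=
  h₁.bind φ hs hpre K hW fun c d hc hd _ => Blk.pure (f d) (hg c d hc hd) (hst c d hc hd)
    fun n g m hn h => hpost d c n g m hn hc hd h.1 h.2

/-- Blocks for a fixed finite family are executed one after the other, all from the same
precondition. The first hypothesis keeps earlier results good when the counter grows. -/
theorem Blk.fin (hs : Stable ctr Pre) : ∀ {k : ℕ} {Good : Fin k → ℕ → D → Prop}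
    {Post : Fin k → D → ∀ n, G n → BMem → Prop},
    (∀ i c c' d, c ≤ c' → Good i c d → Good i c' d) →
    (∀ i c d, Good i c d → Stable c (Post i d)) →
    (∀ i c, ctr ≤ c → Blk c W Pre (Good i) (Post i)) →
    Blk ctr W Pre (fun c (d : Fin k → D) => ∀ i, Good i c (d i))
      fun d n g m => ∀ i, Post i (d i) n g m := by
  intro k
  induction k with
  | zero =>
    intro Good Post _ _ _
    exact Blk.pure Fin.elim0 (fun i => i.elim0) (fun _ _ _ _ _ _ i => i.elim0)
      fun _ _ _ _ _ i => i.elim0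
  | succ k ih =>
    intro Good Post hm hst h
    refine (ih (fun i => hm i.castSucc) (fun i => hst i.castSucc) fun i => h i.castSucc).bind
      (fun _ g => g) hs (fun _ _ _ _ h => h) 1 (fun n => by simp) fun c₁ d₁ hc₁ hd₁ hs₁ => ?_
    refine (h (Fin.last k) c₁ hc₁).bind (fun _ g => g) ((hs.mono hc₁).and hs₁)
      (fun _ _ _ _ h => h.1) 1 (fun n => by simp) fun c₂ d₂ hc₂ hd₂ hs₂ => ?_
    have hgood : ∀ i, Good i c₂ (Fin.snoc (α := fun _ => D) d₁ d₂ i) := fun i => by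
      induction i using Fin.lastCases with
      | last => simpa using hd₂
      | cast i => simpa using hm _ _ _ _ hc₂ (hd₁ i)
    refine Blk.pure _ hgood (Stable.all fun i => hst i c₂ _ (hgood i)) ?_
    intro n g m _ hp i
    induction i using Fin.lastCases with
    | last => simpa using hp.2
    | cast i => simpa using hp.1.2 i

theorem Blk.finite (hs : Stable ctr Pre) {ι : Type} [Finite ι] {Good : ι → ℕ → D → Prop}
    {Post : ι → D → ∀ n, G n → BMem → Prop}
    (hm : ∀ i c c' d, c ≤ c' → Good i c d → Good i c' d)
    (hst : ∀ i c d, Good i c d → Stable c (Post i d))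
    (h : ∀ i c, ctr ≤ c → Blk c W Pre (Good i) (Post i)) :
    Blk ctr W Pre (fun c (d : ι → D) => ∀ i, Good i c (d i))
      fun d n g m => ∀ i, Post i (d i) n g m := by
  obtain ⟨k, ⟨e⟩⟩ := Finite.exists_equiv_fin ι
  refine (Blk.fin hs (fun i => hm (e.symm i)) (fun i => hst (e.symm i)) fun i => h (e.symm i)).conseq
    (fun _ g => g) hs (fun _ _ _ _ h => h) 1 (fun n => by simp) (fun d i => d (e i)) ?_ ?_ ?_
  · intro c d _ hd i
    simpa using hd (e i)
  · intro c d _ hd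
    exact Stable.all fun i => hst i c _ (by simpa using hd (e i))
  · intro d c n g m _ _ _ _ hd i
    simpa using hd (e i)

theorem exists_procs {ks : List Kernel} (hN : ∀ k ∈ ks, ∃ C, ∀ n, k.N.eval n ≤ C * W n) :
    ∃ (Q : NumExpr) (C : ℕ), (∀ n, Q.eval n ≤ C * W n) ∧
      ∀ k ∈ ks, ∀ n, k.N.eval n ≤ Q.eval n := by
  induction ks with
  | nil => exact ⟨.lit 0, 0, fun n => by simp [NumExpr.eval], by simp⟩
  | cons k ks ih =>
    obtain ⟨Q, C, h1, h2⟩ := ih fun k hk => hN k (by simp [hk])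
    obtain ⟨C', h3⟩ := hN k (by simp)
    refine ⟨.add k.N Q, C' + C, fun n => ?_, fun k' hk' n => ?_⟩
    · rw [add_mul]
      exact add_le_add (h3 n) (h1 n)
    · rcases List.mem_cons.1 hk' with rfl | hk'
      · exact Nat.le_add_right _ _
      · exact (h2 k' hk' n).trans (Nat.le_add_left _ _)

/-- A fresh bank can be filled by any kernels that do not conflict. -/
theorem Blk.write (ks : List Kernel) (hb : ∀ k ∈ ks, k.b = tmpBank ctr)
    (hk : ∀ k ∈ ks, k.mask.Below ctr ∧ k.cell.Below ctr ∧ k.val.Below ctr)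
    (hN : ∀ k ∈ ks, ∃ C, ∀ n, k.N.eval n ≤ C * W n)
    (hleg : ∀ n g m, 1 ≤ n → Pre n g m → ∀ k ∈ ks, ∀ k' ∈ ks, ∀ i i', k.On n m i → k'.On n m i' →
      k.cell.eval n m (fun _ => i) = k'.cell.eval n m (fun _ => i') →
      k.val.eval n m (fun _ => i) = k'.val.eval n m (fun _ => i')) :
    Blk ctr W Pre (fun c (d : ℕ) => c = ctr + 1 ∧ d = tmpBank ctr) fun d n _ m =>
      (∀ k ∈ ks, ∀ i, k.On n m i →
        m d (k.cell.eval n m fun _ => i) = k.val.eval n m fun _ => i) ∧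
      ∀ x, (∀ k ∈ ks, ∀ i, k.On n m i → k.cell.eval n m (fun _ => i) ≠ x) → m d x = 0 := by
  classical
  obtain ⟨Q, C, hQ, hNQ⟩ := exists_procs hN
  have heq : ∀ n (m m' : BMem), Agree ctr m m' → ∀ k ∈ ks, ∀ i, (k.On n m' i ↔ k.On n m i) ∧
      k.cell.eval n m' (fun _ => i) = k.cell.eval n m (fun _ => i) ∧
      k.val.eval n m' (fun _ => i) = k.val.eval n m (fun _ => i) := fun n m m' ha k hks i => by
    obtain ⟨h1, h2, h3⟩ := hk k hks
    exact ⟨by rw [Kernel.On, Kernel.On, h1.eval_eq ha], h2.eval_eq ha, h3.eval_eq ha⟩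
  refine ⟨ctr + 1, ks, Q, C, tmpBank ctr, by omega, fun k hks => ⟨ctr, le_rfl, by omega, hb k hks⟩,
    hQ, ⟨rfl, rfl⟩, ?_, ?_⟩
  · intro n g m m' ha h
    have hd : m' (tmpBank ctr) = m (tmpBank ctr) := ha _ fun k hk h => by
      have := tmpBank_injective h; omega
    have heq' := heq n m m' (ha.mono (by omega))
    refine ⟨fun k hks i hon => ?_, fun x hx => ?_⟩
    · obtain ⟨e1, e2, e3⟩ := heq' k hks i
      rw [hd, e2, e3, h.1 k hks i (e1.1 hon)]
    · rw [hd, h.2 x]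
      intro k hks i hon he
      obtain ⟨e1, e2, e3⟩ := heq' k hks i
      exact hx k hks i (e1.2 hon) (e2.trans he)
  · intro n g p m hn hp hf hpr
    have hag : ∀ m' : BMem, (∀ b ∉ ({tmpBank ctr} : Set ℕ), m' b = m b) → Agree ctr m m' :=
      fun m' h b hb => h b fun hbb => hb ctr le_rfl hbb
    -- The target function takes any value that some processor wants to write at `x`; by `hleg` the
    -- choice is irrelevant.
    obtain ⟨m', h1, h2, h3⟩ := runs_of_target p n (fun _ x =>
      if h : ∃ v, ∃ k ∈ ks, ∃ i, k.On n m i ∧ k.cell.eval n m (fun _ => i) = x ∧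
        k.val.eval n m (fun _ => i) = v then h.choose else 0) {tmpBank ctr} m ks
      (fun k hks => hb k hks) (fun k hks => (hNQ k hks n).trans hp)
      (fun m' hm' => heq n m m' (hag m' hm'))
      (fun k hks i hon => by
        have h : ∃ v, ∃ k' ∈ ks, ∃ i', k'.On n m i' ∧
          k'.cell.eval n m (fun _ => i') = k.cell.eval n m (fun _ => i) ∧
          k'.val.eval n m (fun _ => i') = v := ⟨_, k, hks, i, hon, rfl, rfl⟩
        rw [dif_pos h]
        obtain ⟨k', hk', i', hon', hc, hv⟩ := h.choose_spec
        rw [← hv]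
        exact hleg n g m hn hpr k hks k' hk' i i' hon hon' hc.symm)
      m fun _ _ => rfl
    have heq' := heq n m m' (hag m' h2)
    refine ⟨m', h1, fun k hks i hon => ?_, fun x hx => ?_⟩
    · obtain ⟨e1, e2, e3⟩ := heq' k hks i
      have h : ∃ v, ∃ k' ∈ ks, ∃ i', k'.On n m i' ∧
          k'.cell.eval n m (fun _ => i') = k.cell.eval n m (fun _ => i) ∧
          k'.val.eval n m (fun _ => i') = v := ⟨_, k, hks, i, e1.1 hon, rfl, rfl⟩
      rw [e2, e3, h3, if_pos ⟨k, hks, hb k hks, i, e1.1 hon, rfl⟩, dif_pos h]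
      obtain ⟨k', hk', i', hon', hc, hv⟩ := h.choose_spec
      rw [← hv]
      exact hleg n g m hn hpr k' hk' k hks i' i hon' (e1.1 hon) hc
    · rw [h3, if_neg, hf ctr le_rfl]
      rintro ⟨k, hks, -, i, hon, he⟩
      obtain ⟨e1, e2, e3⟩ := heq' k hks i
      exact hx k hks i (e1.2 hon) (e2.trans he)

end

/-! # Views of stored states -/

/-- The bank of the symbol `f` of the instance number `c`. -/
def symBank (c : ℕ) (s : Srt) (f : ℕ) : ℕ :=
  Nat.pair c (Nat.pair (match s with | .rel => 0 | .fn => 1) f) + 1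

/-- The number of a tuple in base `n`. -/
def tupleCode {n k : ℕ} (a : Fin k → Fin n) : ℕ := ∑ i, (a i : ℕ) * n ^ (i : ℕ)

theorem symAddr_eq {n k : ℕ} (c : ℕ) (s : Srt) (f : ℕ) (a : Fin k → Fin n) :
    symAddr c s f a = Nat.pair (symBank c s f) (tupleCode a) := rfl

theorem tupleCode_injective {n k : ℕ} : Function.Injective (tupleCode (n := n) (k := k)) := by
  intro a b h
  apply (finFunctionFinEquiv (m := n) (n := k)).injective
  ext
  simpa only [finFunctionFinEquiv_apply, tupleCode] using h

theorem symBank_inj {c c' : ℕ} {s s' : Srt} {f f' : ℕ} :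
    symBank c s f = symBank c' s' f' ↔ c = c' ∧ s = s' ∧ f = f' := by
  cases s <;> cases s' <;> simp [symBank]

/-- Symbols use the sort tags `0` and `1`; intermediate results have the tag `2`. -/
theorem symBank_ne_tmpBank (c : ℕ) (s : Srt) (f k : ℕ) : symBank c s f ≠ tmpBank k := by
  cases s <;> simp [symBank, tmpBank]

theorem zero_ne_tmpBank (k : ℕ) : 0 ≠ tmpBank k := by simp [tmpBank]

/-! ### The tree of instances and the disjointness of their banks -/

/-- The instance number `d` is the instance number `c` or a direct or indirect supplementary
instance of it. -/
inductive InTree (c : ℕ) : ℕ → Prop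
  | refl : InTree c c
  | step {d : ℕ} (i : ℕ) : InTree c d → InTree c (Nat.pair d i + 1)

theorem InTree.trans {c d e : ℕ} (h : InTree c d) (h' : InTree d e) : InTree c e := by
  induction h' with
  | refl => exact h
  | step i _ ih => exact ih.step i

theorem InTree.child (c i : ℕ) : InTree c (Nat.pair c i + 1) := .step i .refl

theorem InTree.le {c d : ℕ} (h : InTree c d) : c ≤ d := by
  induction h with
  | refl => exact le_rfl
  | step i _ ih => exact ih.trans ((Nat.left_le_pair _ _).trans (Nat.le_succ _))

/-- A number `Nat.pair d i + 1` determines its parent `d`, so the ancestors of a node form a chain.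
-/
theorem InTree.linear {a b d : ℕ} (h : InTree a d) (h' : InTree b d) : InTree a b ∨ InTree b a := by
  induction h with
  | refl => exact .inr h'
  | @step d' i h ih =>
    generalize he : Nat.pair d' i + 1 = e at h'
    cases h' with
    | refl => exact .inl (he ▸ h.step i)
    | @step d'' j h' =>
      obtain ⟨rfl, rfl⟩ : d' = d'' ∧ i = j := by simpa using he
      exact ih h'

theorem InTree.of_child {c i b : ℕ} (h : InTree b (Nat.pair c i + 1)) :
    b = Nat.pair c i + 1 ∨ InTree b c := by
  generalize he : Nat.pair c i + 1 = e at h ⊢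
  cases h with
  | refl => exact .inl rfl
  | @step d j h =>
    obtain ⟨rfl, rfl⟩ : c = d ∧ i = j := by simpa using he
    exact .inr h

/-- Subtrees of different children are disjoint: otherwise the children would be comparable, and one
of them would be an ancestor of `c`, although numbers increase strictly from parent to child. -/
theorem InTree.child_inj {c i j d : ℕ} (h : InTree (Nat.pair c i + 1) d)
    (h' : InTree (Nat.pair c j + 1) d) : i = j := by
  have key : ∀ i j, InTree (Nat.pair c i + 1) (Nat.pair c j + 1) → i = j := fun i j h => by
    rcases h.of_child with h | h
    · simpa using h
    · have := h.le
      have := Nat.left_le_pair c i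
      omega
  rcases h.linear h' with h | h
  · exact key _ _ h
  · exact (key _ _ h).symm

/-- The bank belongs to the instance number `c` or to a supplementary instance of it. -/
def BankIn (c b : ℕ) : Prop := ∃ d s f, InTree c d ∧ b = symBank d s f

theorem BankIn.of_child {c i b : ℕ} (h : BankIn (Nat.pair c i + 1) b) : BankIn c b := by
  obtain ⟨d, s, f, h, rfl⟩ := h
  exact ⟨d, s, f, (InTree.child c i).trans h, rfl⟩

theorem bankIn_symBank (c : ℕ) (s : Srt) (f : ℕ) : BankIn c (symBank c s f) :=
  ⟨c, s, f, .refl, rfl⟩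

theorem not_bankIn_child (c i : ℕ) (s : Srt) (f : ℕ) :
    ¬ BankIn (Nat.pair c i + 1) (symBank c s f) := by
  rintro ⟨d, s', f', h, he⟩
  obtain ⟨rfl, -, -⟩ := symBank_inj.1 he
  have := h.le
  have := Nat.left_le_pair c i
  omega

theorem BankIn.child_inj {c i j b : ℕ} (h : BankIn (Nat.pair c i + 1) b)
    (h' : BankIn (Nat.pair c j + 1) b) : i = j := by
  obtain ⟨d, s, f, h, rfl⟩ := h
  obtain ⟨d', s', f', h', he⟩ := h'
  obtain ⟨rfl, -, -⟩ := symBank_inj.1 he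
  exact h.child_inj h'

theorem BankIn.ne_tmpBank {c b : ℕ} (h : BankIn c b) (k : ℕ) : b ≠ tmpBank k := by
  obtain ⟨d, s, f, -, rfl⟩ := h
  exact symBank_ne_tmpBank d s f k

/-- Read the address `x` in a view, which gives for every bank an expression for the contents
of cells. -/
def rd (V : ℕ → SExp) (n : ℕ) (m : BMem) (x : ℕ) : ℕ :=
  (V x.unpair.1).eval n m fun _ => x.unpair.2

theorem rd_pair (V : ℕ → SExp) (n : ℕ) (m : BMem) (b x : ℕ) :
    rd V n m (Nat.pair b x) = (V b).eval n m fun _ => x := by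
  simp [rd]

/-- The view `V` shows the state `st` of the instance number `c`. -/
def RepS {I : Interface} (P : Prog I) {n : ℕ} (c : ℕ) (st : P.State n) (V : ℕ → SExp) (m : BMem) :
    Prop :=
  ∀ x v, P.Holds n c st x v → rd V n m x = v

theorem Prog.Holds.bankIn {I : Interface} {P : Prog I} {n : ℕ} : ∀ {c : ℕ} {st : P.State n}
    {x v : ℕ}, P.Holds n c st x v → BankIn c x.unpair.1 := by
  induction P with
  | mk aux k J sub upd qry ih =>
    rintro c st x v (⟨s, f, a, rfl, -⟩ | ⟨i, h⟩)
    · simpa [symAddr_eq] using bankIn_symBank c s f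
    · exact (ih i h).of_child

/-- A state depends only on the banks of its own subtree; thus changes of one instance leave the
representations of its siblings intact. -/
theorem RepS.congr {I : Interface} {P : Prog I} {n c : ℕ} {st : P.State n} {V V' : ℕ → SExp}
    {m m' : BMem} (h : RepS P c st V m)
    (hV : ∀ x, BankIn c x.unpair.1 → rd V' n m' x = rd V n m x) : RepS P c st V' m' :=
  fun x v hx => (hV x hx.bankIn).trans (h x v hx)

section
variable {I : Interface} {aux : Schema} {k : ℕ} {J : Fin k → Interface}
  {sub : (i : Fin k) → Prog (J i)}
  {upd : (δ : Fin I.chg) → (s : Srt) → (f : Fin (aux.num s)) →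
    Option (UpdRule aux J (I.chgArity δ) s f)}
  {qry : (s : Srt) → (q : Fin (I.qry.num s)) → QryRule aux J (I.qry.arity s q) s}

theorem repS_mk {n c : ℕ} {st : (Prog.mk aux k J sub upd qry).State n} {V : ℕ → SExp} {m : BMem} :
    RepS (Prog.mk aux k J sub upd qry) c st V m ↔
      (∀ (s : Srt) (f : Fin (aux.num s)) a, rd V n m (symAddr c s f a) = (st.1 s f a).code) ∧
      ∀ i : Fin k, RepS (sub i) (Nat.pair c i + 1) (st.2 i) V m := by
  constructor
  · exact fun h => ⟨fun s f a => h _ _ (.inl ⟨s, f, a, rfl, rfl⟩),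
      fun i x v hx => h x v (.inr ⟨i, hx⟩)⟩
  · rintro ⟨h, h'⟩ x v (⟨s, f, a, rfl, rfl⟩ | ⟨i, hx⟩)
    · exact h s f a
    · exact h' i x v hx

end

/-! # Codes of values and tuples -/

theorem Val.code_injective {n : ℕ} : ∀ {s : Srt}, Function.Injective (Val.code (n := n) (s := s))
  | .rel => by rintro (_ | _) (_ | _) h <;> simp_all [Val.code]
  | .fn => by
    rintro (_ | x) (_ | y) h
    · rfl
    · exact absurd h (Nat.succ_ne_zero _).symm
    · exact absurd h (Nat.succ_ne_zero _)
    · exact congrArg some (Fin.ext (Nat.succ_injective h))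

@[simp] theorem Val.code_true {n : ℕ} : Val.code (n := n) (s := .rel) true = 1 := rfl
@[simp] theorem Val.code_false {n : ℕ} : Val.code (n := n) (s := .rel) false = 0 := rfl
@[simp] theorem Val.code_none {n : ℕ} :
    Val.code (n := n) (s := .fn) (none : Option (Fin n)) = 0 := rfl
@[simp] theorem Val.code_some {n : ℕ} (x : Fin n) :
    Val.code (n := n) (s := .fn) (some x) = x + 1 := rfl
@[simp] theorem Val.code_default {n : ℕ} (s : Srt) : (Val.default n s).code = 0 := by
  cases s <;> rfl

theorem tuple_eq_some {α : Type} {k : ℕ} {e : Fin k → Option α} {a : Fin k → α} :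
    tuple e = some a ↔ ∀ i, e i = some (a i) := by
  unfold tuple
  constructor
  · intro h i
    split_ifs at h with hs
    cases h
    simp
  · intro h
    rw [dif_pos fun i => by simp [h]]
    simp [h]

theorem isSome_tuple {α : Type} {k : ℕ} {e : Fin k → Option α} :
    (tuple e).isSome ↔ ∀ i, (e i).isSome := by
  unfold tuple
  split_ifs with h <;> simpa using h

namespace SExp

/-- The number of a tuple in base `n`. -/
def tupleE : {k : ℕ} → (Fin k → SExp) → SExp
  | 0, _ => lit 0
  | k + 1, e =>
    .op .add (tupleE fun i => e i.castSucc) (.op .mul (e (Fin.last k)) (.num (.pow .size k)))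

theorem eval_tupleE (n : ℕ) (m : BMem) (ρ : ℕ → ℕ) {k : ℕ} (e : Fin k → SExp) :
    (tupleE e).eval n m ρ = ∑ i, (e i).eval n m ρ * n ^ (i : ℕ) := by
  induction k with
  | zero => rfl
  | succ k ih => simp [tupleE, ih, Fin.sum_univ_castSucc]

theorem below_tupleE {ctr k : ℕ} {e : Fin k → SExp} (h : ∀ i, (e i).Below ctr) :
    (tupleE e).Below ctr := by
  induction k with
  | zero => trivial
  | succ k ih => exact ⟨ih fun i => h _, h _, trivial⟩

/-- The product of a tuple. -/
def prodE : {k : ℕ} → (Fin k → SExp) → SExp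
  | 0, _ => lit 1
  | _ + 1, e => .op .mul (prodE fun i => e i.castSucc) (e (Fin.last _))

theorem eval_prodE (n : ℕ) (m : BMem) (ρ : ℕ → ℕ) {k : ℕ} (e : Fin k → SExp) :
    (prodE e).eval n m ρ = ∏ i, (e i).eval n m ρ := by
  induction k with
  | zero => rfl
  | succ k ih => simp [prodE, ih, Fin.prod_univ_castSucc]

theorem below_prodE {ctr k : ℕ} {e : Fin k → SExp} (h : ∀ i, (e i).Below ctr) :
    (prodE e).Below ctr := by
  induction k with
  | zero => trivial
  | succ k ih => exact ⟨ih fun i => h _, h _⟩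

/-- The number of the tuple with the codes `e`. -/
def decodeE {k : ℕ} (e : Fin k → SExp) : SExp := tupleE fun i => .op .sub (e i) (lit 1)

theorem below_decodeE {ctr k : ℕ} {e : Fin k → SExp} (h : ∀ i, (e i).Below ctr) :
    (decodeE e).Below ctr :=
  below_tupleE fun i => ⟨h i, trivial⟩

section
variable {n : ℕ} {m : BMem} {ρ : ℕ → ℕ} {k : ℕ} {e : Fin k → SExp} {v : Fin k → Option (Fin n)}

/-- Only `⊥` has the code `0`, so the product of the codes tests whether all entries are defined. -/
theorem eval_prodE_code (h : ∀ i, (e i).eval n m ρ = Val.code (s := .fn) (v i)) : (prodE e).eval n m ρ ≠ 0 ↔ ∃ a, tuple v = some a := by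
  rw [eval_prodE, Finset.prod_ne_zero_iff, ← Option.isSome_iff_exists, isSome_tuple]
  refine ⟨fun H i => ?_, fun H i _ => ?_⟩
  · have := H i (Finset.mem_univ _)
    rw [h] at this
    cases hv : v i with
    | none => simp [hv] at this
    | some x => rfl
  · obtain ⟨x, hx⟩ := Option.isSome_iff_exists.1 (H i)
    simp [h, hx]

theorem eval_decodeE (h : ∀ i, (e i).eval n m ρ = Val.code (s := .fn) (v i))
    {a : Fin k → Fin n} (ha : tuple v = some a) :
    (decodeE e).eval n m ρ = tupleCode a := by
  rw [tuple_eq_some] at ha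
  simp [decodeE, eval_tupleE, h, ha, tupleCode]

end

end SExp

/-! # Vectors of values -/

/-- In every active context the expression `R` has the code of the value of `f`. -/
def Vals {n : ℕ} {s : Srt} (R : SExp) (m : BMem) (act : ℕ → Prop) (f : ℕ → Option (Val n s)) :
    Prop :=
  ∀ j, act j → ∃ v, f j = some v ∧ R.eval n m (fun _ => j) = v.code

theorem Vals.eval_eq {n : ℕ} {s : Srt} {R : SExp} {m : BMem} {act : ℕ → Prop}
    {f : ℕ → Option (Val n s)} (h : Vals R m act f) {j : ℕ} (hj : act j) {v : Val n s}
    (hv : f j = some v) : R.eval n m (fun _ => j) = v.code := by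
  obtain ⟨w, hw, h⟩ := h j hj
  rw [hv] at hw
  cases hw
  exact h

theorem stable_vals {G : ℕ → Type} {s : Srt} {c : ℕ} {R : SExp} (hR : R.Below c)
    (act : ∀ n, G n → ℕ → Prop) (f : ∀ n, G n → ℕ → Option (Val n s)) :
    Stable c fun n g m => Vals R m (act n g) (f n g) := by
  intro n g m m' ha h j hj
  obtain ⟨v, h1, h2⟩ := h j hj
  exact ⟨v, h1, by rw [hR.eval_eq ha, h2]⟩

/-- The contexts `j < N` with `mask ≠ 0` are the active ones, and in these the variables have the
values `env j`. -/
structure VecRep {k n : ℕ} (N : NumExpr) (mask : SExp) (vars : Fin k → SExp) (act : ℕ → Prop)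
    (env : ℕ → Fin k → Fin n) (m : BMem) : Prop where
  mask_iff : ∀ j, mask.eval n m (fun _ => j) ≠ 0 ↔ act j
  lt : ∀ j, act j → j < N.eval n
  var : ∀ j, act j → ∀ i, (vars i).eval n m (fun _ => j) = env j i

theorem VecRep.agree {k n c : ℕ} {N : NumExpr} {mask : SExp} {vars : Fin k → SExp}
    {act : ℕ → Prop} {env : ℕ → Fin k → Fin n} {m m' : BMem} (h : VecRep N mask vars act env m)
    (hm : mask.Below c) (hv : ∀ i, (vars i).Below c) (ha : Agree c m m') :
    VecRep N mask vars act env m' where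
  mask_iff j := by rw [hm.eval_eq ha, h.mask_iff]
  lt := h.lt
  var j hj i := by rw [(hv i).eval_eq ha, h.var j hj]

theorem RepS.agree {I : Interface} {P : Prog I} {n c ctr : ℕ} {st : P.State n} {V : ℕ → SExp}
    {m m' : BMem} (h : RepS P c st V m) (hV : ∀ b, (V b).Below ctr) (ha : Agree ctr m m') :
    RepS P c st V m' :=
  h.congr fun _ _ => (hV _).eval_eq ha

/-- The field `pos` provides a dummy element for the parameters of inactive contexts. -/
structure QGhost {I : Interface} (P : Prog I) (k n : ℕ) where
  pos : 0 < n
  st : P.State n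
  act : ℕ → Prop
  env : ℕ → Fin k → Fin n

/-- The queries of the program can be evaluated in parallel, for many parameter tuples. -/
def QClaim {I : Interface} (P : Prog I) : Prop :=
  ∀ (s : Srt) (q : Fin (I.qry.num s)) (ctr : ℕ) (N : NumExpr) (c : ℕ) (SV : ℕ → SExp)
    (mask : SExp) (vars : Fin (I.qry.arity s q) → SExp), mask.Below ctr →
    (∀ i, (vars i).Below ctr) → (∀ b, (SV b).Below ctr) →
    Blk ctr (fun n => N.eval n * (P.work n).qry s q) (G := QGhost P (I.qry.arity s q))
      (fun n g m => VecRep N mask vars g.act g.env m ∧ RepS P c g.st SV m ∧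
        ∀ j, g.act j → ((P.sem n).query g.st s q (g.env j)).isSome)
      (fun c R => R.Below c)
      fun R n g m => Vals R m g.act fun j => (P.sem n).query g.st s q (g.env j)

/-! # Contexts -/

/-- Static description of a vector of contexts: their number, the number of the instance, the view
of the state, the active contexts, the values of the variables, and the values of the
assigned symbols as a function of the context and the address. -/
structure Amb (m : ℕ) where
  N : NumExpr
  c : ℕ
  SV : ℕ → SExp
  mask : SExp
  vars : Fin m → SExp
  tv : SExp

structure Amb.Below {m : ℕ} (ctr : ℕ) (A : Amb m) : Prop where
  SV : ∀ b, (A.SV b).Below ctr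
  mask : A.mask.Below ctr
  vars : ∀ i, (A.vars i).Below ctr
  tv : A.tv.Below ctr

theorem Amb.Below.mono {m ctr ctr' : ℕ} {A : Amb m} (h : A.Below ctr) (hc : ctr ≤ ctr') :
    A.Below ctr' :=
  ⟨fun b => (h.SV b).mono hc, h.mask.mono hc, fun i => (h.vars i).mono hc, h.tv.mono hc⟩

section
variable {Γ : Ctx} (sub : (i : Fin Γ.k) → Prog (Γ.sub i))

/-- All contexts share the auxiliary structure and the states of the supplementary instances,
whereas the variables and the assigned symbols are private to each context. -/
structure Ghost (m n : ℕ) where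
  pos : 0 < n
  σ : Struct Γ.aux n
  θ : (i : Fin Γ.k) → (sub i).State n
  act : ℕ → Prop
  env : ℕ → Fin m → Fin n
  τ : ℕ → Struct Γ.tmp n

variable {sub}

/-- In `tv`, variable `0` is the context and variable `1` the address. Addresses of assigned symbols
are formed with instance number `0`; they are mere keys and denote no memory cells. -/
structure Amb.Rep {m n : ℕ} (A : Amb m) (g : Ghost sub m n) (mem : BMem) : Prop where
  vec : VecRep A.N A.mask A.vars g.act g.env mem
  aux : ∀ (s) (f : Fin (Γ.aux.num s)) a, rd A.SV n mem (symAddr A.c s f a) = (g.σ s f a).code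
  sub : ∀ i, RepS (sub i) (Nat.pair A.c i + 1) (g.θ i) A.SV mem
  tmp : ∀ j, g.act j → ∀ (s) (f : Fin (Γ.tmp.num s)) a, A.tv.eval n mem (two j (symAddr 0 s f a)) = (g.τ j s f a).code

theorem Amb.Rep.agree {m n ctr : ℕ} {A : Amb m} {g : Ghost sub m n} {mem mem' : BMem}
    (h : A.Rep g mem) (hA : A.Below ctr) (ha : Agree ctr mem mem') : A.Rep g mem' where
  vec := h.vec.agree hA.mask hA.vars ha
  aux s f a := by rw [← h.aux]; exact (hA.SV _).eval_eq ha
  sub i := (h.sub i).agree hA.SV ha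
  tmp j hj s f a := by rw [hA.tv.eval_eq ha, h.tmp j hj]

theorem Amb.Below.stable {m ctr : ℕ} {A : Amb m} (hA : A.Below ctr)
    (X : ∀ n, Ghost sub m n → Prop) :
    Stable ctr fun n (g : Ghost sub m n) mem => A.Rep g mem ∧ X n g :=
  fun _ _ _ _ ha h => ⟨h.1.agree hA ha, h.2⟩

/-- The value of an expression in the `j`-th context. -/
noncomputable def Ghost.val {m n : ℕ} {s : Srt} (g : Ghost sub m n) (e : Expr Γ m s) (j : ℕ) :
    Option (Val n s) :=
  e.eval (fun i => (sub i).sem n) g.σ g.θ (g.τ j) (g.env j)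

noncomputable def Ghost.args {m n k : ℕ} (g : Ghost sub m n) (e : Fin k → Expr Γ m .fn) (j : ℕ) :
    Option (Option (Fin k → Fin n)) :=
  evalArgs (fun i => (sub i).sem n) g.σ g.θ (g.τ j) (g.env j) e

/-! ## Restriction to some contexts -/

def Amb.withMask {m : ℕ} (A : Amb m) (mask : SExp) : Amb m := { A with mask := mask }

def Ghost.withAct {m n : ℕ} (g : Ghost sub m n) (act : ℕ → Prop) : Ghost sub m n :=
  { g with act := act }

theorem Amb.Below.withMask {m ctr : ℕ} {A : Amb m} (h : A.Below ctr) {mask : SExp}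
    (hm : mask.Below ctr) : (A.withMask mask).Below ctr :=
  ⟨h.SV, hm, h.vars, h.tv⟩

theorem Amb.Rep.withMask {m n : ℕ} {A : Amb m} {g : Ghost sub m n} {mem : BMem}
    (h : A.Rep g mem) {mask : SExp} {act : ℕ → Prop}
    (hm : ∀ j, mask.eval n mem (fun _ => j) ≠ 0 ↔ act j) (ha : ∀ j, act j → g.act j) :
    (A.withMask mask).Rep (g.withAct act) mem where
  vec := ⟨hm, fun j hj => h.vec.lt j (ha j hj), fun j hj => h.vec.var j (ha j hj)⟩
  aux := h.aux
  sub := h.sub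
  tmp j hj := h.tmp j (ha j hj)

/-- How a conditional is executed: the code of a truth value is `0` or `1` and can be multiplied to
the mask. -/
theorem Amb.Rep.onTrue {m n : ℕ} {A : Amb m} {g : Ghost sub m n} {mem : BMem}
    (h : A.Rep g mem) {R : SExp} {f : ℕ → Option (Val n .rel)} (hR : Vals R mem g.act f) :
    (A.withMask (.op .mul A.mask R)).Rep (g.withAct fun j => g.act j ∧ f j = some true) mem := by
  refine h.withMask (fun j => ?_) fun j hj => hj.1
  rw [SExp.eval_mul, mul_ne_zero_iff, h.vec.mask_iff]
  refine and_congr_right fun hj => ?_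
  obtain ⟨v, hv, hc⟩ := hR j hj
  rw [hc, hv]
  cases v <;> simp

theorem Amb.Rep.onFalse {m n : ℕ} {A : Amb m} {g : Ghost sub m n} {mem : BMem}
    (h : A.Rep g mem) {R : SExp} {f : ℕ → Option (Val n .rel)} (hR : Vals R mem g.act f) :
    (A.withMask (.op .mul A.mask (.op .sub (.lit 1) R))).Rep
      (g.withAct fun j => g.act j ∧ f j = some false) mem := by
  refine h.withMask (fun j => ?_) fun j hj => hj.1
  rw [SExp.eval_mul, mul_ne_zero_iff, h.vec.mask_iff]
  refine and_congr_right fun hj => ?_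
  obtain ⟨v, hv, hc⟩ := hR j hj
  rw [SExp.eval_sub, hc, hv]
  cases v <;> simp

/-! ## Contexts for a bound variable -/

/-- One context for every context of `A` and every candidate for `z ≤ g(n)`. -/
def Amb.ext {m : ℕ} (A : Amb m) (g : NumFun) : Amb (m + 1) where
  N := .mul A.N (.range g)
  c := A.c
  SV := A.SV
  mask := .op .mul (A.mask.at' (.op .div (.var 0) (.num (.range g))))
    (.op .lt (.mod (.var 0) (.num (.range g))) (.num .size))
  vars := Fin.snoc (α := fun _ => SExp)
    (fun i => (A.vars i).at' (.op .div (.var 0) (.num (.range g))))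
    (.mod (.var 0) (.num (.range g)))
  tv := A.tv.app (.op .div (.var 0) (.num (.range g))) (.var 1)

/-- Context `j` is split by division with remainder into the old context and the value of the bound
variable. If `b(n) ≥ n`, the remainder can be `n`, which is outside of the domain; such contexts are
inactive and get the dummy value `0`. -/
def Ghost.ext {m n : ℕ} (g : Ghost sub m n) (b : NumFun) : Ghost sub (m + 1) n where
  pos := g.pos
  σ := g.σ
  θ := g.θ
  act j := g.act (j / (NumExpr.range b).eval n) ∧ j % (NumExpr.range b).eval n < n
  env j := Fin.snoc (α := fun _ => Fin n) (g.env (j / (NumExpr.range b).eval n))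
    (if h : j % (NumExpr.range b).eval n < n then ⟨_, h⟩ else ⟨0, g.pos⟩)
  τ j := g.τ (j / (NumExpr.range b).eval n)

theorem Amb.Below.ext {m ctr : ℕ} {A : Amb m} (h : A.Below ctr) (g : NumFun) :
    (A.ext g).Below ctr where
  SV := h.SV
  mask := by simpa [Amb.ext] using h.mask.at (by simp)
  vars i := by
    induction i using Fin.lastCases with
    | last => simp [Amb.ext]
    | cast i => simpa [Amb.ext] using (h.vars i).at (by simp)
  tv := h.tv.app (by simp) (by simp)

theorem range_pos (b : NumFun) (n : ℕ) : 0 < (NumExpr.range b).eval n := by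
  simp [NumExpr.range, NumExpr.eval]

/-- There are `min(b(n), n) + 1` candidates, but the work-bounding function counts `max(1, b(n))`.
This is where every binder contributes a factor `2` to the constant. -/
theorem range_le (b : NumFun) (n : ℕ) : (NumExpr.range b).eval n ≤ 2 * max 1 (b.toFun n) := by
  simp only [NumExpr.range, NumExpr.eval]
  omega

theorem mod_range_le (b : NumFun) (n j : ℕ) : j % (NumExpr.range b).eval n ≤ b.toFun n := by
  have := Nat.mod_lt j (range_pos b n)
  have h : (NumExpr.range b).eval n = min (b.toFun n) n + 1 := rfl
  omega

/-- The number of the context for `z` that belongs to the context `j`. -/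
def childIdx (b : NumFun) (n j z : ℕ) : ℕ := j * (NumExpr.range b).eval n + z

section
variable {b : NumFun} {n j z : ℕ}

theorem childIdx_mod (hz : z ≤ b.toFun n) (hn : z < n) :
    childIdx b n j z % (NumExpr.range b).eval n = z := by
  have h : (NumExpr.range b).eval n = min (b.toFun n) n + 1 := rfl
  rw [childIdx, mul_comm, Nat.mul_add_mod, Nat.mod_eq_of_lt (by omega)]

theorem childIdx_div (hz : z ≤ b.toFun n) (hn : z < n) :
    childIdx b n j z / (NumExpr.range b).eval n = j := by
  have h : (NumExpr.range b).eval n = min (b.toFun n) n + 1 := rfl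
  rw [childIdx, mul_comm, Nat.mul_add_div (range_pos b n), Nat.div_eq_of_lt (by omega), add_zero]

end

theorem Amb.Rep.ext {m n : ℕ} {A : Amb m} {g : Ghost sub m n} {mem : BMem}
    (h : A.Rep g mem) (b : NumFun) : (A.ext b).Rep (g.ext b) mem where
  vec := by
    refine ⟨fun j => ?_, fun j hj => ?_, fun j hj i => ?_⟩
    · change SExp.eval n mem (fun _ => j) (.op .mul _ _) ≠ 0 ↔ _
      rw [SExp.eval_mul, mul_ne_zero_iff, SExp.eval_at, h.vec.mask_iff]
      simp [Ghost.ext]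
    · have := h.vec.lt _ hj.1
      exact (Nat.div_lt_iff_lt_mul (range_pos b n)).1 this
    · induction i using Fin.lastCases with
      | last => simp [Amb.ext, Ghost.ext, hj.2]
      | cast i => simpa [Amb.ext, Ghost.ext] using h.vec.var _ hj.1 i
  aux := h.aux
  sub := h.sub
  tmp j hj s f a := by
    have := h.tmp _ hj.1 s f a
    simpa [Amb.ext, Ghost.ext] using this

theorem Ghost.ext_act {m n j : ℕ} {g : Ghost sub m n} {b : NumFun} {z : Fin n}
    (hz : (z : ℕ) ≤ b.toFun n) : (g.ext b).act (childIdx b n j z) ↔ g.act j := by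
  simp [Ghost.ext, childIdx_mod hz z.2, childIdx_div hz z.2]

theorem Ghost.ext_env {m n j : ℕ} {g : Ghost sub m n} {b : NumFun} {z : Fin n}
    (hz : (z : ℕ) ≤ b.toFun n) :
    (g.ext b).env (childIdx b n j z) = Fin.snoc (α := fun _ => Fin n) (g.env j) z := by
  simp [Ghost.ext, childIdx_mod hz z.2, childIdx_div hz z.2]

theorem Ghost.ext_τ {m n j : ℕ} {g : Ghost sub m n} {b : NumFun} {z : Fin n}
    (hz : (z : ℕ) ≤ b.toFun n) : (g.ext b).τ (childIdx b n j z) = g.τ j := by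
  simp [Ghost.ext, childIdx_div hz z.2]

theorem Ghost.ext_val {m n j : ℕ} {s : Srt} {g : Ghost sub m n} {b : NumFun} {z : Fin n}
    (hz : (z : ℕ) ≤ b.toFun n) (e : Expr Γ (m + 1) s) :
    (g.ext b).val e (childIdx b n j z) =
      e.eval (fun i => (sub i).sem n) g.σ g.θ (g.τ j) (Fin.snoc (g.env j) z) := by
  rw [Ghost.val, Ghost.ext_env hz, Ghost.ext_τ hz]
  rfl

/-- Every active context of the extension belongs to an element `z ≤ b(n)`. -/
theorem Ghost.exists_of_ext_act {m n j : ℕ} {g : Ghost sub m n} {b : NumFun}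
    (h : (g.ext b).act j) : ∃ (i : ℕ) (z : Fin n), (z : ℕ) ≤ b.toFun n ∧ j = childIdx b n i z ∧
      g.act i ∧ i = j / (NumExpr.range b).eval n ∧ (z : ℕ) = j % (NumExpr.range b).eval n := by
  refine ⟨j / (NumExpr.range b).eval n, ⟨_, h.2⟩, mod_range_le b n j, ?_, h.1, rfl, rfl⟩
  rw [childIdx, mul_comm]
  exact (Nat.div_add_mod _ _).symm

end

/-! # Evaluation of expressions in parallel -/

theorem one_le_maxOne {k : ℕ} (u : Fin k → ℕ) : 1 ≤ maxOne u := le_max_left _ _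

theorem le_maxOne {k : ℕ} (u : Fin k → ℕ) (i : Fin k) : u i ≤ maxOne u :=
  (Finset.le_sup (f := u) (Finset.mem_univ i)).trans (le_max_right _ _)

theorem Expr.one_le_work {Γ : Ctx} (n : ℕ) (W : (i : Fin Γ.k) → WorkBound (Γ.sub i)) {m : ℕ}
    {s : Srt} (e : Expr Γ m s) : 1 ≤ e.work n W := by
  induction e with
  | bot | var => exact le_rfl
  | sym | loc => exact one_le_maxOne _
  | ask => exact le_max_of_le_left (one_le_maxOne _)
  | neg c ih => exact ih
  | unique g c ih | ex g c ih => exact one_le_mul (le_max_left _ _) ih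
  | add a b ih | mul a b ih | eq a b ih | le a b ih | and a b ih | or a b ih | ite c t e ih =>
    exact le_max_of_le_left ih

section
variable {Γ : Ctx} (sub : (i : Fin Γ.k) → Prog (Γ.sub i)) {m : ℕ} {s : Srt}

abbrev subWork (n : ℕ) : (i : Fin Γ.k) → WorkBound (Γ.sub i) := fun i => (sub i).work n

/-- The expression can be evaluated in parallel, in many contexts. -/
def EClaim (e : Expr Γ m s) : Prop :=
  ∀ (ctr : ℕ) (A : Amb m), A.Below ctr →
    Blk ctr (fun n => A.N.eval n * e.work n (subWork sub n)) (G := Ghost sub m)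
      (fun _ g mem => A.Rep g mem ∧ ∀ j, g.act j → (g.val e j).isSome)
      (fun c R => R.Below c) fun R _ g mem => Vals R mem g.act (g.val e)

variable {sub}

theorem Amb.Rep.on_iff {n : ℕ} {A : Amb m} {g : Ghost sub m n} {mem : BMem} (h : A.Rep g mem)
    {b : ℕ} {cell val : SExp} {i : ℕ} :
    (⟨b, A.N, A.mask, cell, val⟩ : Kernel).On n mem i ↔ g.act i :=
  ⟨fun hi => (h.vec.mask_iff i).1 hi.2, fun hi => ⟨h.vec.lt i hi, (h.vec.mask_iff i).2 hi⟩⟩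

theorem mul_work_le {N a b : ℕ} (h : a ≤ b) : N * a ≤ 1 * (N * b) := by
  rw [one_mul]
  exact Nat.mul_le_mul_left N h

/-! ### Arithmetic, comparisons, Boolean connectives and conditional terms -/

theorem EClaim.binary {s₁ s₂ : Srt} {a : Expr Γ m s₁} {b : Expr Γ m s₂} {e : Expr Γ m s}
    (ha : EClaim sub a) (hb : EClaim sub b)
    (hwa : ∀ n, a.work n (subWork sub n) ≤ e.work n (subWork sub n))
    (hwb : ∀ n, b.work n (subWork sub n) ≤ e.work n (subWork sub n))
    (E : SExp) (hE : E.Below 0)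
    (h : ∀ n (g : Ghost sub m n) j mem v, g.val e j = some v → ∃ va vb, g.val a j = some va ∧
      g.val b j = some vb ∧ E.eval n mem (two va.code vb.code) = v.code) : EClaim sub e := by
  intro ctr A hA
  have hsome : ∀ n (g : Ghost sub m n) (mem : BMem), (∀ j, g.act j → (g.val e j).isSome) →
      ∀ j, g.act j → (g.val a j).isSome ∧ (g.val b j).isSome := fun n g mem hp j hj => by
    obtain ⟨v, hv⟩ := Option.isSome_iff_exists.1 (hp j hj)
    obtain ⟨va, vb, h1, h2, -⟩ := h n g j mem v hv
    simp [h1, h2]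
  refine (ha ctr A hA).bind (fun _ g => g) (hA.stable _)
    (fun n g mem _ hp => ⟨hp.1, fun j hj => (hsome n g mem hp.2 j hj).1⟩) 1
    (fun n => mul_work_le (hwa n)) fun c₁ Ra hc₁ hRa hs₁ => ?_
  refine (hb c₁ A (hA.mono hc₁)).conseq (fun _ g => g) (((hA.stable _).mono hc₁).and hs₁)
    (fun n g mem _ hp => ⟨hp.1.1, fun j hj => (hsome n g mem hp.1.2 j hj).2⟩) 1
    (fun n => mul_work_le (hwb n)) (fun Rb => E.app Ra Rb) ?_ ?_ ?_
  · exact fun c Rb hc hRb => (hE.mono c.zero_le).app (hRa.mono hc) hRb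
  · exact fun c Rb hc hRb =>
      stable_vals ((hE.mono c.zero_le).app (hRa.mono hc) hRb) _ _
  · intro Rb c n g mem _ _ hRb hp hVb j hj
    obtain ⟨v, hv⟩ := Option.isSome_iff_exists.1 (hp.1.2 j hj)
    obtain ⟨va, vb, h1, h2, h3⟩ := h n g j mem v hv
    refine ⟨v, hv, ?_⟩
    rw [SExp.eval_app, hp.2.eval_eq hj h1, hVb.eval_eq hj h2, h3]

/-- For expressions whose value can be read off the description of the contexts. -/
theorem EClaim.simple {e : Expr Γ m s} (R : Amb m → SExp)
    (hR : ∀ ctr A, Amb.Below ctr A → (R A).Below ctr)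
    (h : ∀ n (A : Amb m) (g : Ghost sub m n) mem, A.Rep g mem → Vals (R A) mem g.act (g.val e)) :
    EClaim sub e :=
  fun ctr A hA => Blk.pure (R A) (hR ctr A hA) (stable_vals (hR ctr A hA) _ _)
    fun n g mem _ hp => h n A g mem hp.1

theorem eClaim_bot : EClaim sub (.bot : Expr Γ m .fn) :=
  .simple (fun _ => .lit 0) (fun _ _ _ => trivial)
    fun _ _ _ _ _ _ _ => ⟨none, by simp only [Ghost.val, Expr.eval], rfl⟩

theorem eClaim_var (v : Fin m) : EClaim sub (.var v : Expr Γ m .fn) :=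
  .simple (fun A => .op .add (A.vars v) (.lit 1)) (fun _ _ hA => ⟨hA.vars v, trivial⟩)
    fun _ _ g _ hA j hj => ⟨some (g.env j v), by simp only [Ghost.val, Expr.eval],
      by simp [hA.vec.var j hj]⟩

theorem eClaim_add {a b : Expr Γ m .fn} (ha : EClaim sub a) (hb : EClaim sub b) :
    EClaim sub (.add a b) := by
  refine ha.binary hb (fun n => le_max_left _ _) (fun n => le_max_right _ _)
    -- Elements are coded with a shift by one: codes `x + 1` and `y + 1` add up to `x + y + 2`, so
    -- `2` is subtracted for the comparison with `n`, and `1` to obtain the code of the sum.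
    (.cond (.op .mul (.var 0) (.var 1)) (.cond (.op .lt (.op .sub (.op .add (.var 0) (.var 1))
      (.lit 2)) (.num .size)) (.op .sub (.op .add (.var 0) (.var 1)) (.lit 1)) (.lit 0)) (.lit 0))
    (by simp) ?_
  intro n g j mem v hv
  simp only [Ghost.val, Expr.eval] at hv ⊢
  split at hv
  · rename_i x y hx hy
    cases hv
    refine ⟨_, _, hx, hy, ?_⟩
    have e : (x : ℕ) + 1 + (y + 1) = x + y + 2 := by ring
    by_cases h : (x : ℕ) + y < n <;> simp [toDom, h, e]
  · rename_i va vb hn hx hy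
    cases hv
    refine ⟨_, _, hx, hy, ?_⟩
    rcases va with _ | x
    · simp
    · rcases vb with _ | y
      · simp
      · exact absurd rfl (hn x y rfl)
  · cases hv

theorem eClaim_mul {a b : Expr Γ m .fn} (ha : EClaim sub a) (hb : EClaim sub b) :
    EClaim sub (.mul a b) := by
  refine ha.binary hb (fun n => le_max_left _ _) (fun n => le_max_right _ _)
    (.cond (.op .mul (.var 0) (.var 1)) (.cond (.op .lt (.op .mul (.op .sub (.var 0) (.lit 1))
      (.op .sub (.var 1) (.lit 1))) (.num .size)) (.op .add (.op .mul (.op .sub (.var 0) (.lit 1))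
      (.op .sub (.var 1) (.lit 1))) (.lit 1)) (.lit 0)) (.lit 0))
    (by simp) ?_
  intro n g j mem v hv
  simp only [Ghost.val, Expr.eval] at hv ⊢
  split at hv
  · rename_i x y hx hy
    cases hv
    refine ⟨_, _, hx, hy, ?_⟩
    by_cases h : (x : ℕ) * y < n <;> simp [toDom, h]
  · rename_i va vb hn hx hy
    cases hv
    refine ⟨_, _, hx, hy, ?_⟩
    rcases va with _ | x
    · simp
    · rcases vb with _ | y
      · simp
      · exact absurd rfl (hn x y rfl)
  · cases hv

theorem eClaim_eq {a b : Expr Γ m .fn} (ha : EClaim sub a) (hb : EClaim sub b) :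
    EClaim sub (.eq a b) := by
  refine ha.binary hb (fun n => le_max_left _ _) (fun n => le_max_right _ _)
    -- Codes are compared directly; two undefined terms both have the code `0` and count as equal,
    -- as the semantics demands.
    (.op .sub (.lit 1) (.ne (.var 0) (.var 1))) (by simp) ?_
  intro n g j mem v hv
  simp only [Ghost.val, Expr.eval] at hv ⊢
  split at hv
  · rename_i x y hx hy
    cases hv
    refine ⟨_, _, hx, hy, ?_⟩
    by_cases h : x = y
    · simp [h]
    · simp [h, Val.code_injective.ne h]
  · cases hv

theorem eClaim_le {a b : Expr Γ m .fn} (ha : EClaim sub a) (hb : EClaim sub b) :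
    EClaim sub (.le a b) := by
  refine ha.binary hb (fun n => le_max_left _ _) (fun n => le_max_right _ _)
    (.cond (.op .mul (.var 0) (.var 1)) (.op .sub (.lit 1) (.op .lt (.var 1) (.var 0))) (.lit 0))
    (by simp) ?_
  intro n g j mem v hv
  simp only [Ghost.val, Expr.eval] at hv ⊢
  split at hv
  · rename_i x y hx hy
    cases hv
    refine ⟨_, _, hx, hy, ?_⟩
    by_cases h : x ≤ y
    · simp [h, not_lt.2 h]
    · simp [h, not_le.1 h]
  · rename_i va vb hn hx hy
    cases hv
    refine ⟨_, _, hx, hy, ?_⟩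
    rcases va with _ | x
    · simp
    · rcases vb with _ | y
      · simp
      · exact absurd rfl (hn x y rfl)
  · cases hv

theorem eClaim_neg {c : Expr Γ m .rel} (hc : EClaim sub c) : EClaim sub (.neg c) := by
  -- A unary operation is treated as a binary one, with the same operand twice.
  refine hc.binary hc (fun n => le_rfl) (fun n => le_rfl)
    (.op .sub (.lit 1) (.var 0)) (by simp) ?_
  intro n g j mem v hv
  simp only [Ghost.val, Expr.eval] at hv ⊢
  split at hv
  · rename_i x hx
    cases hv
    refine ⟨_, _, hx, hx, ?_⟩
    cases x <;> simp
  · cases hv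

theorem eClaim_and {a b : Expr Γ m .rel} (ha : EClaim sub a) (hb : EClaim sub b) :
    EClaim sub (.and a b) := by
  refine ha.binary hb (fun n => le_max_left _ _) (fun n => le_max_right _ _)
    (.op .mul (.var 0) (.var 1)) (by simp) ?_
  intro n g j mem v hv
  simp only [Ghost.val, Expr.eval] at hv ⊢
  split at hv
  · rename_i x y hx hy
    cases hv
    refine ⟨_, _, hx, hy, ?_⟩
    cases x <;> cases y <;> simp
  · cases hv

theorem eClaim_or {a b : Expr Γ m .rel} (ha : EClaim sub a) (hb : EClaim sub b) :
    EClaim sub (.or a b) := by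
  refine ha.binary hb (fun n => le_max_left _ _) (fun n => le_max_right _ _)
    (.cond (.var 0) (.lit 1) (.var 1)) (by simp) ?_
  intro n g j mem v hv
  simp only [Ghost.val, Expr.eval] at hv ⊢
  split at hv
  · rename_i x y hx hy
    cases hv
    refine ⟨_, _, hx, hy, ?_⟩
    cases x <;> cases y <;> simp
  · cases hv

/-- Both branches are executed, but each under a mask for the contexts that select it, since only
there its value is known to be meaningful. -/
theorem eClaim_ite {c : Expr Γ m .rel} {t e : Expr Γ m .fn} (hc : EClaim sub c)
    (ht : EClaim sub t) (he : EClaim sub e) : EClaim sub (.ite c t e) := by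
  intro ctr A hA
  have key : ∀ n (g : Ghost sub m n) j, (g.val (.ite c t e) j).isSome →
      (g.val c j = some true ∧ (g.val t j).isSome ∧ g.val (.ite c t e) j = g.val t j) ∨
      (g.val c j = some false ∧ (g.val e j).isSome ∧ g.val (.ite c t e) j = g.val e j) := by
    intro n g j h
    simp only [Ghost.val, Expr.eval] at h ⊢
    split at h
    · rename_i hx; exact .inl ⟨hx, h, rfl⟩
    · rename_i hx; exact .inr ⟨hx, h, rfl⟩
    · cases h
  refine (hc ctr A hA).bind (fun _ g => g) (hA.stable _)
    (fun n g mem _ hp => ⟨hp.1, fun j hj => ?_⟩) 1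
    (fun n => mul_work_le (le_max_left _ _)) fun c₁ Rc hc₁ hRc hs₁ => ?_
  · rcases key n g j (hp.2 j hj) with h | h <;> simp [h.1]
  have hA₁ := hA.mono hc₁
  have hst₁ := ((hA.stable fun n (g : Ghost sub m n) => ∀ j, g.act j →
    (g.val (.ite c t e) j).isSome).mono hc₁).and hs₁
  refine (ht c₁ _ (hA₁.withMask (mask := .op .mul A.mask Rc) ⟨hA₁.mask, hRc⟩)).bind
    (fun _ g => g.withAct fun j => g.act j ∧ g.val c j = some true) hst₁
    (fun n g mem _ hp => ⟨hp.1.1.onTrue hp.2, fun j hj => ?_⟩) 1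
    (fun n => mul_work_le (le_max_of_le_right (le_max_left _ _))) fun c₂ Rt hc₂ hRt hs₂ => ?_
  · rcases key n g j (hp.1.2 j hj.1) with h | h
    · exact h.2.1
    · exact absurd (hj.2.symm.trans h.1) (by simp)
  have hA₂ := hA₁.mono hc₂
  have hRc₂ := hRc.mono hc₂
  refine (he c₂ _ (hA₂.withMask (mask := .op .mul A.mask (.op .sub (.lit 1) Rc))
    ⟨hA₂.mask, trivial, hRc₂⟩)).conseq
    (fun _ g => g.withAct fun j => g.act j ∧ g.val c j = some false) ((hst₁.mono hc₂).and hs₂)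
    (fun n g mem _ hp => ⟨hp.1.1.1.onFalse hp.1.2, fun j hj => ?_⟩) 1
    (fun n => mul_work_le (le_max_of_le_right (le_max_right _ _))) (fun Re => .cond Rc Rt Re)
    ?_ ?_ ?_
  · rcases key n g j (hp.1.1.2 j hj.1) with h | h
    · exact absurd (hj.2.symm.trans h.1) (by simp)
    · exact h.2.1
  · exact fun c Re hc hRe => by simp [hRc₂.mono hc, hRt.mono hc, hRe]
  · exact fun c Re hc hRe => stable_vals (by simp [hRc₂.mono hc, hRt.mono hc, hRe]) _ _
  · intro Re c n g mem _ _ hRe hp hVe j hj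
    rw [SExp.eval_cond]
    rcases key n g j (hp.1.1.2 j hj) with ⟨h1, h2, h3⟩ | ⟨h1, h2, h3⟩
    · rw [hp.1.2.eval_eq hj h1, h3]
      simp only [Val.code_true, one_ne_zero, if_false]
      exact hp.2 j ⟨hj, h1⟩
    · rw [hp.1.2.eval_eq hj h1, h3]
      simp only [Val.code_false, if_true]
      exact hVe j ⟨hj, h1⟩

/-! ## Tuples of terms -/

/-- In every active context the expressions `R` have the codes of the tuple with value `f`. -/
def ArgVals {n k : ℕ} (R : Fin k → SExp) (mem : BMem) (act : ℕ → Prop)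
    (f : ℕ → Option (Option (Fin k → Fin n))) : Prop :=
  ∀ j, act j → ∃ v : Fin k → Option (Fin n), f j = some (tuple v) ∧
    ∀ i, (R i).eval n mem (fun _ => j) = Val.code (s := .fn) (v i)

theorem stable_argVals {G : ℕ → Type} {k c : ℕ} {R : Fin k → SExp} (hR : ∀ i, (R i).Below c)
    (act : ∀ n, G n → ℕ → Prop) (f : ∀ n, G n → ℕ → Option (Option (Fin k → Fin n))) :
    Stable c fun n g m => ArgVals R m (act n g) (f n g) := by
  intro n g m m' ha h j hj
  obtain ⟨v, h1, h2⟩ := h j hj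
  exact ⟨v, h1, fun i => by rw [(hR i).eval_eq ha, h2]⟩

section
variable {n k : ℕ} {R : Fin k → SExp} {mem : BMem} {act : ℕ → Prop}
  {f : ℕ → Option (Option (Fin k → Fin n))}

theorem ArgVals.prodE_ne_zero (h : ArgVals R mem act f) {j : ℕ} (hj : act j) :
    (SExp.prodE R).eval n mem (fun _ => j) ≠ 0 ↔ ∃ a, f j = some (some a) := by
  obtain ⟨v, h1, h2⟩ := h j hj
  rw [SExp.eval_prodE_code h2, h1]
  simp

theorem ArgVals.decodeE_eq (h : ArgVals R mem act f) {j : ℕ} (hj : act j) {a : Fin k → Fin n}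
    (ha : f j = some (some a)) : (SExp.decodeE R).eval n mem (fun _ => j) = tupleCode a := by
  obtain ⟨v, h1, h2⟩ := h j hj
  rw [h1, Option.some_inj] at ha
  exact SExp.eval_decodeE h2 ha

theorem ArgVals.eval_eq (h : ArgVals R mem act f) {j : ℕ} (hj : act j) {a : Fin k → Fin n}
    (ha : f j = some (some a)) (i : Fin k) : (R i).eval n mem (fun _ => j) = a i + 1 := by
  obtain ⟨v, h1, h2⟩ := h j hj
  rw [h1, Option.some_inj, tuple_eq_some] at ha
  rw [h2, ha]
  rfl

end

section
variable {k : ℕ} {args : Fin k → Expr Γ m .fn}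

theorem Ghost.isSome_args {n : ℕ} (g : Ghost sub m n) (j : ℕ) :
    (g.args args j).isSome ↔ ∀ i, (g.val (args i) j).isSome := by
  rw [Ghost.args, evalArgs, Option.isSome_map, isSome_tuple]
  rfl

/-- The arity is fixed, so the arguments may be evaluated one after the other. -/
theorem argsBlk (ha : ∀ i, EClaim sub (args i)) {w : ℕ → ℕ}
    (hw : ∀ i n, (args i).work n (subWork sub n) ≤ w n) (ctr : ℕ) (A : Amb m) (hA : A.Below ctr) :
    Blk ctr (fun n => A.N.eval n * w n) (G := Ghost sub m)
      (fun _ g mem => A.Rep g mem ∧ ∀ j, g.act j → (g.args args j).isSome)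
      (fun c (R : Fin k → SExp) => ∀ i, (R i).Below c)
      fun R _ g mem => ArgVals R mem g.act (g.args args) := by
  have hst := hA.stable fun n (g : Ghost sub m n) => ∀ j, g.act j → (g.args args j).isSome
  refine (Blk.fin (D := SExp) (Good := fun _ c R => R.Below c)
    (Post := fun i R n (g : Ghost sub m n) mem => Vals R mem g.act (g.val (args i))) hst
    (fun i c c' R hc hR => hR.mono hc) (fun i c R hR => stable_vals hR _ _)
    fun i c hc => (ha i c A (hA.mono hc)).conseq (fun _ g => g) (hst.mono hc)
      (fun n g mem _ hp => ⟨hp.1, fun j hj => (g.isSome_args j).1 (hp.2 j hj) i⟩) 1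
      (fun n => mul_work_le (hw i n)) (fun R => R) (fun _ _ _ h => h)
      (fun _ _ _ hR => stable_vals hR _ _) fun _ _ _ _ _ _ _ _ _ h => h).conseq
    (fun _ g => g) hst (fun _ _ _ _ h => h) 1 (fun n => by simp) (fun R => R)
    (fun _ _ _ h => h) (fun _ _ _ hR => stable_argVals hR _ _) ?_
  intro R c n g mem _ _ _ hp h j hj
  choose v hv hc using fun i => h i j hj
  refine ⟨v, ?_, hc⟩
  rw [Ghost.args, evalArgs, show (tuple fun i => (args i).eval (fun i => (sub i).sem n) g.σ g.θ
    (g.τ j) (g.env j)) = some v from tuple_eq_some.2 hv]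
  rfl

end

/-! ### Atoms, function terms and queries to supplementary instances -/

theorem Ghost.val_sym {n : ℕ} (g : Ghost sub m n) (f : Fin (Γ.aux.num s))
    (args : Fin (Γ.aux.arity s f) → Expr Γ m .fn) (j : ℕ) :
    g.val (.sym s f args) j = (g.args args j).map fun v => match v with
      | some a => g.σ s f a
      | none => Val.default n s := by
  rw [Ghost.val, Expr.eval, Ghost.args, evalArgs, Option.map_map]
  congr 1
  funext v
  rw [Function.comp_apply]
  cases tuple v <;> rfl

theorem Ghost.val_loc {n : ℕ} (g : Ghost sub m n) (f : Fin (Γ.tmp.num s))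
    (args : Fin (Γ.tmp.arity s f) → Expr Γ m .fn) (j : ℕ) :
    g.val (.loc s f args) j = (g.args args j).map fun v => match v with
      | some a => g.τ j s f a
      | none => Val.default n s := by
  rw [Ghost.val, Expr.eval, Ghost.args, evalArgs, Option.map_map]
  congr 1
  funext v
  rw [Function.comp_apply]
  cases tuple v <;> rfl

theorem Ghost.val_ask {n : ℕ} (g : Ghost sub m n) (i : Fin Γ.k)
    (q : Fin ((Γ.sub i).qry.num s))
    (args : Fin ((Γ.sub i).qry.arity s q) → Expr Γ m .fn) (j : ℕ) :
    g.val (.ask i s q args) j = (g.args args j).bind fun v => match v with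
      | some a => ((sub i).sem n).query (g.θ i) s q a
      | none => some (Val.default n s) := by
  rw [Ghost.val, Expr.eval, Ghost.args, evalArgs]
  cases tuple fun k => (args k).eval (fun i => (sub i).sem n) g.σ g.θ (g.τ j) (g.env j) with
  | none => rfl
  | some v =>
    rw [Option.map_some, Option.bind_some, Option.bind_some]
    cases tuple v <;> rfl

/-- The product of the codes of the arguments tests for `⊥`. If it vanishes, the value is the
default, which has the code `0` for both sorts; otherwise the arguments are decoded to a cell
number. -/
theorem eClaim_sym (f : Fin (Γ.aux.num s)) {args : Fin (Γ.aux.arity s f) → Expr Γ m .fn}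
    (ha : ∀ i, EClaim sub (args i)) : EClaim sub (.sym s f args) := by
  intro ctr A hA
  refine (argsBlk ha (w := fun n => (Expr.sym s f args).work n (subWork sub n))
    (fun i n => le_maxOne (fun i => (args i).work n (subWork sub n)) i) ctr A hA).conseq
    (fun _ g => g) (hA.stable _) (fun n g mem _ hp => ⟨hp.1, fun j hj => ?_⟩) 1 (fun n => by simp)
    (fun R => .cond (SExp.prodE R) ((A.SV (symBank A.c s f)).at' (SExp.decodeE R)) (.lit 0))
    (fun c R hc hR => ?_) (fun c R hc hR => stable_vals ?_ _ _) fun R c n g mem _ _ _ hp h j hj => ?_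
  · simpa [Ghost.val_sym] using hp.2 j hj
  · simp [SExp.below_prodE hR, ((hA.SV (symBank A.c s f)).mono hc).at (SExp.below_decodeE hR)]
  · simp [SExp.below_prodE hR, ((hA.SV (symBank A.c s f)).mono hc).at (SExp.below_decodeE hR)]
  · rw [SExp.eval_cond, Ghost.val_sym]
    have hne := h.prodE_ne_zero hj
    obtain ⟨v, hv, -⟩ := h j hj
    cases hvv : tuple v with
    | none =>
      rw [hvv] at hv
      rw [if_pos (by by_contra hc; obtain ⟨a, ha⟩ := hne.1 hc; simp [hv] at ha), hv]
      exact ⟨_, rfl, by simp⟩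
    | some a =>
      rw [hvv] at hv
      rw [if_neg (hne.2 ⟨a, hv⟩), hv]
      refine ⟨_, rfl, ?_⟩
      rw [SExp.eval_at, h.decodeE_eq hj hv, ← rd_pair, ← symAddr_eq, hp.1.aux]

theorem eClaim_loc (f : Fin (Γ.tmp.num s)) {args : Fin (Γ.tmp.arity s f) → Expr Γ m .fn}
    (ha : ∀ i, EClaim sub (args i)) : EClaim sub (.loc s f args) := by
  intro ctr A hA
  refine (argsBlk ha (w := fun n => (Expr.loc s f args).work n (subWork sub n))
    (fun i n => le_maxOne (fun i => (args i).work n (subWork sub n)) i) ctr A hA).conseq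
    (fun _ g => g) (hA.stable _) (fun n g mem _ hp => ⟨hp.1, fun j hj => ?_⟩) 1 (fun n => by simp)
    (fun R => .cond (SExp.prodE R)
      (A.tv.app (.var 0) (.pair (.lit (symBank 0 s f)) (SExp.decodeE R))) (.lit 0))
    (fun c R hc hR => ?_) (fun c R hc hR => stable_vals ?_ _ _) fun R c n g mem _ _ _ hp h j hj => ?_
  · simpa [Ghost.val_loc] using hp.2 j hj
  · simp [SExp.below_prodE hR, SExp.below_decodeE hR, SExp.Below.app (hA.tv.mono hc)]
  · simp [SExp.below_prodE hR, SExp.below_decodeE hR, SExp.Below.app (hA.tv.mono hc)]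
  · rw [SExp.eval_cond, Ghost.val_loc]
    have hne := h.prodE_ne_zero hj
    obtain ⟨v, hv, -⟩ := h j hj
    cases hvv : tuple v with
    | none =>
      rw [hvv] at hv
      rw [if_pos (by by_contra hc; obtain ⟨a, ha⟩ := hne.1 hc; simp [hv] at ha), hv]
      exact ⟨_, rfl, by simp⟩
    | some a =>
      rw [hvv] at hv
      rw [if_neg (hne.2 ⟨a, hv⟩), hv]
      refine ⟨_, rfl, ?_⟩
      rw [SExp.eval_app, SExp.eval_pair, h.decodeE_eq hj hv, SExp.eval_lit, SExp.eval_var,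
        ← symAddr_eq, hp.1.tmp j hj]

/-- The query is answered simultaneously for all contexts with defined arguments. Here the product
`N * w` of the number of contexts and the work of the query rule arises. -/
theorem eClaim_ask (i : Fin Γ.k) (q : Fin ((Γ.sub i).qry.num s))
    {args : Fin ((Γ.sub i).qry.arity s q) → Expr Γ m .fn} (hq : QClaim (sub i))
    (ha : ∀ i, EClaim sub (args i)) : EClaim sub (.ask i s q args) := by
  intro ctr A hA
  have hst := hA.stable fun n (g : Ghost sub m n) => ∀ j, g.act j →
    (g.val (.ask i s q args) j).isSome
  refine (argsBlk ha (w := fun n => (Expr.ask i s q args).work n (subWork sub n))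
    (fun i n => (le_maxOne (fun i => (args i).work n (subWork sub n)) i).trans (le_max_left _ _))
    ctr A hA).bind (fun _ g => g) hst (fun n g mem _ hp => ⟨hp.1, fun j hj => ?_⟩) 1
    (fun n => by simp) fun c₁ R hc₁ hR hs₁ => ?_
  · have := hp.2 j hj
    rw [Ghost.val_ask] at this
    cases h : g.args args j with
    | none => simp [h] at this
    | some v => rfl
  have hA₁ := hA.mono hc₁
  refine (hq s q c₁ A.N (Nat.pair A.c i + 1) A.SV (.op .mul A.mask (SExp.prodE R))
    (fun l => .op .sub (R l) (.lit 1)) ⟨hA₁.mask, SExp.below_prodE hR⟩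
    (fun l => ⟨hR l, trivial⟩) hA₁.SV).conseq
    -- The parameter tuple of an inactive context is never looked at, so any default will do.
    (fun n g => ⟨g.pos, g.θ i, fun j => g.act j ∧ ∃ a, g.args args j = some (some a),
      fun j => ((g.args args j).getD none).getD fun _ => ⟨0, g.pos⟩⟩) ((hst.mono hc₁).and hs₁)
    (fun n g mem _ hp => ⟨⟨fun j => ?_, fun j hj => hp.1.1.vec.lt j hj.1, fun j hj l => ?_⟩,
      hp.1.1.sub i, fun j hj => ?_⟩) 1
    (fun n => mul_work_le (le_max_right _ _)) (fun Rq => .cond (SExp.prodE R) Rq (.lit 0))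
    ?_ ?_ ?_
  · rw [SExp.eval_mul, mul_ne_zero_iff, hp.1.1.vec.mask_iff]
    exact and_congr_right fun hj => hp.2.prodE_ne_zero hj
  · obtain ⟨a, ha⟩ := hj.2
    simp [hp.2.eval_eq hj.1 ha, ha]
  · obtain ⟨a, ha⟩ := hj.2
    have := hp.1.2 j hj.1
    rw [Ghost.val_ask, ha] at this
    simpa [ha] using this
  · exact fun c Rq hc hRq => by simp [SExp.below_prodE fun l => (hR l).mono hc, hRq]
  · exact fun c Rq hc hRq =>
      stable_vals (by simp [SExp.below_prodE fun l => (hR l).mono hc, hRq]) _ _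
  · intro Rq c n g mem _ _ _ hp h j hj
    rw [SExp.eval_cond, Ghost.val_ask]
    have hne := hp.2.prodE_ne_zero hj
    obtain ⟨v, hv, -⟩ := hp.2 j hj
    cases hvv : tuple v with
    | none =>
      rw [hvv] at hv
      rw [if_pos (by by_contra hc; obtain ⟨a, ha⟩ := hne.1 hc; simp [hv] at ha), hv]
      exact ⟨_, rfl, by simp⟩
    | some a =>
      rw [hvv] at hv
      rw [if_neg (hne.2 ⟨a, hv⟩), hv]
      simpa [hv] using h j ⟨hj, a, hv⟩

/-! ## Bounded quantification -/

theorem ext_work_le (b : NumFun) (N n w : ℕ) :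
    N * (NumExpr.range b).eval n * w ≤ 2 * (N * (max 1 (b.toFun n) * w)) := by
  calc N * (NumExpr.range b).eval n * w ≤ N * (2 * max 1 (b.toFun n)) * w := by
        gcongr
        exact range_le b n
    _ = _ := by ring

theorem Ghost.eval_ex {n : ℕ} {g : Ghost sub m n} {b : NumFun} {c : Expr Γ (m + 1) .rel} {j : ℕ}
    (h : (g.val (.ex b c) j).isSome) :
    (∀ z : Fin n, (z : ℕ) ≤ b.toFun n → ((g.ext b).val c (childIdx b n j z)).isSome) ∧
    ((∃ z : Fin n, (z : ℕ) ≤ b.toFun n ∧ (g.ext b).val c (childIdx b n j z) = some true) →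
      g.val (.ex b c) j = some true) ∧
    ((¬ ∃ z : Fin n, (z : ℕ) ≤ b.toFun n ∧ (g.ext b).val c (childIdx b n j z) = some true) →
      g.val (.ex b c) j = some false) := by
  have e : ∀ z : Fin n, (z : ℕ) ≤ b.toFun n → (g.ext b).val c (childIdx b n j z) =
      c.eval (fun i => (sub i).sem n) g.σ g.θ (g.τ j) (Fin.snoc (g.env j) z) :=
    fun z hz => Ghost.ext_val hz c
  simp only [Ghost.val, Expr.eval] at h ⊢
  split_ifs at h ⊢ with hd
  · refine ⟨fun z hz => by rw [← Ghost.val, e z hz]; exact hd z hz, ?_, ?_⟩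
    · rintro ⟨z, hz, ht⟩
      rw [← Ghost.val, e z hz] at ht
      simpa using ⟨z, hz, ht⟩
    · intro hn
      simp only [Option.some.injEq, decide_eq_false_iff_not]
      rintro ⟨z, hz, ht⟩
      exact hn ⟨z, hz, by rw [← Ghost.val, e z hz, ht]⟩
  · simp at h

theorem Ghost.eval_unique {n : ℕ} {g : Ghost sub m n} {b : NumFun} {c : Expr Γ (m + 1) .rel}
    {j : ℕ} (h : (g.val (.unique b c) j).isSome) :
    (∀ z : Fin n, (z : ℕ) ≤ b.toFun n → ((g.ext b).val c (childIdx b n j z)).isSome) ∧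
    ∃ z : Fin n, g.val (.unique b c) j = some (some z) ∧ (z : ℕ) ≤ b.toFun n ∧
      (g.ext b).val c (childIdx b n j z) = some true ∧
      ∀ z' : Fin n, (z' : ℕ) ≤ b.toFun n →
        (g.ext b).val c (childIdx b n j z') = some true → z' = z := by
  have e : ∀ z : Fin n, (z : ℕ) ≤ b.toFun n → (g.ext b).val c (childIdx b n j z) =
      c.eval (fun i => (sub i).sem n) g.σ g.θ (g.τ j) (Fin.snoc (g.env j) z) :=
    fun z hz => Ghost.ext_val hz c
  rw [Ghost.val, Expr.eval] at h
  rw [Ghost.val, Expr.eval]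
  split_ifs at h ⊢ with hd
  · refine ⟨fun z hz => by rw [e z hz]; exact hd.1 z hz, hd.2.choose, rfl,
      hd.2.choose_spec.1.1, ?_, fun z' hz' ht => ?_⟩
    · rw [e _ hd.2.choose_spec.1.1, hd.2.choose_spec.1.2]
    · exact hd.2.choose_spec.2 z' ⟨hz', by rw [← e z' hz', ht]⟩
  · simp at h

/-- The kernel in which the contexts of `A.ext b` where `R` is true write `val` at the number
of the context to which they belong. -/
def witnessKernel (A : Amb m) (b : NumFun) (R val : SExp) (bank : ℕ) : Kernel :=
  ⟨bank, (A.ext b).N, .op .mul (A.ext b).mask R, .op .div (.var 0) (.num (.range b)), val⟩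

theorem witnessKernel_on {n : ℕ} {A : Amb m} {g : Ghost sub m n} {mem : BMem} (hA : A.Rep g mem)
    {b : NumFun} {c : Expr Γ (m + 1) .rel} {R : SExp} (hR : Vals R mem (g.ext b).act ((g.ext b).val c))
    {val : SExp} {bank i : ℕ} : (witnessKernel A b R val bank).On n mem i ↔
      (g.ext b).act i ∧ (g.ext b).val c i = some true :=
  ((hA.ext b).onTrue hR).on_iff

/-- A parallel disjunction in one step: each witness writes the same `1` into the cell of its
context. The bank is fresh, so the cell stays `0` if there is no witness. -/
theorem eClaim_ex (b : NumFun) {c : Expr Γ (m + 1) .rel} (hc : EClaim sub c) :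
    EClaim sub (.ex b c) := by
  intro ctr A hA
  have hst := hA.stable fun n (g : Ghost sub m n) => ∀ j, g.act j → (g.val (.ex b c) j).isSome
  refine (hc ctr (A.ext b) (hA.ext b)).bind (fun _ g => g.ext b) hst
    (fun n g mem _ hp => ⟨hp.1.ext b, fun j hj => ?_⟩) 2 (fun n => ext_work_le b _ n _)
    fun c₁ R hc₁ hR hs₁ => ?_
  · obtain ⟨i, z, hz, rfl, hi, -⟩ := Ghost.exists_of_ext_act hj
    exact (Ghost.eval_ex (hp.2 i hi)).1 z hz
  have hA₁ := (hA.mono hc₁).ext b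
  refine (Blk.write [witnessKernel A b R (.lit 1) (tmpBank c₁)] (by simp [witnessKernel])
    (by simp [witnessKernel, hA₁.mask, hR]) (by
      simp only [List.mem_singleton, forall_eq]
      refine ⟨2, fun n => le_trans ?_ (ext_work_le b (A.N.eval n) n (c.work n (subWork sub n)))⟩
      -- One processor for every context of the body is enough, and the work of the body is at least
      -- `1`.
      exact Nat.le_mul_of_pos_right _ (c.one_le_work n _))
    (by simp [witnessKernel])).conseq
    (fun _ g => g) ((hst.mono hc₁).and hs₁) (fun _ _ _ _ h => h) 1 (fun n => (one_mul _).ge)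
    (fun B => .load B (.var 0)) ?_ ?_ ?_
  · rintro c' B - ⟨rfl, rfl⟩
    exact below_load_tmpBank.2 ⟨by omega, trivial⟩
  · rintro c' B - ⟨rfl, rfl⟩
    exact stable_vals (below_load_tmpBank.2 ⟨by omega, SExp.below_var 0⟩) _ _
  · rintro B c' n g mem _ _ _ hp ⟨h1, h2⟩ j hj
    simp only [List.mem_singleton, forall_eq, witnessKernel_on hp.1.1 hp.2] at h1 h2
    obtain ⟨h3, h4, h5⟩ := Ghost.eval_ex (hp.1.2 j hj)
    by_cases hz : ∃ z : Fin n, (z : ℕ) ≤ b.toFun n ∧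
        (g.ext b).val c (childIdx b n j z) = some true
    · refine ⟨_, h4 hz, ?_⟩
      obtain ⟨z, hz, ht⟩ := hz
      have := h1 _ ⟨(Ghost.ext_act hz).2 hj, ht⟩
      simpa [witnessKernel, childIdx_div hz z.2] using this
    · refine ⟨_, h5 hz, ?_⟩
      refine h2 j ?_
      rintro i ⟨hi, ht⟩ rfl
      obtain ⟨i', z, hz', rfl, -⟩ := Ghost.exists_of_ext_act hi
      refine hz ⟨z, hz', ?_⟩
      simpa [witnessKernel, childIdx_div hz' z.2] using ht

/-- As for `eClaim_ex`, but a witness writes its own code, which is the remainder plus one.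
Different witnesses would conflict; definedness of the expression excludes them. -/
theorem eClaim_unique (b : NumFun) {c : Expr Γ (m + 1) .rel} (hc : EClaim sub c) :
    EClaim sub (.unique b c) := by
  intro ctr A hA
  have hst := hA.stable fun n (g : Ghost sub m n) => ∀ j, g.act j →
    (g.val (.unique b c) j).isSome
  refine (hc ctr (A.ext b) (hA.ext b)).bind (fun _ g => g.ext b) hst
    (fun n g mem _ hp => ⟨hp.1.ext b, fun j hj => ?_⟩) 2 (fun n => ext_work_le b _ n _)
    fun c₁ R hc₁ hR hs₁ => ?_
  · obtain ⟨i, z, hz, rfl, hi, -⟩ := Ghost.exists_of_ext_act hj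
    exact (Ghost.eval_unique (hp.2 i hi)).1 z hz
  have hA₁ := (hA.mono hc₁).ext b
  refine (Blk.write [witnessKernel A b R (.op .add (.mod (.var 0) (.num (.range b))) (.lit 1))
      (tmpBank c₁)] (by simp [witnessKernel])
    (by simp [witnessKernel, hA₁.mask, hR]) (by
      simp only [List.mem_singleton, forall_eq]
      refine ⟨2, fun n => le_trans ?_ (ext_work_le b (A.N.eval n) n (c.work n (subWork sub n)))⟩
      exact Nat.le_mul_of_pos_right _ (c.one_le_work n _)) ?_).conseq
    (fun _ g => g) ((hst.mono hc₁).and hs₁) (fun _ _ _ _ h => h) 1 (fun n => (one_mul _).ge)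
    (fun B => .load B (.var 0)) ?_ ?_ ?_
  · intro n g mem _ hp
    simp only [List.mem_singleton, forall_eq, witnessKernel_on hp.1.1 hp.2]
    rintro i i' ⟨hi, ht⟩ ⟨hi', ht'⟩ he
    obtain ⟨j, z, hz, rfl, hj, -⟩ := Ghost.exists_of_ext_act hi
    obtain ⟨j', z', hz', rfl, -⟩ := Ghost.exists_of_ext_act hi'
    simp only [witnessKernel, SExp.eval_div, SExp.eval_var, SExp.eval_num, childIdx_div hz z.2,
      childIdx_div hz' z'.2] at he
    subst he
    obtain ⟨-, w, -, -, -, hw⟩ := Ghost.eval_unique (hp.1.2 j hj)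
    rw [hw z hz ht, hw z' hz' ht']
  · rintro c' B - ⟨rfl, rfl⟩
    exact below_load_tmpBank.2 ⟨by omega, trivial⟩
  · rintro c' B - ⟨rfl, rfl⟩
    exact stable_vals (below_load_tmpBank.2 ⟨by omega, SExp.below_var 0⟩) _ _
  · rintro B c' n g mem _ _ _ hp ⟨h1, -⟩ j hj
    simp only [List.mem_singleton, forall_eq, witnessKernel_on hp.1.1 hp.2] at h1
    obtain ⟨-, z, hv, hz, ht, -⟩ := Ghost.eval_unique (hp.1.2 j hj)
    refine ⟨_, hv, ?_⟩
    have := h1 _ ⟨(Ghost.ext_act hz).2 hj, ht⟩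
    simpa [witnessKernel, childIdx_div hz z.2, childIdx_mod hz z.2] using this

theorem eClaim (hq : ∀ i, QClaim (sub i)) (e : Expr Γ m s) : EClaim sub e := by
  induction e with
  | bot => exact eClaim_bot
  | var v => exact eClaim_var v
  | add a b iha ihb => exact eClaim_add iha ihb
  | mul a b iha ihb => exact eClaim_mul iha ihb
  | sym s f args ih => exact eClaim_sym f ih
  | loc s f args ih => exact eClaim_loc f ih
  | ask i s q args ih => exact eClaim_ask i q (hq i) ih
  | ite c t e ihc iht ihe => exact eClaim_ite ihc iht ihe
  | unique g c ih => exact eClaim_unique g ih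
  | eq a b iha ihb => exact eClaim_eq iha ihb
  | le a b iha ihb => exact eClaim_le iha ihb
  | neg c ih => exact eClaim_neg ih
  | and a b iha ihb => exact eClaim_and iha ihb
  | or a b iha ihb => exact eClaim_or iha ihb
  | ex g c ih => exact eClaim_ex g ih

end

/-! # Execution of instructions in parallel -/

theorem symAddr_inj {A : Schema} {n c : ℕ} {s s' : Srt} {f : Fin (A.num s)} {f' : Fin (A.num s')}
    {a : Fin (A.arity s f) → Fin n} {a' : Fin (A.arity s' f') → Fin n}
    (h : symAddr c s f a = symAddr c s' f' a') :
    (⟨s, f, a⟩ : (s : Srt) × (f : Fin (A.num s)) × (Fin (A.arity s f) → Fin n)) = ⟨s', f', a'⟩ := by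
  rw [symAddr_eq, symAddr_eq, Nat.pair_eq_pair, symBank_inj] at h
  obtain ⟨⟨-, rfl, h⟩, h'⟩ := h
  obtain rfl := Fin.ext h
  rw [tupleCode_injective h']

-- Symbols and tuples are compared through their addresses, which avoids equations between dependent
-- triples.
open scoped Classical in
theorem Struct.code_set {A : Schema} {n : ℕ} (τ : Struct A n) (s : Srt) (f : Fin (A.num s))
    (a : Fin (A.arity s f) → Fin n) (v : Val n s) (s' : Srt) (f' : Fin (A.num s'))
    (a' : Fin (A.arity s' f') → Fin n) : (τ.set s f a v s' f' a').code =
      if symAddr 0 s' f' a' = symAddr 0 s f a then v.code else (τ s' f' a').code := by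
  split_ifs with h
  · cases symAddr_inj h
    exact congrArg Val.code ((congrFun (congrFun (Function.update_self ..) f) a).trans
      ((congrFun (Function.update_self ..) a).trans (Function.update_self ..)))
  · by_cases hs : s' = s
    · subst hs
      refine congrArg Val.code ((congrFun (congrFun (Function.update_self ..) f') a').trans ?_)
      by_cases hf : f' = f
      · subst hf
        have : a' ≠ a := fun h' => h (by rw [h'])
        exact (congrFun (Function.update_self ..) a').trans (Function.update_of_ne this _ _)
      · exact congrFun (Function.update_of_ne hf _ _) a'
    · exact congrArg Val.code (congrFun (congrFun (Function.update_of_ne hs _ _) f') a')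

namespace SExp

/-- The function of two variables `t`, except where the bank `B` has an entry `v + 1`. -/
def overlay (B : ℕ) (t : SExp) : SExp :=
  cond (load B (pair (var 0) (var 1))) (.op .sub (load B (pair (var 0) (var 1))) (lit 1)) t

theorem eval_overlay (B : ℕ) (t : SExp) (n : ℕ) (m : BMem) (j x : ℕ) :
    (overlay B t).eval n m (two j x) =
      if m B (Nat.pair j x) = 0 then t.eval n m (two j x) else m B (Nat.pair j x) - 1 := by
  simp [overlay]

theorem below_overlay {ctr k : ℕ} {t : SExp} (hk : k < ctr) (ht : t.Below ctr) :
    (overlay (tmpBank k) t).Below ctr := by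
  simp only [overlay, below_cond, below_op, below_load_tmpBank]
  simp [hk, ht]

end SExp

/-- A family of pairs of a context and an address. -/
structure LogEntry where
  N : NumExpr
  ctx : SExp
  key : SExp

def LogEntry.Below (ctr : ℕ) (e : LogEntry) : Prop := e.ctx.Below ctr ∧ e.key.Below ctr

def LogEntry.Hits (e : LogEntry) (n : ℕ) (m : BMem) (j x : ℕ) : Prop :=
  ∃ i < e.N.eval n, e.ctx.eval n m (fun _ => i) = j ∧ e.key.eval n m (fun _ => i) = x

section
variable {Γ : Ctx} {sub : (i : Fin Γ.k) → Prog (Γ.sub i)} {m : ℕ} {s : Srt}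

/-- The result of an instruction in the `j`-th context. -/
noncomputable def Ghost.exec {n : ℕ} (g : Ghost sub m n) (c : Cmd Γ m) (j : ℕ) :
    Option (Struct Γ.tmp n) :=
  c.exec (fun i => (sub i).sem n) g.σ g.θ (g.env j) (g.τ j)

/-- The view `tv` shows the results of `f`, and it differs from the previous view only in active
contexts and at addresses in the log `L`. -/
def CmdPost (A : Amb m) (tv : SExp) (L : List LogEntry) {n : ℕ} (g : Ghost sub m n) (mem : BMem)
    (f : ℕ → Option (Struct Γ.tmp n)) : Prop :=
  (∀ j, g.act j → ∃ τ', f j = some τ' ∧ ∀ (s) (f : Fin (Γ.tmp.num s)) a,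
    tv.eval n mem (two j (symAddr 0 s f a)) = (τ' s f a).code) ∧
  ∀ j x, tv.eval n mem (two j x) ≠ A.tv.eval n mem (two j x) → g.act j ∧
    (∃ (s : Srt) (f : Fin (Γ.tmp.num s)) (a : Fin (Γ.tmp.arity s f) → Fin n),
      x = symAddr 0 s f a) ∧ ∃ e ∈ L, e.Hits n mem j x

/-- The size of the log is what makes a later merge affordable: visiting all its entries takes `O(N
* w)` processors. -/
def CmdGood (A : Amb m) (w : ℕ → ℕ) (c : ℕ) (d : SExp × List LogEntry) : Prop :=
  d.1.Below c ∧ ∀ e ∈ d.2, e.Below c ∧ ∃ C, ∀ n, e.N.eval n ≤ C * (A.N.eval n * w n)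

theorem CmdGood.stable {A : Amb m} {w : ℕ → ℕ} {c : ℕ} {d : SExp × List LogEntry}
    (hd : CmdGood A w c d) (hA : A.Below c) {G : ℕ → Type} (φ : ∀ n, G n → Ghost sub m n)
    (f : ∀ n, Ghost sub m n → ℕ → Option (Struct Γ.tmp n)) :
    Stable c fun n g mem => CmdPost A d.1 d.2 (φ n g) mem (f n (φ n g)) := by
  intro n g m m' ha h
  refine ⟨fun j hj => ?_, fun j x hx => ?_⟩
  · obtain ⟨τ', h1, h2⟩ := h.1 j hj
    exact ⟨τ', h1, fun s f a => by rw [hd.1.eval_eq ha, h2]⟩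
  · rw [hd.1.eval_eq ha, hA.tv.eval_eq ha] at hx
    obtain ⟨h1, h2, e, he, i, hi, h3, h4⟩ := h.2 j x hx
    exact ⟨h1, h2, e, he, i, hi, by rw [(hd.2 e he).1.1.eval_eq ha, h3],
      by rw [(hd.2 e he).1.2.eval_eq ha, h4]⟩

theorem CmdGood.mono {A A' : Amb m} {w w' : ℕ → ℕ} {c c' : ℕ} {d : SExp × List LogEntry}
    (hd : CmdGood A w c d) (hN : A'.N = A.N) (hc : c ≤ c') (hw : ∀ n, w n ≤ w' n) :
    CmdGood A' w' c' d := by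
  refine ⟨hd.1.mono hc, fun e he => ?_⟩
  obtain ⟨⟨h1, h2⟩, C, h⟩ := hd.2 e he
  refine ⟨⟨h1.mono hc, h2.mono hc⟩, C, fun n => (h n).trans ?_⟩
  rw [hN]
  gcongr
  exact hw n

variable (sub) in
/-- The instruction can be executed in parallel, in many contexts. -/
def CClaim (c : Cmd Γ m) : Prop :=
  ∀ (ctr : ℕ) (A : Amb m), A.Below ctr →
    Blk ctr (fun n => A.N.eval n * c.work n (subWork sub n)) (G := Ghost sub m)
      (fun _ g mem => A.Rep g mem ∧ ∀ j, g.act j → (g.exec c j).isSome)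
      (CmdGood A fun n => c.work n (subWork sub n))
      fun d _ g mem => CmdPost A d.1 d.2 g mem (g.exec c)

def Amb.withTv (A : Amb m) (tv : SExp) : Amb m := { A with tv := tv }

def Ghost.withτ {n : ℕ} (g : Ghost sub m n) (τ : ℕ → Struct Γ.tmp n) : Ghost sub m n :=
  { g with τ := τ }

theorem Amb.Below.withTv {ctr : ℕ} {A : Amb m} (h : A.Below ctr) {tv : SExp}
    (ht : tv.Below ctr) : (A.withTv tv).Below ctr :=
  ⟨h.SV, h.mask, h.vars, ht⟩

theorem Amb.Rep.withTv {n : ℕ} {A : Amb m} {g : Ghost sub m n} {mem : BMem}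
    (h : A.Rep g mem) {tv : SExp} {τ : ℕ → Struct Γ.tmp n}
    (ht : ∀ j, g.act j → ∀ (s) (f : Fin (Γ.tmp.num s)) a,
      tv.eval n mem (two j (symAddr 0 s f a)) = (τ j s f a).code) :
    (A.withTv tv).Rep (g.withτ τ) mem where
  vec := h.vec
  aux := h.aux
  sub := h.sub
  tmp := ht

/-- The contexts after an instruction. -/
theorem Amb.Rep.after {n : ℕ} {A : Amb m} {g : Ghost sub m n} {mem : BMem} (h : A.Rep g mem)
    {tv : SExp} {L : List LogEntry} {f : ℕ → Option (Struct Γ.tmp n)}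
    (hp : CmdPost A tv L g mem f) :
    (A.withTv tv).Rep (g.withτ fun j => (f j).getD (g.τ j)) mem := by
  refine h.withTv fun j hj s k a => ?_
  obtain ⟨τ', h1, h2⟩ := hp.1 j hj
  rw [h1, h2]
  rfl

theorem cClaim_skip : CClaim sub (.skip : Cmd Γ m) := by
  intro ctr A hA
  have hg : CmdGood A (fun n => (Cmd.skip : Cmd Γ m).work n (subWork sub n)) ctr (A.tv, []) :=
    ⟨hA.tv, by simp⟩
  refine Blk.pure (A.tv, []) hg (hg.stable hA (fun _ g => g) fun n g => g.exec .skip)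
    fun n g mem _ hp => ⟨fun j hj => ⟨g.τ j, by simp only [Ghost.exec, Cmd.exec], hp.1.tmp j hj⟩,
      fun j x hx => absurd rfl hx⟩

/-- The second instruction starts from the view left by the first. An address where the final view
differs from the initial one was changed in one of the two stages, so the logs are concatenated. -/
theorem cClaim_seq {c d : Cmd Γ m} (hc : CClaim sub c) (hd : CClaim sub d) :
    CClaim sub (.seq c d) := by
  intro ctr A hA
  have key : ∀ n (g : Ghost sub m n) j, g.exec (.seq c d) j =
      (g.exec c j).bind fun τ => (g.withτ fun j => (g.exec c j).getD (g.τ j)).exec d j := by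
    intro n g j
    simp only [Ghost.exec, Cmd.exec]
    cases h : c.exec (fun i => (sub i).sem n) g.σ g.θ (g.env j) (g.τ j) with
    | none => rfl
    | some τ => simp [Ghost.withτ, h]
  have hst := hA.stable fun n (g : Ghost sub m n) => ∀ j, g.act j → (g.exec (.seq c d) j).isSome
  have hw₁ : ∀ n, c.work n (subWork sub n) ≤ (Cmd.seq c d).work n (subWork sub n) :=
    fun n => le_max_left _ _
  have hw₂ : ∀ n, d.work n (subWork sub n) ≤ (Cmd.seq c d).work n (subWork sub n) :=
    fun n => le_max_right _ _
  refine (hc ctr A hA).bind (fun _ g => g) hst (fun n g mem _ hp => ⟨hp.1, fun j hj => ?_⟩) 1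
    (fun n => mul_work_le (hw₁ n)) fun c₁ d₁ hc₁ hd₁ hs₁ => ?_
  · have := hp.2 j hj
    rw [key] at this
    cases h : g.exec c j <;> simp_all
  have hA₁ := hA.mono hc₁
  have hgood : ∀ c₂ d₂, c₁ ≤ c₂ → CmdGood (A.withTv d₁.1) (fun n => d.work n (subWork sub n)) c₂ d₂ →
      CmdGood A (fun n => (Cmd.seq c d).work n (subWork sub n)) c₂ (d₂.1, d₁.2 ++ d₂.2) := by
    intro c₂ d₂ hc₂ hd₂
    have h₁ := hd₁.mono (A' := A) rfl hc₂ hw₁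
    have h₂ := hd₂.mono (A' := A) rfl le_rfl hw₂
    refine ⟨h₂.1, fun e he => ?_⟩
    rcases List.mem_append.1 he with he | he
    · exact h₁.2 e he
    · exact h₂.2 e he
  refine (hd c₁ (A.withTv d₁.1) (hA₁.withTv hd₁.1)).conseq
    (fun _ g => g.withτ fun j => (g.exec c j).getD (g.τ j)) ((hst.mono hc₁).and hs₁)
    (fun n g mem _ hp => ⟨hp.1.1.after hp.2, fun j hj => ?_⟩) 1 (fun n => mul_work_le (hw₂ n))
    (fun d₂ => (d₂.1, d₁.2 ++ d₂.2)) hgood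
    (fun c₂ d₂ hc₂ hd₂ => (hgood c₂ d₂ hc₂ hd₂).stable (hA₁.mono hc₂) (fun _ g => g)
      fun n g => g.exec (.seq c d)) ?_
  · have := hp.1.2 j hj
    rw [key] at this
    cases h : g.exec c j <;> simp_all
  · intro d₂ c₂ n g mem _ _ _ hp h
    refine ⟨fun j hj => ?_, fun j x hx => ?_⟩
    · obtain ⟨τ₁, h1, -⟩ := hp.2.1 j hj
      obtain ⟨τ₂, h2, h3⟩ := h.1 j hj
      exact ⟨τ₂, by rw [key, h1, ← h2]; rfl, h3⟩
    · by_cases h1 : d₁.1.eval n mem (two j x) = A.tv.eval n mem (two j x)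
      · rw [← h1] at hx
        obtain ⟨h2, h3, e, he, h4⟩ := h.2 j x hx
        exact ⟨h2, h3, e, by simp [he], h4⟩
      · obtain ⟨h2, h3, e, he, h4⟩ := hp.2.2 j x h1
        exact ⟨h2, h3, e, by simp [he], h4⟩

/-- The branches are run one after the other on the same view. They do not interfere, because each
alters the view only in the contexts that select it. -/
theorem cClaim_ite {b : Expr Γ m .rel} {c d : Cmd Γ m} (hb : EClaim sub b) (hc : CClaim sub c)
    (hd : CClaim sub d) : CClaim sub (.ite b c d) := by
  intro ctr A hA
  have key : ∀ n (g : Ghost sub m n) j, (g.exec (.ite b c d) j).isSome →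
      (g.val b j = some true ∧ (g.exec c j).isSome ∧ g.exec (.ite b c d) j = g.exec c j) ∨
      (g.val b j = some false ∧ (g.exec d j).isSome ∧ g.exec (.ite b c d) j = g.exec d j) := by
    intro n g j h
    simp only [Ghost.val, Ghost.exec, Cmd.exec] at h ⊢
    split at h
    · rename_i hx; exact .inl ⟨hx, h, rfl⟩
    · rename_i hx; exact .inr ⟨hx, h, rfl⟩
    · cases h
  have hst := hA.stable fun n (g : Ghost sub m n) => ∀ j, g.act j → (g.exec (.ite b c d) j).isSome
  have hw₁ : ∀ n, c.work n (subWork sub n) ≤ (Cmd.ite b c d).work n (subWork sub n) :=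
    fun n => le_max_of_le_right (le_max_left _ _)
  have hw₂ : ∀ n, d.work n (subWork sub n) ≤ (Cmd.ite b c d).work n (subWork sub n) :=
    fun n => le_max_of_le_right (le_max_right _ _)
  refine (hb ctr A hA).bind (fun _ g => g) hst (fun n g mem _ hp => ⟨hp.1, fun j hj => ?_⟩) 1
    (fun n => mul_work_le (le_max_left _ _)) fun c₁ R hc₁ hR hs₁ => ?_
  · rcases key n g j (hp.2 j hj) with h | h <;> simp [h.1]
  have hA₁ := hA.mono hc₁
  refine (hc c₁ _ (hA₁.withMask (mask := .op .mul A.mask R) ⟨hA₁.mask, hR⟩)).bind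
    (fun _ g => g.withAct fun j => g.act j ∧ g.val b j = some true) ((hst.mono hc₁).and hs₁)
    (fun n g mem _ hp => ⟨hp.1.1.onTrue hp.2, fun j hj => ?_⟩) 1
    (fun n => mul_work_le (hw₁ n)) fun c₂ d₁ hc₂ hd₁ hs₂ => ?_
  · rcases key n g j (hp.1.2 j hj.1) with h | h
    · exact h.2.1
    · exact absurd (hj.2.symm.trans h.1) (by simp)
  have hA₂ := hA₁.mono hc₂
  have hgood : ∀ c₃ d₂, c₂ ≤ c₃ →
      CmdGood ((A.withTv d₁.1).withMask (.op .mul A.mask (.op .sub (.lit 1) R)))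
        (fun n => d.work n (subWork sub n)) c₃ d₂ →
      CmdGood A (fun n => (Cmd.ite b c d).work n (subWork sub n)) c₃ (d₂.1, d₁.2 ++ d₂.2) := by
    intro c₃ d₂ hc₃ hd₂
    have h₁ := hd₁.mono (A' := A) rfl hc₃ hw₁
    have h₂ := hd₂.mono (A' := A) rfl le_rfl hw₂
    refine ⟨h₂.1, fun e he => ?_⟩
    rcases List.mem_append.1 he with he | he
    · exact h₁.2 e he
    · exact h₂.2 e he
  -- Where the condition fails, the first branch has left the view as it was.
  have hsame : ∀ n (g : Ghost sub m n) mem, CmdPost (A.withMask (.op .mul A.mask R)) d₁.1 d₁.2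
      (g.withAct fun j => g.act j ∧ g.val b j = some true) mem
        ((g.withAct fun j => g.act j ∧ g.val b j = some true).exec c) →
      ∀ j x, g.val b j ≠ some true →
        d₁.1.eval n mem (two j x) = A.tv.eval n mem (two j x) := by
    intro n g mem h j x hj
    by_contra hne
    exact hj (h.2 j x hne).1.2
  refine (hd c₂ _ ((hA₂.withTv hd₁.1).withMask (mask := .op .mul A.mask (.op .sub (.lit 1) R))
    ⟨hA₂.mask, trivial, hR.mono hc₂⟩)).conseq
    (fun _ g => g.withAct fun j => g.act j ∧ g.val b j = some false)
    ((((hst.mono hc₁).and hs₁).mono hc₂).and hs₂)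
    (fun n g mem _ hp => ⟨?_, fun j hj => ?_⟩) 1
    (fun n => mul_work_le (hw₂ n)) (fun d₂ => (d₂.1, d₁.2 ++ d₂.2)) hgood
    (fun c₂ d₂ hc₂ hd₂ => (hgood c₂ d₂ hc₂ hd₂).stable (hA₂.mono hc₂) (fun _ g => g)
      fun n g => g.exec (.ite b c d)) ?_
  · have h := hp.1.1.1.onFalse hp.1.2
    refine ⟨h.vec, h.aux, h.sub, fun j hj s f a => ?_⟩
    rw [← h.tmp j hj]
    exact hsame n g mem hp.2 j _ (by rw [hj.2]; simp)
  · rcases key n g j (hp.1.1.2 j hj.1) with h | h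
    · exact absurd (hj.2.symm.trans h.1) (by simp)
    · exact h.2.1
  · intro d₂ c₃ n g mem _ _ _ hp h
    refine ⟨fun j hj => ?_, fun j x hx => ?_⟩
    · rcases key n g j (hp.1.1.2 j hj) with ⟨h1, h2, h3⟩ | ⟨h1, h2, h3⟩
      · obtain ⟨τ', h4, h5⟩ := hp.2.1 j ⟨hj, h1⟩
        refine ⟨τ', h3.trans h4, fun s f a => ?_⟩
        rw [← h5]
        by_contra hne
        exact absurd (h1.symm.trans (h.2 j _ hne).1.2) (by simp)
      · obtain ⟨τ', h4, h5⟩ := h.1 j ⟨hj, h1⟩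
        exact ⟨τ', h3.trans h4, h5⟩
    · by_cases h1 : d₁.1.eval n mem (two j x) = A.tv.eval n mem (two j x)
      · rw [← h1] at hx
        obtain ⟨h2, h3, e, he, h4⟩ := h.2 j x hx
        exact ⟨h2.1, h3, e, by simp [he], h4⟩
      · obtain ⟨h2, h3, e, he, h4⟩ := hp.2.2 j x h1
        exact ⟨h2.1, h3, e, by simp [he], h4⟩

theorem Ghost.exec_assign {n : ℕ} {g : Ghost sub m n} {f : Fin (Γ.tmp.num s)}
    {args : Fin (Γ.tmp.arity s f) → Expr Γ m .fn} {e : Expr Γ m s} {j : ℕ}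
    (h : (g.exec (.assign s f args e) j).isSome) :
    ∃ a v, g.args args j = some a ∧ g.val e j = some v ∧ g.exec (.assign s f args e) j =
      some (match a with
        | some a => (g.τ j).set s f a v
        | none => g.τ j) := by
  rw [Ghost.exec, Cmd.exec] at h
  rw [Ghost.exec, Cmd.exec]
  split at h
  · rename_i a v h1 h2
    exact ⟨some a, v, h1, h2, rfl⟩
  · rename_i v h1 h2
    exact ⟨none, v, h1, h2, rfl⟩
  · cases h

/-- Each context writes at most one entry, at the pair of its own number and the address, so there
are no conflicts. The code is stored with a further shift by one, to distinguish a written `0` from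
no entry. -/
theorem cClaim_assign (f : Fin (Γ.tmp.num s)) {args : Fin (Γ.tmp.arity s f) → Expr Γ m .fn}
    {e : Expr Γ m s} (ha : ∀ i, EClaim sub (args i)) (he : EClaim sub e) :
    CClaim sub (.assign s f args e) := by
  intro ctr A hA
  have hst := hA.stable fun n (g : Ghost sub m n) => ∀ j, g.act j →
    (g.exec (.assign s f args e) j).isSome
  refine (argsBlk ha (w := fun n => (Cmd.assign s f args e).work n (subWork sub n))
    (fun i n => (le_maxOne (fun i => (args i).work n (subWork sub n)) i).trans (le_max_left _ _))
    ctr A hA).bind (fun _ g => g) hst (fun n g mem _ hp => ⟨hp.1, fun j hj => ?_⟩) 1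
    (fun n => by simp) fun c₁ R hc₁ hR hs₁ => ?_
  · obtain ⟨a, v, h, -⟩ := Ghost.exec_assign (hp.2 j hj)
    simp [h]
  have hA₁ := hA.mono hc₁
  refine (he c₁ A hA₁).bind (fun _ g => g) ((hst.mono hc₁).and hs₁)
    (fun n g mem _ hp => ⟨hp.1.1, fun j hj => ?_⟩) 1
    (fun n => mul_work_le (le_max_right _ _)) fun c₂ Re hc₂ hRe hs₂ => ?_
  · obtain ⟨a, v, -, h, -⟩ := Ghost.exec_assign (hp.1.2 j hj)
    simp [h]
  have hA₂ := hA₁.mono hc₂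
  have hp₂ := SExp.below_prodE fun i => (hR i).mono hc₂
  have hd₂ := SExp.below_decodeE fun i => (hR i).mono hc₂
  have hon : ∀ n (g : Ghost sub m n) (mem : BMem), A.Rep g mem →
      ArgVals R mem g.act (g.args args) → ∀ (B : ℕ) (cell val : SExp) (i : ℕ),
      (⟨B, A.N, .op .mul A.mask (SExp.prodE R), cell, val⟩ : Kernel).On n mem i ↔
        g.act i ∧ ∃ a, g.args args i = some (some a) := by
    intro n g mem hA hR B cell val i
    exact (hA.withMask (mask := .op .mul A.mask (SExp.prodE R))
      (act := fun j => g.act j ∧ ∃ a, g.args args j = some (some a)) (fun j => by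
        rw [SExp.eval_mul, mul_ne_zero_iff, hA.vec.mask_iff]
        exact and_congr_right fun hj => hR.prodE_ne_zero hj) fun j hj => hj.1).on_iff
  have hw : ∀ n, A.N.eval n ≤
      1 * (A.N.eval n * (Cmd.assign s f args e).work n (subWork sub n)) := fun n => by
    rw [one_mul]
    exact Nat.le_mul_of_pos_right _ (le_max_of_le_left (one_le_maxOne _))
  have hgood : ∀ c', c₂ < c' →
      CmdGood A (fun n => (Cmd.assign s f args e).work n (subWork sub n)) c'
        (SExp.overlay (tmpBank c₂) A.tv, [⟨A.N, .var 0,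
          .pair (.lit (symBank 0 s f)) (SExp.decodeE R)⟩]) := by
    intro c' hc
    refine ⟨SExp.below_overlay hc (hA₂.tv.mono hc.le), ?_⟩
    simp only [List.mem_singleton, forall_eq]
    exact ⟨⟨trivial, by simp [hd₂.mono hc.le]⟩, 1, hw⟩
  refine (Blk.write [⟨tmpBank c₂, A.N, .op .mul A.mask (SExp.prodE R),
      .pair (.var 0) (.pair (.lit (symBank 0 s f)) (SExp.decodeE R)), .op .add Re (.lit 1)⟩]
    (by simp) (by simp [hA₂.mask, hp₂, hd₂, hRe]) (by simpa using ⟨1, hw⟩) (by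
      intro n g mem _ _
      simp +contextual [Nat.pair_eq_pair])).conseq
    (fun _ g => g) ((((hst.mono hc₁).and hs₁).mono hc₂).and hs₂) (fun _ _ _ _ h => h) 1
    (fun n => (one_mul _).ge)
    (fun B => (SExp.overlay B A.tv, [⟨A.N, .var 0,
      .pair (.lit (symBank 0 s f)) (SExp.decodeE R)⟩])) ?_ ?_ ?_
  · rintro c' B - ⟨rfl, rfl⟩
    exact hgood _ (by omega)
  · rintro c' B - ⟨rfl, rfl⟩
    exact (hgood _ (by omega)).stable (hA₂.mono (by omega)) (fun _ g => g)
      fun n g => g.exec (.assign s f args e)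
  · rintro B c' n g mem - - - hp ⟨h1, h2⟩
    simp only [List.mem_singleton, forall_eq, hon n g mem hp.1.1.1 hp.1.2, SExp.eval_pair,
      SExp.eval_var, SExp.eval_lit, SExp.eval_add] at h1 h2
    refine ⟨fun j hj => ?_, fun j x hx => ?_⟩
    · obtain ⟨a, v, h3, h4, h5⟩ := Ghost.exec_assign (hp.1.1.2 j hj)
      refine ⟨_, h5, fun s' f' a' => ?_⟩
      rw [SExp.eval_overlay, hp.1.1.1.tmp j hj]
      cases a with
      | none =>
        rw [if_pos]
        refine h2 _ ?_
        rintro i ⟨hi, a, ha⟩ he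
        obtain ⟨rfl, -⟩ := Nat.pair_eq_pair.1 he
        simp [h3] at ha
      | some a =>
        have h6 := h1 j ⟨hj, a, h3⟩
        rw [hp.1.2.decodeE_eq hj h3, ← symAddr_eq, hp.2.eval_eq hj h4] at h6
        dsimp only
        rw [Struct.code_set]
        by_cases h7 : symAddr 0 s' f' a' = symAddr 0 s f a
        · rw [if_pos h7, h7, h6]
          simp
        · rw [if_neg h7, if_pos]
          refine h2 _ ?_
          rintro i ⟨hi, a, ha⟩ he
          obtain ⟨rfl, he⟩ := Nat.pair_eq_pair.1 he
          rw [h3] at ha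
          cases ha
          rw [hp.1.2.decodeE_eq hj h3, ← symAddr_eq] at he
          exact h7 (Nat.pair_eq_pair.1 he).2.symm
    · rw [SExp.eval_overlay] at hx
      split_ifs at hx with h0
      · exact absurd rfl hx
      · have : ∃ i, (g.act i ∧ ∃ a, g.args args i = some (some a)) ∧
            Nat.pair i (Nat.pair (symBank 0 s f) ((SExp.decodeE R).eval n mem fun _ => i)) =
              Nat.pair j x := by
          by_contra hne
          exact h0 (h2 _ fun i hi he => hne ⟨i, hi, he⟩)
        obtain ⟨i, ⟨hi, a, ha⟩, he⟩ := this
        obtain ⟨rfl, rfl⟩ := Nat.pair_eq_pair.1 he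
        refine ⟨hi, ⟨s, f, a, ?_⟩, _, List.mem_singleton_self _, i, hp.1.1.1.vec.lt i hi, rfl, ?_⟩
        · rw [hp.1.2.decodeE_eq hi ha, ← symAddr_eq]
        · simp

/-! ## Parallel branches -/

theorem Ghost.ext_exec {n j : ℕ} {g : Ghost sub m n} {b : NumFun} {z : Fin n}
    (hz : (z : ℕ) ≤ b.toFun n) (c : Cmd Γ (m + 1)) :
    (g.ext b).exec c (childIdx b n j z) =
      c.exec (fun i => (sub i).sem n) g.σ g.θ (Fin.snoc (g.env j) z) (g.τ j) := by
  rw [Ghost.exec, Ghost.ext_env hz, Ghost.ext_τ hz]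
  rfl

/-- The merge, value by value: either some branch changed the value and its result is taken over, or
no branch did. This frees the later argument from the choice in `mergeBranches`. -/
theorem Ghost.exec_par {n : ℕ} {g : Ghost sub m n} {b : NumFun} {c : Cmd Γ (m + 1)} {j : ℕ}
    (h : (g.exec (.par b c) j).isSome) :
    ∃ ρ : Fin n → Struct Γ.tmp n,
      (∀ z : Fin n, (z : ℕ) ≤ b.toFun n → (g.ext b).exec c (childIdx b n j z) = some (ρ z)) ∧
      (∀ (z z' : Fin n) (s : Srt) (f : Fin (Γ.tmp.num s)) (a : Fin (Γ.tmp.arity s f) → Fin n),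
        (z : ℕ) ≤ b.toFun n → (z' : ℕ) ≤ b.toFun n → ρ z s f a ≠ g.τ j s f a →
        ρ z' s f a ≠ g.τ j s f a → ρ z s f a = ρ z' s f a) ∧
      ∃ τ', g.exec (.par b c) j = some τ' ∧ ∀ (s : Srt) (f : Fin (Γ.tmp.num s)) a,
        (∃ z : Fin n, (z : ℕ) ≤ b.toFun n ∧ ρ z s f a ≠ g.τ j s f a ∧ τ' s f a = ρ z s f a) ∨
        (∀ z : Fin n, (z : ℕ) ≤ b.toFun n → ρ z s f a = g.τ j s f a) ∧
          τ' s f a = g.τ j s f a := by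
  rw [Ghost.exec, Cmd.exec] at h
  rw [Ghost.exec, Cmd.exec]
  split_ifs at h ⊢ with hd
  · refine ⟨fun z => (c.exec (fun i => (sub i).sem n) g.σ g.θ (Fin.snoc (g.env j) z)
      (g.τ j)).getD (g.τ j), fun z hz => ?_, ?_⟩
    rotate_left
    · rw [mergeBranches] at h ⊢
      split_ifs at h ⊢ with hm
      · refine ⟨hm, _, rfl, fun s f a => ?_⟩
        by_cases hex : ∃ z : Fin n, (z : ℕ) ≤ b.toFun n ∧
            (c.exec (fun i => (sub i).sem n) g.σ g.θ (Fin.snoc (g.env j) z) (g.τ j)).getD (g.τ j)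
              s f a ≠ g.τ j s f a
        · refine .inl ⟨hex.choose, hex.choose_spec.1, hex.choose_spec.2, ?_⟩
          rw [dif_pos hex]
        · refine .inr ⟨fun z hz => by_contra fun hne => hex ⟨z, hz, hne⟩, ?_⟩
          rw [dif_neg hex]
      · simp at h
    · rw [Ghost.ext_exec hz]
      obtain ⟨ρ, hρ⟩ := Option.isSome_iff_exists.1 (hd z hz)
      simp only [hρ, Option.getD_some]
  · simp at h

theorem Amb.eval_ext_tv (A : Amb m) (b : NumFun) (n : ℕ) (mem : BMem) (j x : ℕ) :
    (A.ext b).tv.eval n mem (two j x) =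
      A.tv.eval n mem (two (j / (NumExpr.range b).eval n) x) := by
  simp [Amb.ext]

/-- The kernel that takes over the changes at the addresses in a log. -/
def mergeKernel (A : Amb m) (b : NumFun) (tv : SExp) (B : ℕ) (e : LogEntry) : Kernel :=
  ⟨B, e.N, .ne (tv.app e.ctx e.key) ((A.ext b).tv.app e.ctx e.key),
    .pair (.op .div e.ctx (.num (.range b))) e.key, .op .add (tv.app e.ctx e.key) (.lit 1)⟩

theorem mergeKernel_on {A : Amb m} {b : NumFun} {tv : SExp} {B : ℕ} {e : LogEntry} {n : ℕ}
    {mem : BMem} {i : ℕ} : (mergeKernel A b tv B e).On n mem i ↔ i < e.N.eval n ∧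
      tv.eval n mem (two (e.ctx.eval n mem fun _ => i) (e.key.eval n mem fun _ => i)) ≠
        (A.ext b).tv.eval n mem
          (two (e.ctx.eval n mem fun _ => i) (e.key.eval n mem fun _ => i)) := by
  simp [mergeKernel, Kernel.On]

/-- A change in a child context: the branch to which it belongs. -/
theorem CmdPost.exists_branch {n : ℕ} {A : Amb m} {b : NumFun} {c : Cmd Γ (m + 1)} {tv : SExp}
    {L : List LogEntry} {g : Ghost sub m n} {mem : BMem} (hA : A.Rep g mem)
    (hp : CmdPost (A.ext b) tv L (g.ext b) mem ((g.ext b).exec c)) {j x : ℕ}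
    (hx : tv.eval n mem (two j x) ≠ (A.ext b).tv.eval n mem (two j x)) :
    ∃ (z : Fin n) (s : Srt) (f : Fin (Γ.tmp.num s)) (a : Fin (Γ.tmp.arity s f) → Fin n)
      (ρ : Struct Γ.tmp n), (z : ℕ) ≤ b.toFun n ∧
      g.act (j / (NumExpr.range b).eval n) ∧
      j = childIdx b n (j / (NumExpr.range b).eval n) z ∧
      x = symAddr 0 s f a ∧ (g.ext b).exec c j = some ρ ∧
      ρ s f a ≠ g.τ (j / (NumExpr.range b).eval n) s f a ∧
      tv.eval n mem (two j x) = (ρ s f a).code := by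
  obtain ⟨h1, ⟨s, f, a, rfl⟩, -⟩ := hp.2 j x hx
  obtain ⟨ρ, h2, h3⟩ := hp.1 j h1
  obtain ⟨i, z, hz, h4, hi, rfl, -⟩ := Ghost.exists_of_ext_act h1
  refine ⟨z, s, f, a, ρ, hz, hi, h4, rfl, h2, fun he => hx ?_, h3 s f a⟩
  rw [h3, he, (hA.ext b).tmp j h1]
  rfl

/-- The body runs in the child contexts. Each entry of its log compares the views before and after
the body, and where they differ it writes the new value for the parent context. The log of the
parent is the same list with the contexts divided by the range, so it does not grow. -/
theorem cClaim_par (b : NumFun) {c : Cmd Γ (m + 1)} (hc : CClaim sub c) :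
    CClaim sub (.par b c) := by
  intro ctr A hA
  have hst := hA.stable fun n (g : Ghost sub m n) => ∀ j, g.act j → (g.exec (.par b c) j).isSome
  refine (hc ctr (A.ext b) (hA.ext b)).bind (fun _ g => g.ext b) hst
    (fun n g mem _ hp => ⟨hp.1.ext b, fun j hj => ?_⟩) 2 (fun n => ext_work_le b _ n _)
    fun c₁ d hc₁ hd hs₁ => ?_
  · obtain ⟨i, z, hz, rfl, hi, -⟩ := Ghost.exists_of_ext_act hj
    obtain ⟨ρ, h, -⟩ := Ghost.exec_par (hp.2 i hi)
    simp [h z hz]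
  have hA₁ := hA.mono hc₁
  have hAe := hA₁.ext b
  have hN : ∀ e ∈ d.2, ∃ C, ∀ n, e.N.eval n ≤
      C * (A.N.eval n * (Cmd.par b c).work n (subWork sub n)) := by
    intro e he
    obtain ⟨-, C, hC⟩ := hd.2 e he
    refine ⟨C * 2, fun n => (hC n).trans ?_⟩
    rw [mul_assoc]
    exact Nat.mul_le_mul_left C (ext_work_le b (A.N.eval n) n (c.work n (subWork sub n)))
  have hgood : ∀ c', c₁ < c' → CmdGood A (fun n => (Cmd.par b c).work n (subWork sub n)) c'
      (SExp.overlay (tmpBank c₁) A.tv,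
        d.2.map fun e => ⟨e.N, .op .div e.ctx (.num (.range b)), e.key⟩) := by
    intro c' hc'
    refine ⟨SExp.below_overlay hc' (hA₁.tv.mono hc'.le), fun e he => ?_⟩
    obtain ⟨e, hed, rfl⟩ := List.mem_map.1 he
    exact ⟨⟨⟨(hd.2 e hed).1.1.mono hc'.le, trivial⟩, (hd.2 e hed).1.2.mono hc'.le⟩, hN e hed⟩
  refine (Blk.write (d.2.map (mergeKernel A b d.1 (tmpBank c₁))) ?_ ?_ ?_ ?_).conseq
    (fun _ g => g) ((hst.mono hc₁).and hs₁) (fun _ _ _ _ h => h) 1 (fun n => (one_mul _).ge)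
    (fun B => (SExp.overlay B A.tv,
        d.2.map fun e => ⟨e.N, .op .div e.ctx (.num (.range b)), e.key⟩)) ?_ ?_ ?_
  · intro k hk
    obtain ⟨e, he, rfl⟩ := List.mem_map.1 hk
    rfl
  · intro k hk
    obtain ⟨e, he, rfl⟩ := List.mem_map.1 hk
    obtain ⟨h1, h2⟩ := (hd.2 e he).1
    simp [mergeKernel, h1, h2, hd.1.app h1 h2, hAe.tv.app h1 h2]
  · intro k hk
    obtain ⟨e, he, rfl⟩ := List.mem_map.1 hk
    exact hN e he
  · intro n g mem _ hp k hk k' hk' i i' hi hi' hcell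
    obtain ⟨e, he, rfl⟩ := List.mem_map.1 hk
    obtain ⟨e', he', rfl⟩ := List.mem_map.1 hk'
    rw [mergeKernel_on] at hi hi'
    obtain ⟨z, s, f, a, ρ, h1, h2, h3, h4, h5, h6, h7⟩ := hp.2.exists_branch hp.1.1 hi.2
    obtain ⟨z', s', f', a', ρ', h1', h2', h3', h4', h5', h6', h7'⟩ :=
      hp.2.exists_branch hp.1.1 hi'.2
    simp only [mergeKernel, SExp.eval_pair, SExp.eval_div, SExp.eval_num, Nat.pair_eq_pair] at hcell
    rw [h4, h4'] at hcell
    obtain ⟨hcell, hkey⟩ := hcell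
    cases symAddr_inj hkey
    -- Two processors with the same target represent two branches of one context that changed the
    -- same value; the merge condition `r2` makes their results equal.
    obtain ⟨ρs, r1, r2, -⟩ := Ghost.exec_par (hp.1.2 _ h2)
    rw [h3, r1 z h1] at h5
    rw [h3', ← hcell, r1 z' h1'] at h5'
    cases h5
    cases h5'
    rw [← hcell] at h6'
    simp only [mergeKernel, SExp.eval_add, SExp.eval_app, SExp.eval_lit, h7, h7']
    rw [r2 z z' s f a h1 h1' h6 h6']
  · rintro c' B - ⟨rfl, rfl⟩
    exact hgood _ (by omega)
  · rintro c' B - ⟨rfl, rfl⟩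
    exact (hgood _ (by omega)).stable (hA₁.mono (by omega)) (fun _ g => g)
      fun n g => g.exec (.par b c)
  · rintro B c' n g mem - - - hp ⟨h1, h2⟩
    simp only [List.forall_mem_map, mergeKernel_on] at h1 h2
    refine ⟨fun j hj => ?_, fun j x hx => ?_⟩
    · obtain ⟨ρs, r1, r2, τ', r3, r4⟩ := Ghost.exec_par (hp.1.2 j hj)
      refine ⟨τ', r3, fun s f a => ?_⟩
      rw [SExp.eval_overlay]
      rcases r4 s f a with ⟨z, hz, hne, hτ⟩ | ⟨hno, hτ⟩
      · have hact := (Ghost.ext_act (j := j) (g := g) hz).2 hj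
        obtain ⟨ρ, h3, h4⟩ := hp.2.1 _ hact
        rw [r1 z hz] at h3
        cases h3
        have hne' : d.1.eval n mem (two (childIdx b n j z) (symAddr 0 s f a)) ≠
            (A.ext b).tv.eval n mem (two (childIdx b n j z) (symAddr 0 s f a)) := by
          rw [h4, Amb.eval_ext_tv, childIdx_div hz z.2, hp.1.1.tmp j hj]
          exact Val.code_injective.ne hne
        obtain ⟨-, -, e, he, i, hi, h5, h6⟩ := hp.2.2 _ _ hne'
        -- A change by a branch is visible in the view of the child context, hence logged, hence
        -- written by the kernel of the entry `e`.
        have := h1 e he i ⟨hi, by rw [h5, h6]; exact hne'⟩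
        simp only [mergeKernel, SExp.eval_pair, SExp.eval_div, SExp.eval_num, SExp.eval_add,
          SExp.eval_app, h5, h6, childIdx_div hz z.2, SExp.eval_lit, h4] at this
        rw [this, hτ]
        simp
      -- If no branch changed the value, no processor targets this cell, and the overlay falls back
      -- to the view before the branches.
      · rw [if_pos, hp.1.1.tmp j hj, hτ]
        refine h2 _ ?_
        rintro e he i ⟨hi, hne⟩ hcell
        obtain ⟨z, s', f', a', ρ, q1, q2, q3, q4, q5, q6, -⟩ :=
          hp.2.exists_branch hp.1.1 hne
        simp only [mergeKernel, SExp.eval_pair, SExp.eval_div, SExp.eval_num,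
          Nat.pair_eq_pair] at hcell
        rw [q4] at hcell
        obtain ⟨rfl, hkey⟩ := hcell
        cases symAddr_inj hkey
        rw [q3, r1 z q1] at q5
        cases q5
        exact q6 (hno z q1)
    · rw [SExp.eval_overlay] at hx
      split_ifs at hx with h0
      · exact absurd rfl hx
      · have : ∃ e ∈ d.2, ∃ i, (mergeKernel A b d.1 (tmpBank c₁) e).On n mem i ∧
            (mergeKernel A b d.1 (tmpBank c₁) e).cell.eval n mem (fun _ => i) = Nat.pair j x := by
          by_contra hne
          exact h0 (h2 _ fun e he i hi hc => hne ⟨e, he, i, mergeKernel_on.2 hi, hc⟩)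
        obtain ⟨e, he, i, hi, hcell⟩ := this
        rw [mergeKernel_on] at hi
        obtain ⟨z, s', f', a', ρ, q1, q2, q3, q4, q5, q6, -⟩ :=
          hp.2.exists_branch hp.1.1 hi.2
        simp only [mergeKernel, SExp.eval_pair, SExp.eval_div, SExp.eval_num,
          Nat.pair_eq_pair] at hcell
        obtain ⟨rfl, rfl⟩ := hcell
        exact ⟨q2, ⟨s', f', a', q4⟩, _, List.mem_map.2 ⟨e, he, rfl⟩, i, hi.1, by simp, rfl⟩

theorem cClaim (hq : ∀ i, QClaim (sub i)) (c : Cmd Γ m) : CClaim sub c := by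
  induction c with
  | skip => exact cClaim_skip
  | assign s f args e => exact cClaim_assign f (fun i => eClaim hq _) (eClaim hq e)
  | seq c d ihc ihd => exact cClaim_seq ihc ihd
  | ite b c d ihc ihd => exact cClaim_ite (eClaim hq b) ihc ihd
  | par g c ih => exact cClaim_par g ih

end

/-! # Main procedures and queries -/

section
variable {Γ : Ctx} {sub : (i : Fin Γ.k) → Prog (Γ.sub i)} {m : ℕ} {s : Srt}

/-- The value returned by a main procedure in the `j`-th context. -/
noncomputable def Ghost.run {n : ℕ} (g : Ghost sub m n) (B : Body Γ m s) (j : ℕ) :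
    Option (Val n s) :=
  B.run (fun i => (sub i).sem n) g.σ g.θ (g.env j) (g.τ j)

theorem Body.one_le_work (n : ℕ) (W : (i : Fin Γ.k) → WorkBound (Γ.sub i)) (B : Body Γ m s) :
    1 ≤ B.work n W := by
  induction B with
  | ret e => exact e.one_le_work n W
  | step c B ih => exact le_max_of_le_right ih
  | ite b B C _ _ => exact le_max_of_le_left (b.one_le_work n W)

/-- The main procedure can be executed in parallel, in many contexts. -/
theorem bodyBlk (hq : ∀ i, QClaim (sub i)) (B : Body Γ m s) :
    ∀ (ctr : ℕ) (A : Amb m), A.Below ctr →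
    Blk ctr (fun n => A.N.eval n * B.work n (subWork sub n)) (G := Ghost sub m)
      (fun _ g mem => A.Rep g mem ∧ ∀ j, g.act j → (g.run B j).isSome)
      (fun c R => R.Below c) fun R _ g mem => Vals R mem g.act (g.run B) := by
  induction B with
  | ret e => exact eClaim hq e
  | step c B ih =>
    intro ctr A hA
    have key : ∀ n (g : Ghost sub m n) j, g.run (.step c B) j =
        (g.exec c j).bind fun τ => (g.withτ fun j => (g.exec c j).getD (g.τ j)).run B j := by
      intro n g j
      simp only [Ghost.run, Ghost.exec, Body.run]
      cases h : c.exec (fun i => (sub i).sem n) g.σ g.θ (g.env j) (g.τ j) with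
      | none => rfl
      | some τ => simp [Ghost.withτ, h]
    have hst := hA.stable fun n (g : Ghost sub m n) => ∀ j, g.act j → (g.run (.step c B) j).isSome
    refine (cClaim hq c ctr A hA).bind (fun _ g => g) hst
      (fun n g mem _ hp => ⟨hp.1, fun j hj => ?_⟩) 1
      (fun n => mul_work_le (le_max_left _ _)) fun c₁ d₁ hc₁ hd₁ hs₁ => ?_
    · have := hp.2 j hj
      rw [key] at this
      cases h : g.exec c j <;> simp_all
    refine (ih c₁ (A.withTv d₁.1) ((hA.mono hc₁).withTv hd₁.1)).conseq
      (fun _ g => g.withτ fun j => (g.exec c j).getD (g.τ j)) ((hst.mono hc₁).and hs₁)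
      (fun n g mem _ hp => ⟨hp.1.1.after hp.2, fun j hj => ?_⟩) 1
      (fun n => mul_work_le (le_max_right _ _)) (fun R => R) (fun _ _ _ h => h)
      (fun c₂ R _ hR => stable_vals hR _ _) ?_
    · have := hp.1.2 j hj
      rw [key] at this
      cases h : g.exec c j <;> simp_all
    · intro R c₂ n g mem _ _ _ hp h j hj
      obtain ⟨τ₁, h1, -⟩ := hp.2.1 j hj
      obtain ⟨v, h2, h3⟩ := h j hj
      exact ⟨v, by rw [key, h1, ← h2]; rfl, h3⟩
  | ite b B C ihB ihC =>
    intro ctr A hA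
    have key : ∀ n (g : Ghost sub m n) j, (g.run (.ite b B C) j).isSome →
        (g.val b j = some true ∧ (g.run B j).isSome ∧ g.run (.ite b B C) j = g.run B j) ∨
        (g.val b j = some false ∧ (g.run C j).isSome ∧ g.run (.ite b B C) j = g.run C j) := by
      intro n g j h
      simp only [Ghost.val, Ghost.run, Body.run] at h ⊢
      split at h
      · rename_i hx; rw [hx]; exact .inl ⟨rfl, h, rfl⟩
      · rename_i hx; rw [hx]; exact .inr ⟨rfl, h, rfl⟩
      · cases h
    have hst := hA.stable fun n (g : Ghost sub m n) => ∀ j, g.act j →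
      (g.run (.ite b B C) j).isSome
    refine (eClaim hq b ctr A hA).bind (fun _ g => g) hst
      (fun n g mem _ hp => ⟨hp.1, fun j hj => ?_⟩) 1
      (fun n => mul_work_le (le_max_left _ _)) fun c₁ R hc₁ hR hs₁ => ?_
    · rcases key n g j (hp.2 j hj) with h | h <;> simp [h.1]
    have hA₁ := hA.mono hc₁
    refine (ihB c₁ _ (hA₁.withMask (mask := .op .mul A.mask R) ⟨hA₁.mask, hR⟩)).bind
      (fun _ g => g.withAct fun j => g.act j ∧ g.val b j = some true) ((hst.mono hc₁).and hs₁)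
      (fun n g mem _ hp => ⟨hp.1.1.onTrue hp.2, fun j hj => ?_⟩) 1
      (fun n => mul_work_le (le_max_of_le_right (le_max_left _ _))) fun c₂ R₁ hc₂ hR₁ hs₂ => ?_
    · rcases key n g j (hp.1.2 j hj.1) with h | h
      · exact h.2.1
      · exact absurd (hj.2.symm.trans h.1) (by simp)
    have hA₂ := hA₁.mono hc₂
    have hR₂ := hR.mono hc₂
    refine (ihC c₂ _ (hA₂.withMask (mask := .op .mul A.mask (.op .sub (.lit 1) R))
      ⟨hA₂.mask, trivial, hR₂⟩)).conseq
      (fun _ g => g.withAct fun j => g.act j ∧ g.val b j = some false)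
      ((((hst.mono hc₁).and hs₁).mono hc₂).and hs₂)
      (fun n g mem _ hp => ⟨hp.1.1.1.onFalse hp.1.2, fun j hj => ?_⟩) 1
      (fun n => mul_work_le (le_max_of_le_right (le_max_right _ _))) (fun R₃ => .cond R R₁ R₃)
      ?_ ?_ ?_
    · rcases key n g j (hp.1.1.2 j hj.1) with h | h
      · exact absurd (hj.2.symm.trans h.1) (by simp)
      · exact h.2.1
    · exact fun c R₃ hc hR₃ => by simp [hR₂.mono hc, hR₁.mono hc, hR₃]
    · exact fun c R₃ hc hR₃ => stable_vals (by simp [hR₂.mono hc, hR₁.mono hc, hR₃]) _ _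
    · intro R₃ c n g mem _ _ _ hp hV j hj
      rw [SExp.eval_cond]
      rcases key n g j (hp.1.1.2 j hj) with ⟨h1, h2, h3⟩ | ⟨h1, h2, h3⟩
      · rw [hp.1.2.eval_eq hj h1, h3]
        simp only [Val.code_true, one_ne_zero, if_false]
        exact hp.2 j ⟨hj, h1⟩
      · rw [hp.1.2.eval_eq hj h1, h3]
        simp only [Val.code_false, if_true]
        exact hV j ⟨hj, h1⟩

end

/-- The body is executed with initially empty assigned symbols; all their entries have the code `0`,
so the constant view `0` describes them. -/
theorem qClaim_mk {I : Interface} (aux : Schema) (k : ℕ) (J : Fin k → Interface)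
    (sub : (i : Fin k) → Prog (J i))
    (upd : (δ : Fin I.chg) → (s : Srt) → (f : Fin (aux.num s)) →
      Option (UpdRule aux J (I.chgArity δ) s f))
    (qry : (s : Srt) → (q : Fin (I.qry.num s)) → QryRule aux J (I.qry.arity s q) s)
    (hq : ∀ i, QClaim (sub i)) : QClaim (Prog.mk aux k J sub upd qry) := by
  intro s q ctr N c SV mask vars hm hv hS
  have hA : Amb.Below ctr ⟨N, c, SV, mask, vars, .lit 0⟩ := ⟨hS, hm, hv, trivial⟩
  refine (bodyBlk (Γ := ⟨aux, (qry s q).tmp, k, J⟩) (sub := sub) hq (qry s q).body ctr _ hA).conseq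
    (fun n g => ⟨g.pos, g.st.1, g.st.2, g.act, g.env, fun _ => Struct.empty _ n⟩) ?_
    (fun n g mem _ hp => ⟨⟨hp.1, (repS_mk.1 hp.2.1).1, (repS_mk.1 hp.2.1).2, ?_⟩, hp.2.2⟩) 1
    ?_ (fun R => R) (fun _ _ _ h => h)
    (fun c R _ hR => stable_vals hR _ _) (fun _ _ _ _ _ _ _ _ _ h => h)
  · intro n g mem mem' ha hp
    exact ⟨hp.1.agree hm hv ha, hp.2.1.agree hS ha, hp.2.2⟩
  · intro j _ s f a
    simp [Struct.empty]
  · intro n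
    rw [one_mul, Prog.work]
    exact le_rfl

theorem qClaim {I : Interface} (P : Prog I) : QClaim P := by
  induction P with
  | mk aux k J sub upd qry ih => exact qClaim_mk aux k J sub upd qry ih

/-! # Changes of stored states -/

/-- A family of cells of a bank. -/
structure StateLog where
  N : NumExpr
  b : ℕ
  cell : SExp

def StateLog.Hits (e : StateLog) (n : ℕ) (m : BMem) (x : ℕ) : Prop :=
  ∃ i < e.N.eval n, Nat.pair e.b (e.cell.eval n m fun _ => i) = x

/-- A new view of a state, together with a list of the cells that may have changed. -/
structure Delta where
  SV : ℕ → SExp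
  log : List StateLog

namespace Delta

/-- The new view differs from `SV` only in the banks in `dom`. -/
structure Good (SV : ℕ → SExp) (dom : ℕ → Prop) (w : ℕ → ℕ) (ctr : ℕ) (d : Delta) : Prop where
  below : ∀ b, (d.SV b).Below ctr
  eq : ∀ b, ¬ dom b → d.SV b = SV b
  log : ∀ e ∈ d.log, e.cell.Below ctr ∧ dom e.b ∧ ∃ C, ∀ n, e.N.eval n ≤ C * w n

/-- The part about `act` says that nothing changes if the procedure is masked out. This allows both
branches of a conditional to be run in sequence. -/
def Logged (SV : ℕ → SExp) (d : Delta) (n : ℕ) (m : BMem) (act : Prop) : Prop :=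
  ∀ x, rd d.SV n m x ≠ rd SV n m x → act ∧ ∃ e ∈ d.log, e.Hits n m x

variable {SV : ℕ → SExp} {dom dom' : ℕ → Prop} {w w' : ℕ → ℕ} {ctr ctr' n : ℕ} {d d' : Delta}
  {m : BMem}

theorem Good.mono (h : d.Good SV dom w ctr) (hdom : ∀ b, dom b → dom' b)
    (hw : ∀ n, w n ≤ w' n) (hc : ctr ≤ ctr') : d.Good SV dom' w' ctr' where
  below b := (h.below b).mono hc
  eq b hb := h.eq b fun h => hb (hdom b h)
  log e he := by
    obtain ⟨h1, h2, C, h3⟩ := h.log e he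
    exact ⟨h1.mono hc, hdom _ h2, C, fun n => (h3 n).trans (Nat.mul_le_mul_left C (hw n))⟩

theorem Good.stable (h : d.Good SV dom w ctr) (hS : ∀ b, (SV b).Below ctr) {G : ℕ → Type}
    (act : ∀ n, G n → Prop) : Stable ctr fun n g m => d.Logged SV n m (act n g) := by
  intro n g m m' ha hl x hx
  rw [rd, rd, (h.below _).eval_eq ha, (hS _).eval_eq ha] at hx
  obtain ⟨h1, e, he, i, hi, h2⟩ := hl x hx
  exact ⟨h1, e, he, i, hi, by rw [(h.log e he).1.eval_eq ha, h2]⟩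

theorem Good.refl (hS : ∀ b, (SV b).Below ctr) : Good SV dom w ctr ⟨SV, []⟩ :=
  ⟨hS, fun _ _ => rfl, by simp⟩

theorem Logged.refl {act : Prop} : Logged SV ⟨SV, []⟩ n m act := fun _ hx => absurd rfl hx

theorem Logged.rd_eq {act : Prop} (h : d.Logged SV n m act) (ha : ¬ act) (x : ℕ) :
    rd d.SV n m x = rd SV n m x :=
  by_contra fun hx => ha (h x hx).1

/-- The second change is understood relative to the view of the first, so its view is already the
final one. -/
def seq (d d' : Delta) : Delta := ⟨d'.SV, d.log ++ d'.log⟩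

theorem Good.seq (h : d.Good SV dom w ctr) (h' : d'.Good d.SV dom w ctr) :
    (d.seq d').Good SV dom w ctr where
  below := h'.below
  eq b hb := (h'.eq b hb).trans (h.eq b hb)
  log e he := by
    rcases List.mem_append.1 he with he | he
    · exact h.log e he
    · exact h'.log e he

theorem Logged.seq {act act₁ act₂ : Prop} (h : d.Logged SV n m act₁)
    (h' : d'.Logged d.SV n m act₂) (h₁ : act₁ → act) (h₂ : act₂ → act) :
    (d.seq d').Logged SV n m act := by
  intro x hx
  by_cases hd : rd d.SV n m x = rd SV n m x
  · obtain ⟨ha, e, he, h⟩ := h' x (hd ▸ hx)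
    exact ⟨h₂ ha, e, List.mem_append_right _ he, h⟩
  · obtain ⟨ha, e, he, h⟩ := h x hd
    exact ⟨h₁ ha, e, List.mem_append_left _ he, h⟩

end Delta

/-- The change operations of the program can be executed, in the context `0` if it is active. -/
def ChgClaim {I : Interface} (P : Prog I) : Prop :=
  ∀ (δ : Fin I.chg) (ctr c : ℕ) (SV : ℕ → SExp) (mask : SExp) (vars : Fin (I.chgArity δ) → SExp),
    mask.Below ctr → (∀ i, (vars i).Below ctr) → (∀ b, (SV b).Below ctr) →
    Blk ctr (fun n => (P.work n).chg δ) (G := QGhost P (I.chgArity δ))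
      (fun n g m => VecRep (.lit 1) mask vars g.act g.env m ∧ RepS P c g.st SV m ∧
        (g.act 0 → ((P.sem n).change g.st δ (g.env 0)).isSome))
      (fun ctr (d : Delta) => d.Good SV (BankIn c) (fun n => (P.work n).chg δ) ctr)
      fun d n g m => (g.act 0 → ∃ st', (P.sem n).change g.st δ (g.env 0) = some st' ∧
        RepS P c st' d.SV m) ∧ d.Logged SV n m (g.act 0)

/-! ## Initial procedures -/

section
variable {Γ : Ctx} {sub : (i : Fin Γ.k) → Prog (Γ.sub i)} {m : ℕ}

noncomputable def Ghost.execInit {n : ℕ} (g : Ghost sub m n) (c : Init Γ m) :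
    Option (((i : Fin Γ.k) → (sub i).State n) × Struct Γ.tmp n) :=
  c.exec (fun i => (sub i).sem n) g.σ (g.env 0) (g.θ, g.τ 0)

/-- The banks of the supplementary instances for which `c` invokes change operations. -/
def Init.dom (c : Init Γ m) (a b : ℕ) : Prop :=
  ∃ i : Fin Γ.k, c.Invokes i ∧ BankIn (Nat.pair a i + 1) b

def InitPost (A : Amb m) (d : SExp × Delta) {n : ℕ} (g : Ghost sub m n) (mem : BMem)
    (f : Option (((i : Fin Γ.k) → (sub i).State n) × Struct Γ.tmp n)) : Prop :=
  (g.act 0 → ∃ x, f = some x ∧ (∀ i, RepS (sub i) (Nat.pair A.c i + 1) (x.1 i) d.2.SV mem) ∧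
    ∀ (s) (f : Fin (Γ.tmp.num s)) a,
      d.1.eval n mem (two 0 (symAddr 0 s f a)) = (x.2 s f a).code) ∧
  (∀ j x, d.1.eval n mem (two j x) ≠ A.tv.eval n mem (two j x) → g.act 0) ∧
  d.2.Logged A.SV n mem (g.act 0)

def InitGood (A : Amb m) (dom : ℕ → ℕ → Prop) (w : ℕ → ℕ) (c : ℕ) (d : SExp × Delta) : Prop :=
  d.1.Below c ∧ d.2.Good A.SV (dom A.c) w c

theorem InitGood.stable {A : Amb m} {dom : ℕ → ℕ → Prop} {w : ℕ → ℕ} {c : ℕ} {d : SExp × Delta}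
    (hd : InitGood A dom w c d) (hA : A.Below c) {G : ℕ → Type} (φ : ∀ n, G n → Ghost sub m n)
    (f : ∀ n, Ghost sub m n → Option (((i : Fin Γ.k) → (sub i).State n) × Struct Γ.tmp n)) :
    Stable c fun n g mem => InitPost A d (φ n g) mem (f n (φ n g)) := by
  intro n g m m' ha h
  refine ⟨fun h0 => ?_, fun j x hx => ?_,
    hd.2.stable hA.SV (fun n g => (φ n g).act 0) n g m m' ha h.2.2⟩
  · obtain ⟨x, h1, h2, h3⟩ := h.1 h0
    exact ⟨x, h1, fun i => (h2 i).agree hd.2.below ha, fun s f a => by rw [hd.1.eval_eq ha, h3]⟩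
  · rw [hd.1.eval_eq ha, hA.tv.eval_eq ha] at hx
    exact h.2.1 j x hx

variable (sub) in
def IClaim (c : Init Γ m) : Prop :=
  ∀ (ctr : ℕ) (A : Amb m), A.Below ctr → A.N = .lit 1 →
    Blk ctr (fun n => c.work n (subWork sub n)) (G := Ghost sub m)
      (fun _ g mem => A.Rep g mem ∧ (g.act 0 → (g.execInit c).isSome))
      (InitGood A c.dom fun n => c.work n (subWork sub n))
      fun d _ g mem => InitPost A d g mem (g.execInit c)

theorem Amb.Rep.eq_zero {n : ℕ} {A : Amb m} {g : Ghost sub m n} {mem : BMem} (h : A.Rep g mem)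
    (hN : A.N = .lit 1) {j : ℕ} (hj : g.act j) : j = 0 := by
  have := h.vec.lt j hj
  rw [hN] at this
  simpa [NumExpr.eval] using this

def Amb.withSt (A : Amb m) (SV : ℕ → SExp) (tv : SExp) : Amb m := { A with SV := SV, tv := tv }

theorem Amb.Below.withSt {ctr : ℕ} {A : Amb m} (h : A.Below ctr) {SV : ℕ → SExp} {tv : SExp}
    (hS : ∀ b, (SV b).Below ctr) (ht : tv.Below ctr) : (A.withSt SV tv).Below ctr :=
  ⟨hS, h.mask, h.vars, ht⟩

open scoped Classical in
/-- The contexts after an initial procedure with the result `f`. -/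
noncomputable def Ghost.afterInit {n : ℕ} (g : Ghost sub m n)
    (f : Option (((i : Fin Γ.k) → (sub i).State n) × Struct Γ.tmp n)) : Ghost sub m n :=
  { g with
    θ := if g.act 0 then (f.getD (g.θ, g.τ 0)).1 else g.θ
    τ := fun j => if g.act 0 then (f.getD (g.θ, g.τ 0)).2 else g.τ j }

/-- What follows the initial procedure sees the new supplementary states but still the old auxiliary
structure. -/
theorem Amb.Rep.afterInit {n : ℕ} {A : Amb m} {g : Ghost sub m n} {mem : BMem} (h : A.Rep g mem)
    (hN : A.N = .lit 1) {c : Init Γ m} {d : SExp × Delta} {w : ℕ → ℕ} {ctr : ℕ}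
    {f : Option (((i : Fin Γ.k) → (sub i).State n) × Struct Γ.tmp n)}
    (hd : InitGood A c.dom w ctr d) (hp : InitPost A d g mem f) :
    (A.withSt d.2.SV d.1).Rep (g.afterInit f) mem where
  vec := h.vec
  aux s k a := by
    refine Eq.trans ?_ (h.aux s k a)
    change rd d.2.SV n mem (symAddr A.c s k a) = _
    -- Change invocations alter only banks of supplementary instances, and none of these holds an
    -- auxiliary symbol.
    rw [symAddr_eq, rd_pair, rd_pair, hd.2.eq]
    rintro ⟨i, -, hb⟩
    exact not_bankIn_child _ _ _ _ hb
  sub i := by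
    by_cases h0 : g.act 0
    · obtain ⟨x, h1, h2, -⟩ := hp.1 h0
      simpa [Ghost.afterInit, Amb.withSt, h0, h1] using h2 i
    · simp only [Ghost.afterInit, h0, if_false]
      exact (h.sub i).congr fun x _ => hp.2.2.rd_eq h0 x
  tmp j hj s k a := by
    obtain rfl : j = 0 := h.eq_zero hN hj
    have h0 : g.act 0 := hj
    obtain ⟨x, h1, -, h2⟩ := hp.1 h0
    simpa [Ghost.afterInit, Amb.withSt, h0, h1] using h2 s k a

theorem iClaim_cmd (hq : ∀ i, QClaim (sub i)) (c : Cmd Γ m) : IClaim sub (.cmd c) := by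
  intro ctr A hA hN
  have hst := hA.stable fun n (g : Ghost sub m n) => g.act 0 → (g.execInit (.cmd c)).isSome
  have key : ∀ n (g : Ghost sub m n), g.execInit (.cmd c) = (g.exec c 0).map fun τ' => (g.θ, τ') :=
    fun n g => by simp only [Ghost.execInit, Init.exec, Ghost.exec]
  have hgood : ∀ c' d, ctr ≤ c' → CmdGood A (fun n => c.work n (subWork sub n)) c' d →
      InitGood A (Init.cmd c).dom (fun n => (Init.cmd c).work n (subWork sub n)) c'
        (d.1, ⟨A.SV, []⟩) :=
    fun c' d hc hd => ⟨hd.1, .refl fun b => (hA.SV b).mono hc⟩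
  refine (cClaim hq c ctr A hA).conseq (fun _ g => g) hst (fun n g mem _ hp => ⟨hp.1, fun j hj => ?_⟩)
    1 (fun n => ?_) (fun d => (d.1, ⟨A.SV, []⟩)) hgood
    (fun c' d hc hd => (hgood c' d hc hd).stable (hA.mono hc) (fun _ g => g)
      fun n g => g.execInit (.cmd c)) ?_
  · obtain rfl := hp.1.eq_zero hN hj
    simpa [key] using hp.2 hj
  · rw [hN]
    exact le_rfl
  · intro d c' n g mem _ _ _ hp h
    refine ⟨fun h0 => ?_, fun j x hx => ?_, .refl⟩
    · obtain ⟨τ', h1, h2⟩ := h.1 0 h0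
      exact ⟨(g.θ, τ'), by rw [key, h1]; rfl, hp.1.sub, h2⟩
    · have hj := (h.2 j x hx).1
      obtain rfl := hp.1.eq_zero hN hj
      exact hj

theorem Ghost.execInit_change {n : ℕ} {g : Ghost sub m n} {i : Fin Γ.k} {δ : Fin (Γ.sub i).chg}
    {args : Fin ((Γ.sub i).chgArity δ) → Expr Γ m .fn}
    (h : (g.execInit (.change i δ args)).isSome) :
    (g.args args 0 = some none ∧ g.execInit (.change i δ args) = some (g.θ, g.τ 0)) ∨
    ∃ a x, g.args args 0 = some (some a) ∧ ((sub i).sem n).change (g.θ i) δ a = some x ∧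
      g.execInit (.change i δ args) = some (Function.update g.θ i x, g.τ 0) := by
  simp only [Ghost.execInit, Init.exec, Ghost.args] at h ⊢
  split at h
  · rename_i a ha
    obtain ⟨x, hx⟩ := Option.isSome_iff_exists.1 (by simpa using h)
    exact .inr ⟨a, x, ha, hx, by simp [hx]⟩
  · rename_i ha
    exact .inl ⟨ha, rfl⟩
  · cases h

/-- The change block of the instance is run under a mask that also demands defined arguments. -/
theorem iClaim_change (hq : ∀ i, QClaim (sub i)) (hc : ∀ i, ChgClaim (sub i)) (i : Fin Γ.k)
    (δ : Fin (Γ.sub i).chg) (args : Fin ((Γ.sub i).chgArity δ) → Expr Γ m .fn) :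
    IClaim sub (.change i δ args) := by
  intro ctr A hA hN
  have hst := hA.stable fun n (g : Ghost sub m n) => g.act 0 →
    (g.execInit (.change i δ args)).isSome
  refine (argsBlk (fun i => eClaim hq (args i))
    (w := fun n => (Init.change i δ args).work n (subWork sub n))
    (fun i n => (le_maxOne (fun i => (args i).work n (subWork sub n)) i).trans (le_max_left _ _))
    ctr A hA).bind (fun _ g => g) hst (fun n g mem _ hp => ⟨hp.1, fun j hj => ?_⟩) 1
    (fun n => by rw [hN]; exact le_rfl) fun c₁ R hc₁ hR hs₁ => ?_
  · obtain rfl := hp.1.eq_zero hN hj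
    rcases Ghost.execInit_change (hp.2 hj) with h | ⟨a, x, h, -⟩
    · simp [h.1]
    · simp [h]
  have hA₁ := hA.mono hc₁
  have hpr := SExp.below_prodE hR
  have hgood : ∀ c' d, c₁ ≤ c' →
      d.Good A.SV (BankIn (Nat.pair A.c i + 1)) (fun n => ((sub i).work n).chg δ) c' →
      InitGood A (Init.change i δ args).dom
        (fun n => (Init.change i δ args).work n (subWork sub n)) c' (A.tv, d) :=
    fun c' d hc hd => ⟨hA₁.tv.mono hc,
      hd.mono (fun b hb => ⟨i, rfl, hb⟩) (fun n => le_max_right _ _) le_rfl⟩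
  refine (hc i δ c₁ (Nat.pair A.c i + 1) A.SV (.op .mul A.mask (SExp.prodE R))
    (fun i => .op .sub (R i) (.lit 1)) ⟨hA₁.mask, hpr⟩ (fun i => ⟨hR i, trivial⟩) hA₁.SV).conseq
    (fun n g => ⟨g.pos, g.θ i, fun j => g.act j ∧ ∃ a, g.args args j = some (some a),
      fun j => (g.args args j).join.getD fun _ => ⟨0, g.pos⟩⟩)
    ((hst.mono hc₁).and hs₁) ?_ 1
    (fun n => by rw [one_mul]; exact le_max_right _ _) (fun d => (A.tv, d)) hgood
    (fun c' d hc hd => (hgood c' d hc hd).stable (hA₁.mono hc) (fun _ g => g)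
      fun n g => g.execInit (.change i δ args)) ?_
  · intro n g mem _ hp
    have hon := hp.1.1.withMask (mask := .op .mul A.mask (SExp.prodE R))
      (act := fun j => g.act j ∧ ∃ a, g.args args j = some (some a)) (fun j => by
        rw [SExp.eval_mul, mul_ne_zero_iff, hp.1.1.vec.mask_iff]
        exact and_congr_right fun hj => hp.2.prodE_ne_zero hj) fun j hj => hj.1
    refine ⟨⟨hon.vec.mask_iff, ?_, fun j hj l => ?_⟩, hp.1.1.sub i, fun h0 => ?_⟩
    · rw [← hN]
      exact hon.vec.lt
    · obtain ⟨a, ha⟩ := hj.2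
      rw [SExp.eval_sub, hp.2.eval_eq hj.1 ha, SExp.eval_lit, Nat.add_sub_cancel]
      simp [ha]
    · rcases Ghost.execInit_change (hp.1.2 h0.1) with h | ⟨a, x, h, h', -⟩
      · obtain ⟨a, ha⟩ := h0.2
        simp [h.1] at ha
      · simp [h, h']
  · rintro d c' n g mem _ _ hd hp ⟨h1, h2⟩
    refine ⟨fun h0 => ?_, fun j x hx => absurd rfl hx, fun x hx => ?_⟩
    · rcases Ghost.execInit_change (hp.1.2 h0) with ⟨h3, h4⟩ | ⟨a, x, h3, h4, h5⟩
      -- An argument is `⊥`: the invocation is masked out, so the view is unchanged.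
      · refine ⟨_, h4, fun l => (hp.1.1.sub l).congr fun x _ => h2.rd_eq ?_ x, hp.1.1.tmp 0 h0⟩
        rintro ⟨-, a, ha⟩
        rw [h3] at ha
        simp at ha
      · refine ⟨_, h5, fun l => ?_, hp.1.1.tmp 0 h0⟩
        obtain ⟨x', h6, h7⟩ := h1 ⟨h0, a, h3⟩
        simp only [h3, Option.join_some, Option.getD_some] at h6
        rw [h4, Option.some_inj] at h6
        subst h6
        by_cases hl : l = i
        · subst hl
          simpa using h7
        · simp only [Function.update_of_ne hl]
          -- The other instances are untouched, because subtrees of different children share no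
          -- bank.
          refine (hp.1.1.sub l).congr fun x hx => ?_
          rw [rd, rd, hd.eq]
          intro hx'
          exact hl (Fin.ext (hx.child_inj hx'))
    · obtain ⟨h3, h4⟩ := h2 x hx
      exact ⟨h3.1, h4⟩

theorem iClaim_seq {c d : Init Γ m} (hc : IClaim sub c) (hd : IClaim sub d) :
    IClaim sub (.seq c d) := by
  intro ctr A hA hN
  have key : ∀ n (g : Ghost sub m n), g.act 0 → g.execInit (.seq c d) =
      (g.execInit c).bind fun _ => (g.afterInit (g.execInit c)).execInit d := by
    intro n g h0
    simp only [Ghost.execInit, Init.exec]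
    cases h : c.exec (fun i => (sub i).sem n) g.σ (g.env 0) (g.θ, g.τ 0) with
    | none => rfl
    | some x => simp [Ghost.afterInit, h0]
  have hst := hA.stable fun n (g : Ghost sub m n) => g.act 0 → (g.execInit (.seq c d)).isSome
  have hw₁ : ∀ n, c.work n (subWork sub n) ≤ (Init.seq c d).work n (subWork sub n) :=
    fun n => le_max_left _ _
  have hw₂ : ∀ n, d.work n (subWork sub n) ≤ (Init.seq c d).work n (subWork sub n) :=
    fun n => le_max_right _ _
  refine (hc ctr A hA hN).bind (fun _ g => g) hst (fun n g mem _ hp => ⟨hp.1, fun h0 => ?_⟩) 1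
    (fun n => by rw [one_mul]; exact hw₁ n) fun c₁ d₁ hc₁ hd₁ hs₁ => ?_
  · have := hp.2 h0
    rw [key n g h0] at this
    cases h : g.execInit c <;> simp_all
  have hA₁ := hA.mono hc₁
  have hgood : ∀ c₂ d₂, c₁ ≤ c₂ → InitGood (A.withSt d₁.2.SV d₁.1) d.dom
      (fun n => d.work n (subWork sub n)) c₂ d₂ →
      InitGood A (Init.seq c d).dom (fun n => (Init.seq c d).work n (subWork sub n)) c₂
        (d₂.1, d₁.2.seq d₂.2) := fun c₂ d₂ hc₂ hd₂ =>
    ⟨hd₂.1, (hd₁.2.mono (fun b ⟨i, hi, hb⟩ => ⟨i, .inl hi, hb⟩) hw₁ hc₂).seq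
      (hd₂.2.mono (fun b ⟨i, hi, hb⟩ => ⟨i, .inr hi, hb⟩) hw₂ le_rfl)⟩
  refine (hd c₁ (A.withSt d₁.2.SV d₁.1) (hA₁.withSt hd₁.2.below hd₁.1) hN).conseq
    (fun _ g => g.afterInit (g.execInit c)) ((hst.mono hc₁).and hs₁)
    (fun n g mem _ hp => ⟨hp.1.1.afterInit hN hd₁ hp.2, fun h0 => ?_⟩) 1
    (fun n => by rw [one_mul]; exact hw₂ n) (fun d₂ => (d₂.1, d₁.2.seq d₂.2)) hgood
    (fun c₂ d₂ hc₂ hd₂ => (hgood c₂ d₂ hc₂ hd₂).stable (hA₁.mono hc₂) (fun _ g => g)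
      fun n g => g.execInit (.seq c d)) ?_
  · have := hp.1.2 h0
    rw [key n g h0] at this
    cases h : g.execInit c <;> simp_all
  · intro d₂ c₂ n g mem _ _ _ hp h
    refine ⟨fun h0 => ?_, fun j x hx => ?_, hp.2.2.2.seq h.2.2 id id⟩
    · obtain ⟨x₁, h1, -⟩ := hp.2.1 h0
      obtain ⟨x₂, h2, h3⟩ := h.1 h0
      exact ⟨x₂, by rw [key n g h0, h1, ← h2]; simp [h1], h3⟩
    · by_cases h1 : d₁.1.eval n mem (two j x) = A.tv.eval n mem (two j x)
      · rw [← h1] at hx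
        exact h.2.1 j x hx
      · exact hp.2.2.1 j x h1

/-- As for instructions: the branches run in sequence under complementary masks, and the one that is
masked out changes neither the state nor the assigned symbols. -/
theorem iClaim_ite (hq : ∀ i, QClaim (sub i)) {b : Expr Γ m .rel} {c d : Init Γ m}
    (hc : IClaim sub c) (hd : IClaim sub d) : IClaim sub (.ite b c d) := by
  intro ctr A hA hN
  have key : ∀ n (g : Ghost sub m n), (g.execInit (.ite b c d)).isSome →
      (g.val b 0 = some true ∧ (g.execInit c).isSome ∧
        g.execInit (.ite b c d) = g.execInit c) ∨
      (g.val b 0 = some false ∧ (g.execInit d).isSome ∧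
        g.execInit (.ite b c d) = g.execInit d) := by
    intro n g h
    simp only [Ghost.val, Ghost.execInit, Init.exec] at h ⊢
    split at h
    · rename_i hx; rw [hx]; exact .inl ⟨rfl, h, rfl⟩
    · rename_i hx; rw [hx]; exact .inr ⟨rfl, h, rfl⟩
    · cases h
  have hst := hA.stable fun n (g : Ghost sub m n) => g.act 0 → (g.execInit (.ite b c d)).isSome
  have hw₁ : ∀ n, c.work n (subWork sub n) ≤ (Init.ite b c d).work n (subWork sub n) :=
    fun n => le_max_of_le_right (le_max_left _ _)
  have hw₂ : ∀ n, d.work n (subWork sub n) ≤ (Init.ite b c d).work n (subWork sub n) :=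
    fun n => le_max_of_le_right (le_max_right _ _)
  refine (eClaim hq b ctr A hA).bind (fun _ g => g) hst
    (fun n g mem _ hp => ⟨hp.1, fun j hj => ?_⟩) 1
    (fun n => by rw [hN, one_mul, NumExpr.eval, one_mul]; exact le_max_left _ _)
    fun c₁ R hc₁ hR hs₁ => ?_
  · obtain rfl := hp.1.eq_zero hN hj
    rcases key n g (hp.2 hj) with h | h <;> simp [h.1]
  have hA₁ := hA.mono hc₁
  refine (hc c₁ _ (hA₁.withMask (mask := .op .mul A.mask R) ⟨hA₁.mask, hR⟩) hN).bind
    (fun _ g => g.withAct fun j => g.act j ∧ g.val b j = some true) ((hst.mono hc₁).and hs₁)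
    (fun n g mem _ hp => ⟨hp.1.1.onTrue hp.2, fun h0 => ?_⟩) 1
    (fun n => by rw [one_mul]; exact hw₁ n) fun c₂ d₁ hc₂ hd₁ hs₂ => ?_
  · rcases key n g (hp.1.2 h0.1) with h | h
    · exact h.2.1
    · exact absurd (h0.2.symm.trans h.1) (by simp)
  have hA₂ := hA₁.mono hc₂
  have hgood : ∀ c₃ d₂, c₂ ≤ c₃ →
      InitGood ((A.withSt d₁.2.SV d₁.1).withMask (.op .mul A.mask (.op .sub (.lit 1) R))) d.dom
        (fun n => d.work n (subWork sub n)) c₃ d₂ →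
      InitGood A (Init.ite b c d).dom (fun n => (Init.ite b c d).work n (subWork sub n)) c₃
        (d₂.1, d₁.2.seq d₂.2) := fun c₃ d₂ hc₃ hd₂ =>
    ⟨hd₂.1, Delta.Good.seq (SV := A.SV)
      (hd₁.2.mono (fun b ⟨i, hi, hb⟩ => ⟨i, .inl hi, hb⟩) hw₁ hc₃)
      (hd₂.2.mono (fun b ⟨i, hi, hb⟩ => ⟨i, .inr hi, hb⟩) hw₂ le_rfl)⟩
  refine (hd c₂ _ ((hA₂.withSt hd₁.2.below hd₁.1).withMask
    (mask := .op .mul A.mask (.op .sub (.lit 1) R)) ⟨hA₂.mask, trivial, hR.mono hc₂⟩) hN).conseq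
    -- If the condition is false, `afterInit` is the identity, so the second branch starts from the
    -- original state.
    (fun _ g => ((g.withAct fun j => g.act j ∧ g.val b j = some true).afterInit
      (g.execInit c)).withAct fun j => g.act j ∧ g.val b j = some false)
    ((((hst.mono hc₁).and hs₁).mono hc₂).and hs₂)
    (fun n g mem _ hp => ⟨?_, fun h0 => ?_⟩) 1
    (fun n => by rw [one_mul]; exact hw₂ n) (fun d₂ => (d₂.1, d₁.2.seq d₂.2)) hgood
    (fun c₂ d₂ hc₂ hd₂ => (hgood c₂ d₂ hc₂ hd₂).stable (hA₂.mono hc₂) (fun _ g => g)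
      fun n g => g.execInit (.ite b c d)) ?_
  · have h := hp.1.1.1.onFalse hp.1.2
    have h' := (hp.1.1.1.onTrue hp.1.2).afterInit hN hd₁ hp.2
    refine ⟨h.vec, h'.aux, h'.sub, fun j hj s f a => ?_⟩
    obtain rfl := h.eq_zero hN hj
    have hne : ¬ (g.act 0 ∧ g.val b 0 = some true) := fun h => by simp [hj.2] at h
    have : (((g.withAct fun j => g.act j ∧ g.val b j = some true).afterInit
      (g.execInit c)).withAct fun j => g.act j ∧ g.val b j = some false).τ 0 = g.τ 0 := by
      simp [Ghost.afterInit, Ghost.withAct, hj.2]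
    rw [this, ← hp.1.1.1.tmp 0 hj.1]
    by_contra hne'
    exact hne (hp.2.2.1 0 _ hne')
  · rcases key n g (hp.1.1.2 h0.1) with h | h
    · exact absurd (h0.2.symm.trans h.1) (by simp)
    · have := h.2.1
      simpa [Ghost.afterInit, Ghost.withAct, h0.2, Ghost.execInit] using this
  · intro d₂ c₃ n g mem _ _ _ hp h
    refine ⟨fun h0 => ?_, fun j x hx => ?_,
      hp.2.2.2.seq h.2.2 (fun h => h.1) fun h => h.1⟩
    · rcases key n g (hp.1.1.2 h0) with ⟨h1, h2, h3⟩ | ⟨h1, h2, h3⟩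
      · obtain ⟨x, h4, h5, h6⟩ := hp.2.1 ⟨h0, h1⟩
        have hne : ¬ (g.act 0 ∧ g.val b 0 = some false) := fun h => by simp [h1] at h
        refine ⟨x, h3.trans h4, fun i => (h5 i).congr fun x _ => h.2.2.rd_eq hne x,
          fun s f a => ?_⟩
        rw [← h6]
        by_contra hne'
        exact hne (h.2.1 0 _ hne')
      · obtain ⟨x, h4, h5⟩ := h.1 ⟨h0, h1⟩
        refine ⟨x, ?_, h5⟩
        rw [h3, ← h4]
        simp [Ghost.afterInit, Ghost.withAct, h1, Ghost.execInit]
    · by_cases h1 : d₁.1.eval n mem (two j x) = A.tv.eval n mem (two j x)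
      · rw [← h1] at hx
        exact (h.2.1 j x hx).1
      · exact (hp.2.2.1 j x h1).1

theorem iClaim (hq : ∀ i, QClaim (sub i)) (hc : ∀ i, ChgClaim (sub i)) (c : Init Γ m) :
    IClaim sub c := by
  induction c with
  | cmd c => exact iClaim_cmd hq c
  | change i δ args => exact iClaim_change hq hc i δ args
  | seq c d ihc ihd => exact iClaim_seq ihc ihd
  | ite b c d ihc ihd => exact iClaim_ite hq ihc ihd

end

/-! # Update rules -/

section
variable {Γ : Ctx} {sub : (i : Fin Γ.k) → Prog (Γ.sub i)} {m : ℕ}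

/-! ## Contexts for several bound variables -/

def Amb.extN (A : Amb m) : {l : ℕ} → (Fin l → NumFun) → Amb (m + l)
  | 0, _ => A
  | _ + 1, b => (A.extN fun i => b i.castSucc).ext (b (Fin.last _))

def Ghost.extN {n : ℕ} (g : Ghost sub m n) : {l : ℕ} → (Fin l → NumFun) → Ghost sub (m + l) n
  | 0, _ => g
  | _ + 1, b => (g.extN fun i => b i.castSucc).ext (b (Fin.last _))

theorem Amb.Below.extN {ctr : ℕ} {A : Amb m} (h : A.Below ctr) {l : ℕ} (b : Fin l → NumFun) :
    (A.extN b).Below ctr := by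
  induction l with
  | zero => exact h
  | succ l ih => exact (ih _).ext _

theorem Amb.Rep.extN {n : ℕ} {A : Amb m} {g : Ghost sub m n} {mem : BMem} (h : A.Rep g mem)
    {l : ℕ} (b : Fin l → NumFun) : (A.extN b).Rep (g.extN b) mem := by
  induction l with
  | zero => exact h
  | succ l ih => exact (ih _).ext _

/-- One factor `2` for each of the `l` variables. -/
theorem Amb.eval_extN_le (A : Amb m) {l : ℕ} (b : Fin l → NumFun) (n : ℕ) :
    (A.extN b).N.eval n ≤ 2 ^ l * (A.N.eval n * ∏ i, max 1 ((b i).toFun n)) := by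
  induction l with
  | zero => simp [Amb.extN]
  | succ l ih =>
    rw [Fin.prod_univ_castSucc]
    calc (A.extN b).N.eval n
        = (A.extN fun i => b i.castSucc).N.eval n * (NumExpr.range (b (Fin.last l))).eval n := rfl
      _ ≤ _ := Nat.mul_le_mul (ih _) (range_le _ n)
      _ = _ := by ring

section
variable {n : ℕ} (g : Ghost sub m n) {l : ℕ} (b : Fin l → NumFun)

theorem Ghost.extN_σ : (g.extN b).σ = g.σ := by
  induction l with
  | zero => rfl
  | succ l ih => exact ih _

theorem Ghost.extN_θ : (g.extN b).θ = g.θ := by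
  induction l with
  | zero => rfl
  | succ l ih => exact ih _

/-- The contexts for tuples of bound variables. -/
theorem Ghost.exists_of_extN_act {j : ℕ} (h : (g.extN b).act j) :
    ∃ (i : ℕ) (z : Fin l → Fin n), (∀ k, (z k : ℕ) ≤ (b k).toFun n) ∧ g.act i ∧
      (g.extN b).env j = Fin.append (g.env i) z ∧ (g.extN b).τ j = g.τ i := by
  induction l generalizing j with
  | zero => exact ⟨j, Fin.elim0, fun k => k.elim0, h, by simp [Ghost.extN], rfl⟩
  | succ l ih =>
    obtain ⟨i, y, hy, rfl, hi, -⟩ := Ghost.exists_of_ext_act h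
    obtain ⟨i', z, hz, hi', h1, h2⟩ := ih _ hi
    refine ⟨i', Fin.snoc (α := fun _ => Fin n) z y, fun k => ?_, hi',
      (Ghost.ext_env hy).trans ?_, (Ghost.ext_τ hy).trans h2⟩
    · induction k using Fin.lastCases with
      | last => simpa using hy
      | cast k => simpa using hz k
    · rw [h1, Fin.append_snoc]

theorem Ghost.exists_extN_act {i : ℕ} (h : g.act i) (z : Fin l → Fin n)
    (hz : ∀ k, (z k : ℕ) ≤ (b k).toFun n) : ∃ j, (g.extN b).act j ∧
      (g.extN b).env j = Fin.append (g.env i) z ∧ (g.extN b).τ j = g.τ i := by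
  induction l with
  | zero => exact ⟨i, h, by simp [Ghost.extN, Subsingleton.elim z Fin.elim0], rfl⟩
  | succ l ih =>
    obtain ⟨j, h1, h2, h3⟩ := ih (fun i => b i.castSucc) (fun k => z k.castSucc) fun k => hz _
    refine ⟨childIdx (b (Fin.last l)) n j (z (Fin.last l)), (Ghost.ext_act (hz _)).2 h1,
      (Ghost.ext_env (hz _)).trans ?_, (Ghost.ext_τ (hz _)).trans h3⟩
    rw [h2, ← Fin.append_snoc]
    congr 1
    exact Fin.snoc_init_self z

end

end

/-! ## The new value of a symbol -/

/-- A description of the new value that is uniform in the sort: values with nonzero code win, and a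
value with code `0` results only in their absence. For a relation this is the precedence of `true`
over `false`; for a function all returned values agree anyway. -/
theorem combine_code {n : ℕ} {s : Srt} {old w : Val n s} {V : Set (Val n s)}
    (h : combine s old V = some w) : (∀ v ∈ V, v.code ≠ 0 → w = v) ∧
      (V.Nonempty → w.code ≠ 0 → w ∈ V) ∧ (V = ∅ → w = old) := by
  classical
  cases s with
  | rel =>
    simp only [combine, Option.some_inj] at h
    subst h
    refine ⟨fun v hv h => ?_, fun hV h => ?_, fun hV => by simp [hV]⟩
    · cases v with
      | false => exact absurd rfl h
      | true => simp [hv]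
    · split_ifs at h ⊢ with h1 h2
      · exact h1
      · exact absurd rfl h
      · obtain ⟨v, hv⟩ := hV
        cases v <;> contradiction
  | fn =>
    simp only [combine] at h
    split_ifs at h with h1 h2
    · cases h
      exact ⟨by simp [h1], by simp [h1], fun _ => rfl⟩
    · have h3 := h2.choose_spec
      rw [Option.some_inj] at h
      rw [h] at h3
      exact ⟨fun v hv _ => by rw [h3] at hv; exact hv.symm, fun _ _ => by rw [h3]; rfl,
        fun h => absurd h h1⟩

section
variable {n : ℕ} {aux : Schema} {k : ℕ} {J : Fin k → Interface} {S : Fin k → Type} {p : ℕ}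
  {s : Srt} {f : Fin (aux.num s)}

theorem UpdRule.eval_eq_some {r : UpdRule aux J p s f} {O : (i : Fin k) → Sem n (J i) (S i)}
    {σ : Struct aux n} {θ : (i : Fin k) → S i} {a : Fin p → Fin n}
    {y : ((Fin (aux.arity s f) → Fin n) → Val n s) × ((i : Fin k) → S i)}
    (h : r.eval O σ θ a = some y) :
    ∃ x, r.init.exec (Γ := ⟨aux, r.tmp, k, J⟩) O σ a (θ, Struct.empty r.tmp n) = some x ∧
      y.2 = x.1 ∧ (∀ b : Fin r.l → Fin n, (∀ i, (b i : ℕ) ≤ (r.bound i).toFun n) →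
        (evalArgs (Γ := ⟨aux, r.tmp, k, J⟩) O σ x.1 x.2 (Fin.append a b) r.head).isSome ∧
        (r.body.run (Γ := ⟨aux, r.tmp, k, J⟩) O σ x.1 (Fin.append a b) x.2).isSome) ∧
      ∀ c, combine s (σ s f c) {v | ∃ b : Fin r.l → Fin n,
        (∀ i, (b i : ℕ) ≤ (r.bound i).toFun n) ∧
        evalArgs (Γ := ⟨aux, r.tmp, k, J⟩) O σ x.1 x.2 (Fin.append a b) r.head = some (some c) ∧
        r.body.run (Γ := ⟨aux, r.tmp, k, J⟩) O σ x.1 (Fin.append a b) x.2 = some v} =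
          some (y.1 c) := by
  rw [UpdRule.eval, Option.bind_eq_some_iff] at h
  obtain ⟨x, hx, h⟩ := h
  dsimp only at h
  split_ifs at h with hd
  cases h
  exact ⟨x, hx, rfl, hd.1, fun c => (Option.some_get _).symm⟩

/-- The banks that may change when the rule is applied. -/
def UpdRule.dom (r : UpdRule aux J p s f) (c b : ℕ) : Prop :=
  b = symBank c s f ∨ ∃ i, r.Invokes i ∧ BankIn (Nat.pair c i + 1) b

end

section
variable {I : Interface} {aux : Schema} {k : ℕ} {J : Fin k → Interface}
  {sub : (i : Fin k) → Prog (J i)}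
  {upd : (δ : Fin I.chg) → (s : Srt) → (f : Fin (aux.num s)) →
    Option (UpdRule aux J (I.chgArity δ) s f)}
  {qry : (s : Srt) → (q : Fin (I.qry.num s)) → QryRule aux J (I.qry.arity s q) s}
  {p n : ℕ} {s : Srt} {f : Fin (aux.num s)}

/-- The context in which the initial procedure is executed. -/
def QGhost.initial (g : QGhost (Prog.mk aux k J sub upd qry) p n) (r : UpdRule aux J p s f) :
    Ghost (Γ := ⟨aux, r.tmp, k, J⟩) sub p n :=
  ⟨g.pos, g.st.1, g.st.2, g.act, g.env, fun _ => Struct.empty _ n⟩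

/-- The contexts in which the main procedure is executed. -/
noncomputable def QGhost.main (g : QGhost (Prog.mk aux k J sub upd qry) p n)
    (r : UpdRule aux J p s f) : Ghost (Γ := ⟨aux, r.tmp, k, J⟩) sub (p + r.l) n :=
  ((g.initial r).afterInit ((g.initial r).execInit r.init)).extN r.bound

/-- The quantifiers over tuples `x̄` in the semantics are translated to quantifiers over numbers of
contexts. -/
theorem UpdRule.eval_main {r : UpdRule aux J p s f}
    {g : QGhost (Prog.mk aux k J sub upd qry) p n} (h0 : ∀ j, g.act j → j = 0) (h : g.act 0)
    {y : ((Fin (aux.arity s f) → Fin n) → Val n s) × ((i : Fin k) → (sub i).State n)}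
    (hy : r.eval (fun i => (sub i).sem n) g.st.1 g.st.2 (g.env 0) = some y) :
    (∃ x, (g.initial r).execInit r.init = some x ∧ y.2 = x.1) ∧
    (∀ j, (g.main r).act j →
      ((g.main r).args r.head j).isSome ∧ ((g.main r).run r.body j).isSome) ∧
    ∀ a, (∀ j v, (g.main r).act j → (g.main r).args r.head j = some (some a) →
        (g.main r).run r.body j = some v → v.code ≠ 0 → y.1 a = v) ∧
      ((∃ j, (g.main r).act j ∧ (g.main r).args r.head j = some (some a)) → (y.1 a).code ≠ 0 →
        ∃ j, (g.main r).act j ∧ (g.main r).args r.head j = some (some a) ∧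
          (g.main r).run r.body j = some (y.1 a)) ∧
      ((¬ ∃ j, (g.main r).act j ∧ (g.main r).args r.head j = some (some a)) →
        y.1 a = g.st.1 s f a) := by
  obtain ⟨x, hx, h1, h2, h3⟩ := UpdRule.eval_eq_some hy
  have hx' : (g.initial r).execInit r.init = some x := hx
  have hθ : ((g.initial r).afterInit ((g.initial r).execInit r.init)).θ = x.1 := by
    simp only [Ghost.afterInit, hx', Option.getD_some]
    exact if_pos h
  have hτ : ∀ j, ((g.initial r).afterInit ((g.initial r).execInit r.init)).τ j = x.2 := fun j => by
    simp only [Ghost.afterInit, hx', Option.getD_some]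
    exact if_pos h
  have key : ∀ (j : ℕ) (z : Fin r.l → Fin n), (g.main r).env j = Fin.append (g.env 0) z →
      (g.main r).τ j = x.2 →
      (g.main r).args r.head j = evalArgs (Γ := ⟨aux, r.tmp, k, J⟩) (fun i => (sub i).sem n)
        g.st.1 x.1 x.2 (Fin.append (g.env 0) z) r.head ∧
      (g.main r).run r.body j = r.body.run (Γ := ⟨aux, r.tmp, k, J⟩) (fun i => (sub i).sem n)
        g.st.1 x.1 (Fin.append (g.env 0) z) x.2 := by
    intro j z e1 e2
    have e3 : (g.main r).σ = g.st.1 := Ghost.extN_σ _ _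
    have e4 : (g.main r).θ = x.1 := (Ghost.extN_θ _ _).trans hθ
    simp only [Ghost.args, Ghost.run, e1, e2, e3, e4, and_self]
  have fwd : ∀ j, (g.main r).act j → ∃ z : Fin r.l → Fin n,
      (∀ i, (z i : ℕ) ≤ (r.bound i).toFun n) ∧
      (g.main r).env j = Fin.append (g.env 0) z ∧ (g.main r).τ j = x.2 := by
    intro j hj
    obtain ⟨i, z, hz, hi, e1, e2⟩ := Ghost.exists_of_extN_act _ _ hj
    obtain rfl := h0 i hi
    exact ⟨z, hz, e1, e2.trans (hτ _)⟩
  have bwd : ∀ z : Fin r.l → Fin n, (∀ i, (z i : ℕ) ≤ (r.bound i).toFun n) →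
      ∃ j, (g.main r).act j ∧ (g.main r).env j = Fin.append (g.env 0) z ∧
        (g.main r).τ j = x.2 := by
    intro z hz
    obtain ⟨j, hj, e1, e2⟩ := Ghost.exists_extN_act
      ((g.initial r).afterInit ((g.initial r).execInit r.init)) r.bound (i := 0) h z hz
    exact ⟨j, hj, e1, e2.trans (hτ _)⟩
  refine ⟨⟨x, hx', h1⟩, fun j hj => ?_, fun a => ?_⟩
  · obtain ⟨z, hz, e1, e2⟩ := fwd j hj
    rw [(key j z e1 e2).1, (key j z e1 e2).2]
    exact h2 z hz
  · obtain ⟨c1, c2, c3⟩ := combine_code (h3 a)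
    refine ⟨fun j v hj ha hv => c1 v ?_, fun hex hne => ?_, fun hex => c3 ?_⟩
    · obtain ⟨z, hz, e1, e2⟩ := fwd j hj
      rw [(key j z e1 e2).1] at ha
      rw [(key j z e1 e2).2] at hv
      exact ⟨z, hz, ha, hv⟩
    · have hV : Set.Nonempty {v | ∃ b : Fin r.l → Fin n,
          (∀ i, (b i : ℕ) ≤ (r.bound i).toFun n) ∧
          evalArgs (Γ := ⟨aux, r.tmp, k, J⟩) (fun i => (sub i).sem n) g.st.1 x.1 x.2
            (Fin.append (g.env 0) b) r.head = some (some a) ∧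
          r.body.run (Γ := ⟨aux, r.tmp, k, J⟩) (fun i => (sub i).sem n) g.st.1 x.1
            (Fin.append (g.env 0) b) x.2 = some v} := by
        obtain ⟨j, hj, ha⟩ := hex
        obtain ⟨z, hz, e1, e2⟩ := fwd j hj
        obtain ⟨v, hv⟩ := Option.isSome_iff_exists.1 (h2 z hz).2
        exact ⟨v, z, hz, (key j z e1 e2).1 ▸ ha, hv⟩
      obtain ⟨z, hz, ha, hv⟩ := c2 hV hne
      obtain ⟨j, hj, e1, e2⟩ := bwd z hz
      exact ⟨j, hj, by rw [(key j z e1 e2).1, ha], by rw [(key j z e1 e2).2, hv]⟩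
    · refine Set.eq_empty_of_forall_notMem ?_
      rintro v ⟨z, hz, ha, -⟩
      obtain ⟨j, hj, e1, e2⟩ := bwd z hz
      exact hex ⟨j, hj, by rw [(key j z e1 e2).1, ha]⟩

end

/-! # Application of update rules and change operations -/

section
variable {I : Interface} {aux : Schema} {k : ℕ} {J : Fin k → Interface}
  {sub : (i : Fin k) → Prog (J i)}
  {upd : (δ : Fin I.chg) → (s : Srt) → (f : Fin (aux.num s)) →
    Option (UpdRule aux J (I.chgArity δ) s f)}
  {qry : (s : Srt) → (q : Fin (I.qry.num s)) → QryRule aux J (I.qry.arity s q) s}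
  {p : ℕ} {s : Srt} {f : Fin (aux.num s)}

/-- The result of the rule in the context `0`, if this is active. -/
def UpdRule.Post (r : UpdRule aux J p s f) (c : ℕ) (SV : ℕ → SExp) (d : Delta) {n : ℕ}
    (g : QGhost (Prog.mk aux k J sub upd qry) p n) (m : BMem) : Prop :=
  (g.act 0 → ∃ y, r.eval (fun i => (sub i).sem n) g.st.1 g.st.2 (g.env 0) = some y ∧
    (∀ a, rd d.SV n m (symAddr c s f a) = (y.1 a).code) ∧
    ∀ i : Fin k, RepS (sub i) (Nat.pair c i + 1) (y.2 i) d.SV m) ∧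
  d.Logged SV n m (g.act 0)

theorem UpdRule.stable_post (r : UpdRule aux J p s f) {c : ℕ} {SV : ℕ → SExp} {d : Delta}
    {dom : ℕ → Prop} {w : ℕ → ℕ} {ctr : ℕ} (hd : d.Good SV dom w ctr)
    (hS : ∀ b, (SV b).Below ctr) :
    Stable ctr fun n (g : QGhost (Prog.mk aux k J sub upd qry) p n) m => r.Post c SV d g m := by
  intro n g m m' ha h
  refine ⟨fun h0 => ?_, hd.stable hS (fun n (g : QGhost (Prog.mk aux k J sub upd qry) p n) =>
    g.act 0) n g m m' ha h.2⟩
  obtain ⟨y, h1, h2, h3⟩ := h.1 h0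
  exact ⟨y, h1, fun a => by rw [← h2, rd, rd, (hd.below _).eval_eq ha],
    fun i => (h3 i).agree hd.below ha⟩

/-- The kernel that writes `val` at the heads with codes `R`, where `cond ≠ 0`. -/
def headKernel {m j : ℕ} (A : Amb m) (R : Fin j → SExp) (B : ℕ) (cond val : SExp) : Kernel :=
  ⟨B, A.N, .op .mul A.mask (.op .mul (SExp.prodE R) cond), SExp.decodeE R, val⟩

theorem headKernel_on {Γ : Ctx} {sub : (i : Fin Γ.k) → Prog (Γ.sub i)} {m j n : ℕ} {A : Amb m}
    {g : Ghost sub m n} {mem : BMem} (hA : A.Rep g mem) {R : Fin j → SExp}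
    {args : Fin j → Expr Γ m .fn} (hR : ArgVals R mem g.act (g.args args)) (B : ℕ)
    (cond val : SExp) (i : ℕ) : (headKernel A R B cond val).On n mem i ↔
      g.act i ∧ (∃ a, g.args args i = some (some a)) ∧ cond.eval n mem (fun _ => i) ≠ 0 := by
  refine (hA.withMask (mask := .op .mul A.mask (.op .mul (SExp.prodE R) cond))
    (act := fun i => g.act i ∧ (∃ a, g.args args i = some (some a)) ∧
      cond.eval n mem (fun _ => i) ≠ 0) (fun i => ?_) fun j hj => hj.1).on_iff
  rw [SExp.eval_mul, mul_ne_zero_iff, hA.vec.mask_iff, SExp.eval_mul, mul_ne_zero_iff]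
  exact and_congr_right fun hj => and_congr_left fun _ => hR.prodE_ne_zero hj

theorem UpdRule.main_work_le (r : UpdRule aux J p s f) (A : Amb p) (hN : A.N = .lit 1) (n : ℕ)
    (W : (i : Fin k) → WorkBound (J i)) {w : ℕ}
    (hw : w ≤ max (maxOne fun j => (r.head j).work (Γ := ⟨aux, r.tmp, k, J⟩) n W)
      (r.body.work (Γ := ⟨aux, r.tmp, k, J⟩) n W)) :
    (A.extN r.bound).N.eval n * w ≤ 2 ^ r.l * r.work n W := by
  refine (Nat.mul_le_mul (A.eval_extN_le r.bound n) hw).trans ?_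
  rw [hN, NumExpr.eval, one_mul, mul_assoc]
  exact Nat.mul_le_mul_left _ (le_max_right _ _)

/-- The main procedure may return both `true` and `false` for one head, so the returned values
cannot all be written. Instead one bank receives the nonzero codes, a second one marks the heads
that occur, and the new view reads the first bank at marked tuples and the old state elsewhere. -/
theorem ruleBlk (hq : ∀ i, QClaim (sub i)) (hc : ∀ i, ChgClaim (sub i)) (r : UpdRule aux J p s f)
    {ctr c : ℕ} {SV : ℕ → SExp} {mask : SExp} {vars : Fin p → SExp} (hm : mask.Below ctr)
    (hv : ∀ i, (vars i).Below ctr) (hS : ∀ b, (SV b).Below ctr) :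
    Blk ctr (fun n => r.work n fun i => (sub i).work n)
      (G := QGhost (Prog.mk aux k J sub upd qry) p)
      (fun n g m => VecRep (.lit 1) mask vars g.act g.env m ∧
        RepS (Prog.mk aux k J sub upd qry) c g.st SV m ∧
        (g.act 0 → (r.eval (fun i => (sub i).sem n) g.st.1 g.st.2 (g.env 0)).isSome))
      (fun ctr (d : Delta) => d.Good SV (r.dom c) (fun n => r.work n fun i => (sub i).work n) ctr)
      fun d _ g m => r.Post c SV d g m := by
  let A : Amb p := ⟨.lit 1, c, SV, mask, vars, .lit 0⟩
  have hA : A.Below ctr := ⟨hS, hm, hv, trivial⟩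
  have hst : Stable ctr fun n (g : QGhost (Prog.mk aux k J sub upd qry) p n) m =>
      VecRep (.lit 1) mask vars g.act g.env m ∧ RepS (Prog.mk aux k J sub upd qry) c g.st SV m ∧
        (g.act 0 → (r.eval (fun i => (sub i).sem n) g.st.1 g.st.2 (g.env 0)).isSome) :=
    fun n g m m' ha hp => ⟨hp.1.agree hm hv ha, hp.2.1.agree hS ha, hp.2.2⟩
  have hrep : ∀ n (g : QGhost (Prog.mk aux k J sub upd qry) p n) mem,
      VecRep (.lit 1) mask vars g.act g.env mem →
      RepS (Prog.mk aux k J sub upd qry) c g.st SV mem → A.Rep (g.initial r) mem :=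
    fun n g mem h1 h2 => ⟨h1, (repS_mk.1 h2).1, (repS_mk.1 h2).2, fun j _ s f a => by
      simp [A, QGhost.initial, Struct.empty]⟩
  have hzero : ∀ n (g : QGhost (Prog.mk aux k J sub upd qry) p n) mem,
      VecRep (.lit 1) mask vars g.act g.env mem → ∀ j, g.act j → j = 0 := fun n g mem h j hj => by
    simpa [NumExpr.eval] using h.lt j hj
  refine (iClaim (Γ := ⟨aux, r.tmp, k, J⟩) hq hc r.init ctr A hA rfl).bind
    (fun n g => g.initial r) hst (fun n g mem _ hp => ⟨hrep n g mem hp.1 hp.2.1, fun h0 => ?_⟩) 1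
    (fun n => by rw [one_mul]; exact le_max_left _ _) fun c₁ d₁ hc₁ hd₁ hs₁ => ?_
  · obtain ⟨y, hy⟩ := Option.isSome_iff_exists.1 (hp.2.2 h0)
    obtain ⟨x, hx, -⟩ := UpdRule.eval_eq_some hy
    exact Option.isSome_iff_exists.2 ⟨x, hx⟩
  let A' : Amb (p + r.l) := (A.withSt d₁.2.SV d₁.1).extN r.bound
  have hA' : A'.Below c₁ := ((hA.mono hc₁).withSt hd₁.2.below hd₁.1).extN _
  have hact : ∀ n (g : QGhost (Prog.mk aux k J sub upd qry) p n) mem,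
      VecRep (.lit 1) mask vars g.act g.env mem → ∀ j, (g.main r).act j → g.act 0 := by
    intro n g mem h j hj
    obtain ⟨i, -, -, hi, -⟩ := Ghost.exists_of_extN_act _ _ hj
    have hi : g.act i := hi
    rwa [hzero n g mem h i hi] at hi
  have hmain : ∀ n (g : QGhost (Prog.mk aux k J sub upd qry) p n) mem,
      VecRep (.lit 1) mask vars g.act g.env mem →
      (g.act 0 → (r.eval (fun i => (sub i).sem n) g.st.1 g.st.2 (g.env 0)).isSome) →
      ∀ j, (g.main r).act j →
        ((g.main r).args r.head j).isSome ∧ ((g.main r).run r.body j).isSome := by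
    intro n g mem h1 h2 j hj
    have h0 := hact n g mem h1 j hj
    obtain ⟨y, hy⟩ := Option.isSome_iff_exists.1 (h2 h0)
    exact (UpdRule.eval_main (hzero n g mem h1) h0 hy).2.1 j hj
  have hst₁ := (hst.mono hc₁).and hs₁
  refine (argsBlk (Γ := ⟨aux, r.tmp, k, J⟩) (sub := sub) (args := r.head) (fun i => eClaim hq _)
    (w := fun n => maxOne fun j =>
      (r.head j).work (Γ := ⟨aux, r.tmp, k, J⟩) n fun i => (sub i).work n)
    (fun i n => le_maxOne (fun j =>
      (r.head j).work (Γ := ⟨aux, r.tmp, k, J⟩) n fun i => (sub i).work n) i) c₁ A' hA').bind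
    (fun n g => g.main r) hst₁
    (fun n g mem _ hp => ⟨((hrep n g mem hp.1.1 hp.1.2.1).afterInit rfl hd₁ hp.2).extN _,
      fun j hj => (hmain n g mem hp.1.1 hp.1.2.2 j hj).1⟩) (2 ^ r.l)
    (fun n => r.main_work_le (A.withSt d₁.2.SV d₁.1) rfl n _ (le_max_left _ _))
    fun c₂ R hc₂ hR hs₂ => ?_
  refine (bodyBlk (Γ := ⟨aux, r.tmp, k, J⟩) (sub := sub) hq r.body c₂ A' (hA'.mono hc₂)).bind
    (fun n g => g.main r) ((hst₁.mono hc₂).and hs₂)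
    (fun n g mem _ hp => ⟨((hrep n g mem hp.1.1.1 hp.1.1.2.1).afterInit rfl hd₁ hp.1.2).extN _,
      fun j hj => (hmain n g mem hp.1.1.1 hp.1.1.2.2 j hj).2⟩) (2 ^ r.l)
    (fun n => r.main_work_le (A.withSt d₁.2.SV d₁.1) rfl n _ (le_max_right _ _))
    fun c₃ Rb hc₃ hRb hs₃ => ?_
  have hst₃ := (((hst₁.mono hc₂).and hs₂).mono hc₃).and hs₃
  have hA₃ := (hA'.mono hc₂).mono hc₃
  have hR₃ : ∀ i, (R i).Below c₃ := fun i => (hR i).mono hc₃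
  have hwork : ∀ n, A'.N.eval n ≤ 2 ^ r.l * r.work n fun i => (sub i).work n := fun n => by
    have := r.main_work_le (A.withSt d₁.2.SV d₁.1) rfl n (fun i => (sub i).work n) (w := 1)
      (le_max_of_le_left (one_le_maxOne _))
    rwa [mul_one] at this
  have hrep' : ∀ n (g : QGhost (Prog.mk aux k J sub upd qry) p n) mem,
      VecRep (.lit 1) mask vars g.act g.env mem →
      RepS (Prog.mk aux k J sub upd qry) c g.st SV mem →
      InitPost A d₁ (g.initial r) mem ((g.initial r).execInit r.init) → A'.Rep (g.main r) mem :=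
    fun n g mem h1 h2 h3 => ((hrep n g mem h1 h2).afterInit rfl hd₁ h3).extN _
  -- The code `Rb` is both the condition and the value, so only nonzero codes are written; by
  -- `combine_code` these agree at each head.
  refine (Blk.write [headKernel A' R (tmpBank c₃) Rb Rb] (by simp [headKernel])
    (by simp [headKernel, hA₃.mask, SExp.below_prodE hR₃, SExp.below_decodeE hR₃, hRb])
    (by simpa [headKernel] using ⟨_, hwork⟩) ?_).bind (fun _ g => g) hst₃ (fun _ _ _ _ h => h) 1
    (fun n => by rw [one_mul]) fun c₄ B₁ hc₄ hB₁ hs₄ => ?_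
  · intro n g mem _ hp k hk k' hk' i i' hi hi' hcell
    obtain rfl := List.mem_singleton.1 hk
    obtain rfl := List.mem_singleton.1 hk'
    have hrep := hrep' n g mem hp.1.1.1.1 hp.1.1.1.2.1 hp.1.1.2
    rw [headKernel_on hrep hp.1.2] at hi hi'
    obtain ⟨hi, ⟨a, ha⟩, hne⟩ := hi
    obtain ⟨hi', ⟨a', ha'⟩, hne'⟩ := hi'
    simp only [headKernel, hp.1.2.decodeE_eq hi ha, hp.1.2.decodeE_eq hi' ha'] at hcell
    obtain rfl := tupleCode_injective hcell
    have h0 := hact n g mem hp.1.1.1.1 i hi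
    obtain ⟨y, hy⟩ := Option.isSome_iff_exists.1 (hp.1.1.1.2.2 h0)
    have hspec := ((UpdRule.eval_main (hzero n g mem hp.1.1.1.1) h0 hy).2.2 a).1
    obtain ⟨v, h1, h2⟩ := hp.2 i hi
    obtain ⟨v', h1', h2'⟩ := hp.2 i' hi'
    rw [h2] at hne
    rw [h2'] at hne'
    simp only [headKernel, h2, h2', ← hspec i v hi ha h1 hne, ← hspec i' v' hi' ha' h1' hne']
  obtain ⟨rfl, rfl⟩ := hB₁
  have hA₄ := hA₃.mono (Nat.le_succ c₃)
  have hR₄ : ∀ i, (R i).Below (c₃ + 1) := fun i => (hR₃ i).mono (Nat.le_succ c₃)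
  -- Unmarked tuples fall back to the original view `SV`, which the initial procedure has not
  -- altered in this bank. The log has one cell for every context, active or not; superfluous
  -- entries are harmless.
  let D : ℕ → Delta := fun B₂ =>
    ⟨Function.update d₁.2.SV (symBank c s f) (.cond (.load B₂ (.var 0))
      (.load (tmpBank c₃) (.var 0)) (SV (symBank c s f))),
      d₁.2.log ++ [⟨A'.N, symBank c s f, SExp.decodeE R⟩]⟩
  have hgood : ∀ c', c₃ + 1 < c' → (D (tmpBank (c₃ + 1))).Good SV (r.dom c)
      (fun n => r.work n fun i => (sub i).work n) c' := by
    intro c' hc'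
    have hd := hd₁.2.mono (dom' := r.dom c) (w' := fun n => r.work n fun i => (sub i).work n)
      (fun b hb => .inr hb) (fun n => le_max_left _ _) (ctr' := c') (by omega)
    refine ⟨fun b => ?_, fun b hb => ?_, fun e he => ?_⟩
    · by_cases hb : b = symBank c s f
      · subst hb
        simp only [D, Function.update_self, SExp.below_cond, below_load_tmpBank]
        exact ⟨⟨hc', trivial⟩, ⟨by omega, trivial⟩, (hS _).mono (by omega)⟩
      · simp only [D, Function.update_of_ne hb]
        exact hd.below b
    · have hne : b ≠ symBank c s f := fun h => hb (.inl h)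
      simp only [D, Function.update_of_ne hne]
      exact hd.eq b hb
    · rcases List.mem_append.1 he with he | he
      · exact hd.log e he
      · obtain rfl := List.mem_singleton.1 he
        exact ⟨(SExp.below_decodeE hR₄).mono hc'.le, .inl rfl, _, hwork⟩
  refine (Blk.write [headKernel A' R (tmpBank (c₃ + 1)) (.lit 1) (.lit 1)] (by simp [headKernel])
    (by simp [headKernel, hA₄.mask, SExp.below_prodE hR₄, SExp.below_decodeE hR₄])
    (by simpa [headKernel] using ⟨_, hwork⟩) (by simp [headKernel])).conseq (fun _ g => g)
    ((hst₃.mono (Nat.le_succ _)).and hs₄) (fun _ _ _ _ h => h) 1 (fun n => by rw [one_mul]) D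
    ?_ ?_ ?_
  · rintro c' B - ⟨rfl, rfl⟩
    exact hgood _ (by omega)
  · rintro c' B - ⟨rfl, rfl⟩
    exact r.stable_post (hgood _ (by omega)) fun b => (hS b).mono (by omega)
  · rintro B c' n g mem - - - ⟨⟨⟨⟨⟨hvec, hst, hsome⟩, hinit⟩, hargs⟩, hvals⟩, h1, h1'⟩ ⟨h2, h2'⟩
    have hrep := hrep' n g mem hvec hst hinit
    simp only [List.mem_singleton, forall_eq, headKernel_on hrep hargs] at h1 h1' h2 h2'
    simp only [headKernel, SExp.eval_lit] at h1 h1' h2 h2'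
    have hown : ∀ x, rd (D B).SV n mem (Nat.pair (symBank c s f) x) =
        if mem B x = 0 then rd SV n mem (Nat.pair (symBank c s f) x) else mem (tmpBank c₃) x := by
      intro x
      by_cases h : mem B x = 0 <;> simp [rd_pair, D, h]
    have hother : ∀ x, x.unpair.1 ≠ symBank c s f →
        rd (D B).SV n mem x = rd d₁.2.SV n mem x := by
      intro x hx
      simp only [rd, D, Function.update_of_ne hx]
    refine ⟨fun h0 => ?_, fun x hx => ?_⟩
    · obtain ⟨y, hy⟩ := Option.isSome_iff_exists.1 (hsome h0)
      obtain ⟨⟨x, hx, hyx⟩, hdef, hspec⟩ := UpdRule.eval_main (hzero n g mem hvec) h0 hy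
      refine ⟨y, hy, fun a => ?_, fun i => ?_⟩
      · obtain ⟨s1, s2, s3⟩ := hspec a
        rw [symAddr_eq, hown]
        by_cases hex : ∃ j, (g.main r).act j ∧ (g.main r).args r.head j = some (some a)
        · rw [if_neg]
          -- At a marked head with new code `0` no nonzero code was returned, so the first bank
          -- still contains its initial `0`.
          · by_cases hne : (y.1 a).code = 0
            · rw [hne]
              refine h1' _ ?_
              rintro j ⟨hj, ⟨a', ha'⟩, hc0⟩ he
              rw [hargs.decodeE_eq hj ha'] at he
              obtain rfl := tupleCode_injective he
              obtain ⟨v, hv, hv'⟩ := hvals j hj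
              rw [hv'] at hc0
              rw [s1 j v hj ha' hv hc0] at hne
              exact hc0 hne
            · obtain ⟨j, hj, ha, hv⟩ := s2 hex hne
              have hR := hvals.eval_eq hj hv
              have := h1 j ⟨hj, ⟨a, ha⟩, by rwa [hR]⟩
              rwa [hargs.decodeE_eq hj ha, hR] at this
          · obtain ⟨j, hj, ha⟩ := hex
            have := h2 j ⟨hj, ⟨a, ha⟩, one_ne_zero⟩
            rw [hargs.decodeE_eq hj ha] at this
            simp [this]
        · rw [if_pos, s3 hex, ← symAddr_eq]
          · exact (repS_mk.1 hst).1 s f a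
          · refine h2' _ ?_
            rintro j ⟨hj, ⟨a', ha'⟩, -⟩ he
            rw [hargs.decodeE_eq hj ha'] at he
            obtain rfl := tupleCode_injective he
            exact hex ⟨j, hj, ha'⟩
      · obtain ⟨x', hx', h3, -⟩ := hinit.1 h0
        rw [hx] at hx'
        cases hx'
        rw [hyx]
        refine (h3 i).congr fun x hx => hother x fun he => ?_
        rw [he] at hx
        exact not_bankIn_child _ _ _ _ hx
    · by_cases hb : x.unpair.1 = symBank c s f
      · obtain ⟨b, x, rfl⟩ : ∃ b x', x = Nat.pair b x' := ⟨_, _, (Nat.pair_unpair x).symm⟩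
        simp only [Nat.unpair_pair] at hb
        subst hb
        rw [hown] at hx
        split_ifs at hx with hz
        · exact absurd rfl hx
        · obtain ⟨j, ⟨hj, h⟩, he⟩ : ∃ j, ((g.main r).act j ∧
              (∃ a, (g.main r).args r.head j = some (some a)) ∧ 1 ≠ 0) ∧
              (SExp.decodeE R).eval n mem (fun _ => j) = x := by
            by_contra hne
            exact hz (h2' x fun j hj he => hne ⟨j, hj, he⟩)
          exact ⟨hact n g mem hvec j hj, _, List.mem_append_right _ (List.mem_singleton_self _),
            j, hrep.vec.lt j hj, by rw [he]⟩
      · rw [hother x hb] at hx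
        obtain ⟨h3, e, he, h4⟩ := hinit.2.2 x hx
        exact ⟨h3, e, List.mem_append_left _ he, h4⟩

end

/-! ### All rules of a change operation together -/

instance : Finite Srt :=
  Finite.of_injective (fun s : Srt => match s with | .rel => true | .fn => false) fun s t => by
    cases s <;> cases t <;> simp

/-- Hides the choice in `applyRules`: it suffices to know that the state of an invoked instance
comes from some rule that invokes it. -/
theorem applyRules_spec {n : ℕ} {aux : Schema} {k : ℕ} {J : Fin k → Interface} {S : Fin k → Type}
    {p : ℕ} {upd : (s : Srt) → (f : Fin (aux.num s)) → Option (UpdRule aux J p s f)}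
    {O : (i : Fin k) → Sem n (J i) (S i)} {st : Struct aux n × ((i : Fin k) → S i)}
    {a : Fin p → Fin n} (h : (applyRules upd O st a).isSome) :
    (∀ s f r, upd s f = some r → (r.eval O st.1 st.2 a).isSome) ∧
    ∃ st', applyRules upd O st a = some st' ∧ (∀ s f, upd s f = none → st'.1 s f = st.1 s f) ∧
      (∀ s f r y, upd s f = some r → r.eval O st.1 st.2 a = some y → st'.1 s f = y.1) ∧
      ∀ i, (st'.2 i = st.2 i ∧ ∀ s f r, upd s f = some r → ¬ r.Invokes i) ∨
        ∃ s f r y, upd s f = some r ∧ r.Invokes i ∧ r.eval O st.1 st.2 a = some y ∧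
          st'.2 i = y.2 i := by
  classical
  unfold applyRules at h ⊢
  split_ifs at h ⊢ with hd
  · refine ⟨hd, _, rfl, fun s f hn => by simp [hn], fun s f r y hr hy => by simp [hr, hy],
      fun i => ?_⟩
    by_cases hex : ∃ (x : (s : Srt) × Fin (aux.num s)) (r : UpdRule aux J p x.1 x.2),
        upd x.1 x.2 = some r ∧ r.Invokes i
    · obtain ⟨r, hr, hi⟩ := hex.choose_spec
      obtain ⟨y, hy⟩ := Option.isSome_iff_exists.1 (hd _ _ r hr)
      refine .inr ⟨_, _, r, y, hr, hi, hy, ?_⟩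
      simp only [dif_pos hex]
      simp [hr, hy]
    · refine .inl ⟨by simp only [dif_neg hex], fun s f r hr hi => hex ⟨⟨s, f⟩, r, hr, hi⟩⟩
  · simp at h

section
variable {I : Interface} {aux : Schema} {k : ℕ} {J : Fin k → Interface}
  {sub : (i : Fin k) → Prog (J i)}
  {upd : (δ : Fin I.chg) → (s : Srt) → (f : Fin (aux.num s)) →
    Option (UpdRule aux J (I.chgArity δ) s f)}
  {qry : (s : Srt) → (q : Fin (I.qry.num s)) → QryRule aux J (I.qry.arity s q) s}

theorem UpdRule.dom.bankIn {p : ℕ} {s : Srt} {f : Fin (aux.num s)} {r : UpdRule aux J p s f}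
    {c b : ℕ} (h : r.dom c b) : BankIn c b := by
  rcases h with rfl | ⟨i, -, h⟩
  · exact bankIn_symBank c s f
  · exact h.of_child

/-- A symbol bank belongs to the rule for this symbol, and a bank of a supplementary instance to the
only rule that may invoke changes of it. -/
theorem UpdRule.dom.unique (hP : (Prog.mk aux k J sub upd qry).WellFormed) {δ : Fin I.chg}
    {s s' : Srt} {f : Fin (aux.num s)} {f' : Fin (aux.num s')}
    {r : UpdRule aux J (I.chgArity δ) s f} {r' : UpdRule aux J (I.chgArity δ) s' f'} {c b : ℕ}
    (hr : upd δ s f = some r) (hr' : upd δ s' f' = some r') (h : r.dom c b) (h' : r'.dom c b) :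
    (⟨s, f⟩ : (s : Srt) × Fin (aux.num s)) = ⟨s', f'⟩ := by
  rcases h with rfl | ⟨i, hi, h⟩ <;> rcases h' with h' | ⟨j, hj, h'⟩
  · obtain ⟨-, rfl, h⟩ := symBank_inj.1 h'
    rw [Fin.ext h]
  · exact absurd h' (not_bankIn_child _ _ _ _)
  · subst h'
    exact absurd h (not_bankIn_child _ _ _ _)
  · obtain rfl := Fin.ext (h.child_inj h')
    exact hP.1 δ i s f s' f' r r' hr hr' hi hj

theorem UpdRule.work_le_chg {δ : Fin I.chg} {s : Srt} {f : Fin (aux.num s)}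
    {r : UpdRule aux J (I.chgArity δ) s f} (hr : upd δ s f = some r) (n : ℕ) :
    (r.work n fun i => (sub i).work n) ≤ ((Prog.mk aux k J sub upd qry).work n).chg δ := by
  rw [Prog.work]
  cases s with
  | rel =>
    refine le_max_of_le_left (le_trans ?_ (Finset.le_sup (Finset.mem_univ f)))
    simp only [hr, le_refl]
  | fn =>
    refine le_max_of_le_right (le_trans ?_ (Finset.le_sup (Finset.mem_univ f)))
    simp only [hr, le_refl]

/-- Because views are expressions and nothing has been stored into the state yet, every rule can be
evaluated on the old state. Afterwards the views are glued together bank by bank. -/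
theorem chgClaim_mk (hP : (Prog.mk aux k J sub upd qry).WellFormed) (hq : ∀ i, QClaim (sub i))
    (hc : ∀ i, ChgClaim (sub i)) : ChgClaim (Prog.mk aux k J sub upd qry) := by
  classical
  intro δ ctr c SV mask vars hm hv hS
  let dom : (s : Srt) × Fin (aux.num s) → ℕ → Prop :=
    fun x b => ∃ r, upd δ x.1 x.2 = some r ∧ r.dom c b
  have hdom : ∀ x x' b, dom x b → dom x' b → x = x' := by
    rintro ⟨s, f⟩ ⟨s', f'⟩ b ⟨r, hr, h⟩ ⟨r', hr', h'⟩
    exact UpdRule.dom.unique hP hr hr' h h'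
  obtain ⟨l, hl⟩ : ∃ l : List ((s : Srt) × Fin (aux.num s)), ∀ x, x ∈ l := by
    have := Fintype.ofFinite ((s : Srt) × Fin (aux.num s))
    exact ⟨Finset.univ.toList, by simp⟩
  -- Each bank is read in the view of the rule that owns it, or in the old view if no rule does.
  let D : ((s : Srt) × Fin (aux.num s) → Delta) → Delta := fun d =>
    ⟨fun b => if h : ∃ x, dom x b then (d h.choose).SV b else SV b, l.flatMap fun x => (d x).log⟩
  have hyes : ∀ d x b, dom x b → (D d).SV b = (d x).SV b := fun d x b h => by
    have hex : ∃ x, dom x b := ⟨x, h⟩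
    simp only [D, dif_pos hex]
    rw [hdom _ _ b hex.choose_spec h]
  have hno : ∀ d b, (∀ x, ¬ dom x b) → (D d).SV b = SV b := fun d b h => by
    simp only [D, dif_neg (not_exists.2 h)]
  have hgood : ∀ c' (d : (s : Srt) × Fin (aux.num s) → Delta), ctr ≤ c' → (∀ x, ctr ≤ c' ∧
      (d x).Good SV (dom x) (fun n => ((Prog.mk aux k J sub upd qry).work n).chg δ) c') →
      Delta.Good SV (BankIn c) (fun n => ((Prog.mk aux k J sub upd qry).work n).chg δ) c'
        (D d) := by
    intro c' d hc' hd
    have hin : ∀ x b, dom x b → BankIn c b := fun x b ⟨r, _, h⟩ => h.bankIn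
    refine ⟨fun b => ?_, fun b hb => hno d b fun x h => hb (hin x b h), fun e he => ?_⟩
    · by_cases hex : ∃ x, dom x b
      · obtain ⟨x, h⟩ := hex
        rw [hyes d x b h]
        exact (hd x).2.below b
      · rw [hno d b fun x h => hex ⟨x, h⟩]
        exact (hS b).mono hc'
    · obtain ⟨x, -, he⟩ := List.mem_flatMap.1 he
      obtain ⟨h1, h2, h3⟩ := (hd x).2.log e he
      exact ⟨h1, hin x _ h2, h3⟩
  have hst : Stable ctr fun n (g : QGhost (Prog.mk aux k J sub upd qry) (I.chgArity δ) n) m =>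
      VecRep (.lit 1) mask vars g.act g.env m ∧ RepS (Prog.mk aux k J sub upd qry) c g.st SV m ∧
        (g.act 0 → (((Prog.mk aux k J sub upd qry).sem n).change g.st δ (g.env 0)).isSome) :=
    fun n g m m' ha hp => ⟨hp.1.agree hm hv ha, hp.2.1.agree hS ha, hp.2.2⟩
  refine (Blk.finite (D := Delta)
    (W := fun n => ((Prog.mk aux k J sub upd qry).work n).chg δ)
    -- The bound on the counter is carried along so that the old view `SV` is known to be below `c'`
    -- when stability is shown.
    (Good := fun x c' d => ctr ≤ c' ∧
      d.Good SV (dom x) (fun n => ((Prog.mk aux k J sub upd qry).work n).chg δ) c')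
    (Post := fun x d n g m =>
      ∀ r, upd δ x.1 x.2 = some r → UpdRule.Post (sub := sub) (upd := upd) (qry := qry) r c SV d g m)
    hst (fun x c c' d hc h => ⟨h.1.trans hc, h.2.mono (fun _ h => h) (fun _ => le_rfl) hc⟩)
    (fun x c' d hd => ?_) fun x c' hc' => ?_).conseq
    (fun _ g => g) hst (fun _ _ _ _ h => h) 1 (fun n => by rw [one_mul])
    D ?_ ?_ ?_
  · intro n g m m' ha h r hr
    exact r.stable_post hd.2 (fun b => (hS b).mono hd.1) n g m m' ha (h r hr)
  · cases hr : upd δ x.1 x.2 with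
    | none =>
      exact Blk.pure ⟨SV, []⟩ ⟨hc', .refl fun b => (hS b).mono hc'⟩ (by simp [Stable]) (by simp)
    | some r =>
      refine (ruleBlk (upd := upd) (qry := qry) hq hc r (hm.mono hc') (fun i => (hv i).mono hc')
        fun b => (hS b).mono hc').conseq (fun _ g => g) (hst.mono hc')
        (fun n g m _ hp => ⟨hp.1, hp.2.1, fun h0 => (applyRules_spec (hp.2.2 h0)).1 _ _ r hr⟩) 1
        (fun n => by rw [one_mul]; exact UpdRule.work_le_chg hr n) (fun d => d)
        (fun c'' d hc'' hd => ⟨hc'.trans hc'', hd.mono (fun b hb => ⟨r, hr, hb⟩)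
          (fun n => UpdRule.work_le_chg hr n) le_rfl⟩)
        (fun c'' d hc'' hd => ?_) (fun d c'' n g m _ _ _ _ h => ?_)
      · simp only [Option.some_inj, forall_eq']
        exact r.stable_post hd fun b => (hS b).mono (hc'.trans hc'')
      · simpa using h
  · exact fun c' d hc' hd => hgood c' d hc' hd
  · intro c' d hc' hd n g m m' ha h
    refine ⟨fun h0 => ?_, (hgood c' d hc' hd).stable (fun b => (hS b).mono hc')
      (fun n (g : QGhost (Prog.mk aux k J sub upd qry) (I.chgArity δ) n) => g.act 0) n g m m' ha
      h.2⟩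
    obtain ⟨st', h1, h2⟩ := h.1 h0
    exact ⟨st', h1, h2.agree (hgood c' d hc' hd).below ha⟩
  · intro d c' n g m _ _ hd hp hpost
    refine ⟨fun h0 => ?_, fun x hx => ?_⟩
    · obtain ⟨hsome, st', h1, h2, h3, h4⟩ := applyRules_spec (hp.2.2 h0)
      have hold := repS_mk.1 hp.2.1
      have hrule : ∀ s f r, upd δ s f = some r → ∃ y,
          r.eval (fun i => (sub i).sem n) g.st.1 g.st.2 (g.env 0) = some y ∧ _ :=
        fun s f r hr => (hpost ⟨s, f⟩ r hr).1 h0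
      refine ⟨st', h1, repS_mk.2 ⟨fun s f a => ?_, fun i => ?_⟩⟩
      · cases hr : upd δ s f with
        | none =>
          rw [h2 s f hr, ← hold.1, symAddr_eq, rd_pair, rd_pair, hno]
          rintro ⟨s', f'⟩ ⟨r', hr', hdom' | ⟨i, -, hdom'⟩⟩
          · obtain ⟨-, rfl, hf⟩ := symBank_inj.1 hdom'
            obtain rfl := Fin.ext hf
            rw [hr] at hr'
            cases hr'
          · exact not_bankIn_child _ _ _ _ hdom'
        | some r =>
          obtain ⟨y, hy, h5, -⟩ := hrule s f r hr
          rw [h3 s f r y hr hy, ← h5, symAddr_eq, rd_pair, rd_pair,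
            hyes d ⟨s, f⟩ _ ⟨r, hr, .inl rfl⟩]
      · rcases h4 i with ⟨h5, h6⟩ | ⟨s, f, r, y, hr, hi, hy, h5⟩
        · rw [h5]
          refine (hold.2 i).congr fun x hx => ?_
          rw [rd, rd, hno]
          rintro ⟨s', f'⟩ ⟨r', hr', hdom' | ⟨j, hj, hdom'⟩⟩
          · rw [hdom'] at hx
            exact not_bankIn_child _ _ _ _ hx
          · obtain rfl := Fin.ext (hx.child_inj hdom')
            exact h6 s' f' r' hr' hj
        · obtain ⟨y', hy', -, h6⟩ := hrule s f r hr
          rw [hy, Option.some_inj] at hy'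
          subst hy'
          rw [h5]
          refine (h6 i).congr fun x hx => ?_
          rw [rd, rd, hyes d ⟨s, f⟩ _ ⟨r, hr, .inr ⟨i, hi, hx⟩⟩]
    · by_cases hex : ∃ z, dom z x.unpair.1
      · obtain ⟨z, hz⟩ := hex
        rw [rd, hyes d z _ hz] at hx
        obtain ⟨r, hr, -⟩ := hz
        obtain ⟨h1, e, he, h2⟩ := (hpost z r hr).2 x hx
        exact ⟨h1, e, List.mem_flatMap.2 ⟨z, hl z, he⟩, h2⟩
      · rw [rd, hno d _ fun z hz => hex ⟨z, hz⟩] at hx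
        exact absurd rfl hx

theorem chgClaim {I : Interface} (P : Prog I) (hP : P.WellFormed) : ChgClaim P := by
  induction P with
  | mk aux k J sub upd qry ih =>
    exact chgClaim_mk hP (fun i => qClaim (sub i)) fun i => ih i (hP.2 i)

end

/-! # Programs for update and query rules -/

open scoped Classical in
/-- The view that shows the memory itself. -/
noncomputable def baseView (b : ℕ) : SExp :=
  if ∃ k, b = tmpBank k then .lit 0 else .load b (.var 0)

/-- Replacing the banks for intermediate results by `0` in `baseView` makes this true for every
`ctr`; no part of the state is lost. -/
theorem below_baseView (ctr b : ℕ) : (baseView b).Below ctr := by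
  unfold baseView
  split_ifs with h
  · trivial
  · exact ⟨fun k _ hk => h ⟨k, hk⟩, trivial⟩

theorem eval_baseView {c b : ℕ} (hb : BankIn c b) (n : ℕ) (m : BMem) (x : ℕ) :
    (baseView b).eval n m (fun _ => x) = m b x := by
  rw [baseView, if_neg fun ⟨k, hk⟩ => hb.ne_tmpBank k hk]
  rfl

section
variable {I : Interface} {P : Prog I} {n : ℕ} {st : P.State n}

theorem repS_baseView {mem : ℕ → ℕ} (h : P.Stores st mem) :
    RepS P 0 st baseView fun b x => mem (Nat.pair b x) := fun x v hx => by
  rw [rd, eval_baseView hx.bankIn, Nat.pair_unpair]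
  exact h x v hx

theorem stores_of_repS {m : BMem} (h : RepS P 0 st baseView m) :
    P.Stores st fun x => m x.unpair.1 x.unpair.2 := fun x v hx => by
  rw [← h x v hx, rd, eval_baseView hx.bankIn]

theorem Prog.Input.tmpBank {k : ℕ} {a : Fin k → Fin n} {mem : ℕ → ℕ} (h : P.Input st a mem)
    (j x : ℕ) : mem (Nat.pair (tmpBank j) x) = 0 := by
  refine h.2.2 _ (fun v hv => ?_) fun i hi => ?_
  · have := hv.bankIn
    rw [Nat.unpair_pair] at this
    exact this.ne_tmpBank j rfl
  · exact zero_ne_tmpBank j (Nat.pair_eq_pair.1 hi).1.symm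

/-- The description of the only context in which a rule is executed. -/
theorem Prog.Input.vecRep {k : ℕ} {a : Fin k → Fin n} {mem : ℕ → ℕ} (h : P.Input st a mem) :
    VecRep (.lit 1) (.op .lt (.var 0) (.lit 1)) (fun i : Fin k => .load 0 (.lit (i + 1)))
      (fun j => j = 0) (fun _ => a) fun b x => mem (Nat.pair b x) where
  mask_iff j := by simp
  lt j hj := by simp [hj, NumExpr.eval]
  var j _ i := h.2.1 i

end

/-! ### From blocks to CRAM programs -/

section
variable {W : ℕ → ℕ} {G : ℕ → Type} {D : Type} {ctr : ℕ} {Pre : ∀ n, G n → BMem → Prop}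
  {Good : ℕ → D → Prop} {Post : D → ∀ n, G n → BMem → Prop}

/-- A block, followed by some more kernels, yields a CRAM program. -/
theorem Blk.exists_cram (h : Blk 1 W Pre Good Post) {R : ∀ n, G n → BMem → Prop}
    (hfin : ∀ c d, Good c d → ∃ ks : List Kernel, (∀ k ∈ ks, k.b ≠ tmpBank 0) ∧
      (∀ k ∈ ks, ∃ C, ∀ n, k.N.eval n ≤ C * W n) ∧
      ∀ n g p m, 1 ≤ n → (∀ k ∈ ks, k.N.eval n ≤ p) → Post d n g m →
        ∃ m', Runs p n ks m m' ∧ R n g m') :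
    ∃ (M : CRAM) (T C : ℕ), ∀ n g mem, 1 ≤ n → (∀ k x, mem (Nat.pair (tmpBank k) x) = 0) →
      Pre n g (fun b x => mem (Nat.pair b x)) →
      ∃ m', M.Computes n mem (fun x => m' x.unpair.1 x.unpair.2) T (C * W n) ∧ R n g m' := by
  obtain ⟨ctr', ks, Q, C, d, -, hk, hQ, hg, -, hrun⟩ := h
  obtain ⟨ks', hb, hN, hrun'⟩ := hfin ctr' d hg
  obtain ⟨Q', C', hQ', hNQ⟩ := exists_procs hN
  refine ⟨CRAM.ofKernels (.add Q Q') (ks ++ ks'), ((ks ++ ks').flatMap Kernel.code).length,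
    ((ks ++ ks').flatMap Kernel.code).length * (C + C'), fun n g mem hn h0 hp => ?_⟩
  obtain ⟨m₁, hr₁, hp₁⟩ := hrun n g ((NumExpr.add Q Q').eval n) _ hn (Nat.le_add_right _ _)
    (fun k _ x => h0 k x) hp
  obtain ⟨m₂, hr₂, hR⟩ := hrun' n g ((NumExpr.add Q Q').eval n) m₁ hn
    (fun k hk => (hNQ k hk n).trans (Nat.le_add_left _ _)) hp₁
  refine ⟨m₂, ?_, hR⟩
  have := CRAM.computes_ofKernels (.add Q Q') (ks ++ ks') n mem m₂ (fun k hk' => ?_) (h0 0 0)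
    (hr₁.append hr₂)
  · obtain ⟨t, h1, h2, h3, h4, h5⟩ := this
    refine ⟨t, h1, h2, h3, h4, h5.trans ?_⟩
    rw [mul_assoc, add_mul]
    exact Nat.mul_le_mul_left _ (add_le_add (hQ n) (hQ' n))
  · rcases List.mem_append.1 hk' with hk' | hk'
    -- The block counts from `1`, so it never uses the bank with number `0`, which contains the
    -- dummy cell.
    · obtain ⟨j, hj, -, e⟩ := hk k hk'
      rw [e]
      exact fun he => by have := tmpBank_injective he; omega
    · exact hb k hk'

/-- Tabulation of expressions in fresh banks. -/
theorem Blk.tabulate (hs : Stable ctr Pre) {ι : Type} [Finite ι] (N : ι → NumExpr) (E : ι → SExp)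
    (hE : ∀ i, (E i).Below ctr) (hN : ∀ i, ∃ C, ∀ n, (N i).eval n ≤ C * W n) :
    Blk ctr W Pre (fun c (d : ι → ℕ) => ∀ i, ctr ≤ c ∧ ∃ j < c, d i = tmpBank j)
      fun d n _ m => ∀ i, ∀ j < (N i).eval n, m (d i) j = (E i).eval n m fun _ => j := by
  refine Blk.finite (Good := fun _ c (d : ℕ) => ctr ≤ c ∧ ∃ j < c, d = tmpBank j)
    (Post := fun i (d : ℕ) n _ m => ∀ j < (N i).eval n, m d j = (E i).eval n m fun _ => j)
    hs (fun i c c' d hc h => ⟨h.1.trans hc, ?_⟩) ?_ fun i c hc => ?_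
  · obtain ⟨j, hj, hd⟩ := h.2
    exact ⟨j, hj.trans_le hc, hd⟩
  · rintro i c d ⟨hc, k, hk, rfl⟩ n g m m' ha h j hj
    rw [((hE i).mono hc).eval_eq ha, ← h j hj, ha]
    exact fun l hl he => by have := tmpBank_injective he; omega
  · refine (Blk.write [⟨tmpBank c, N i, .lit 1, .var 0, E i⟩] (by simp)
      (by simp [(hE i).mono hc]) (by simpa using hN i) (by simp +contextual)).conseq
      (fun _ g => g) (hs.mono hc) (fun _ _ _ _ h => h) 1 (fun n => by rw [one_mul]) (fun d => d)
      ?_ ?_ ?_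
    · rintro c' d hc' ⟨rfl, rfl⟩
      exact ⟨hc.trans hc', c, by omega, rfl⟩
    · rintro c' d hc' ⟨rfl, rfl⟩ n g m m' ha h j hj
      rw [((hE i).mono (hc.trans hc')).eval_eq ha, ← h j hj, ha]
      exact fun l hl he => by have := tmpBank_injective he; omega
    · intro d c' n g m _ _ _ _ h j hj
      simpa [Kernel.On, hj] using h.1 _ (List.mem_singleton_self _) j (by simpa [Kernel.On] using hj)

/-- A block whose result is a new view of the state yields a CRAM program that stores the
new state. -/
theorem Blk.exists_cram_commit {I : Interface} {P : Prog I} {F : ∀ n, G n → P.State n → Prop}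
    (hs : Stable 1 Pre)
    (h : Blk 1 W Pre (fun c (d : Delta) => d.Good baseView (BankIn 0) W c) fun d n g m =>
      (∃ st, F n g st ∧ RepS P 0 st d.SV m) ∧ d.Logged baseView n m True) :
    ∃ (M : CRAM) (T C : ℕ), ∀ n g mem, 1 ≤ n → (∀ k x, mem (Nat.pair (tmpBank k) x) = 0) →
      Pre n g (fun b x => mem (Nat.pair b x)) →
      ∃ m', M.Computes n mem (fun x => m' x.unpair.1 x.unpair.2) T (C * W n) ∧
        ∃ st, F n g st ∧ RepS P 0 st baseView m' := by
  classical
  -- The new view reads the very banks that are to be overwritten. Therefore the logged cell numbers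
  -- (`true`) and their new contents (`false`) are first saved in fresh banks.
  have h' : Blk 1 W Pre
      (fun c (d : (d : Delta) × (Fin d.log.length × Bool → ℕ)) =>
        d.1.Good baseView (BankIn 0) W c ∧ ∀ i, ∃ j, d.2 i = tmpBank j)
      fun d n g m => ((∃ st, F n g st ∧ RepS P 0 st d.1.SV m) ∧ d.1.Logged baseView n m True) ∧
        ∀ i : Fin d.1.log.length, ∀ j < (d.1.log[i]).N.eval n,
          m (d.2 (i, true)) j = (d.1.log[i]).cell.eval n m (fun _ => j) ∧
          m (d.2 (i, false)) j = (d.1.SV (d.1.log[i]).b).eval n m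
            fun _ => (d.1.log[i]).cell.eval n m fun _ => j := by
    refine h.bind (fun _ g => g) hs (fun _ _ _ _ h => h) 1 (fun n => by rw [one_mul])
      fun c d hc hd hst => ?_
    have hE : ∀ i : Fin d.log.length × Bool, (match i.2 with
        | true => (d.log[i.1]).cell
        | false => (d.SV (d.log[i.1]).b).at' (d.log[i.1]).cell : SExp).Below c := by
      rintro ⟨i, _ | _⟩
      · exact (hd.below _).at (hd.log _ (List.getElem_mem _)).1
      · exact (hd.log _ (List.getElem_mem _)).1
    refine (Blk.tabulate (W := W) ((hs.mono hc).and hst) (fun i => (d.log[i.1]).N) _ hE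
      fun i => (hd.log _ (List.getElem_mem _)).2.2).conseq (fun _ g => g) ((hs.mono hc).and hst)
      (fun _ _ _ _ h => h) 1 (fun n => by rw [one_mul]) (fun b => ⟨d, b⟩) ?_ ?_ ?_
    · intro c' b hc' hb
      refine ⟨hd.mono (fun _ h => h) (fun _ => le_rfl) hc', fun i => ?_⟩
      obtain ⟨-, j, -, hj⟩ := hb i
      exact ⟨j, hj⟩
    · intro c' b hc' hb n g m m' ha h
      refine ⟨hst.mono hc' n g m m' ha h.1, fun i j hj => ?_⟩
      obtain ⟨h1, h2⟩ := h.2 i j hj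
      have hbank : ∀ i, m' (b i) = m (b i) := fun i => ha _ fun l hl he => by
        obtain ⟨-, k, hk, hb⟩ := hb i
        have := tmpBank_injective (hb.symm.trans he)
        omega
      have hcell := ((hd.log _ (List.getElem_mem i.2)).1.mono hc').eval_eq (n := n) (ρ := fun _ => j) ha
      refine ⟨?_, ?_⟩
      · refine (congrFun (hbank (i, true)) j).trans (h1.trans hcell.symm)
      · refine (congrFun (hbank (i, false)) j).trans (h2.trans ?_)
        rw [((hd.below _).mono hc').eval_eq ha]
        congr 1
        funext
        exact hcell.symm
    · intro b c' n g m _ _ _ hp hpost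
      refine ⟨hp.2, fun i j hj => ⟨hpost (i, true) j hj, ?_⟩⟩
      have := hpost (i, false) j hj
      simpa using this
  refine h'.exists_cram fun c d hd => ?_
  obtain ⟨d, b⟩ := d
  obtain ⟨hd, hb⟩ := hd
  -- The copying kernels read only the saved tables, so they do not depend on what has been
  -- overwritten.
  refine ⟨(List.finRange d.log.length).map fun i => ⟨(d.log[i]).b, (d.log[i]).N, .lit 1,
    .load (b (i, true)) (.var 0), .load (b (i, false)) (.var 0)⟩, ?_, ?_, ?_⟩
  · intro k hk
    obtain ⟨i, -, rfl⟩ := List.mem_map.1 hk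
    exact (hd.log _ (List.getElem_mem _)).2.1.ne_tmpBank 0
  · intro k hk
    obtain ⟨i, -, rfl⟩ := List.mem_map.1 hk
    exact (hd.log _ (List.getElem_mem _)).2.2
  · rintro n g p m hn hN ⟨⟨⟨st, hF, hst⟩, hlog⟩, htab⟩
    -- The value written is the content of the cell in the new view. It depends on the cell alone,
    -- so cells that are logged repeatedly cause no conflict.
    refine (runs_of_target p n (fun b x => rd d.SV n m (Nat.pair b x))
      {b | BankIn 0 b} m _ ?_ hN ?_ ?_ m fun _ _ => rfl).imp ?_
    · intro k hk
      obtain ⟨i, -, rfl⟩ := List.mem_map.1 hk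
      exact (hd.log _ (List.getElem_mem _)).2.1
    · intro m' hm' k hk j
      obtain ⟨i, -, rfl⟩ := List.mem_map.1 hk
      have hbank : ∀ i, m' (b i) = m (b i) := fun i => hm' _ fun h => by
        obtain ⟨j, hj⟩ := hb i
        exact h.ne_tmpBank j hj
      simp [Kernel.On, hbank]
    · intro k hk j hon
      obtain ⟨i, -, rfl⟩ := List.mem_map.1 hk
      obtain ⟨h1, h2⟩ := htab i j hon.1
      rw [SExp.eval_load, SExp.eval_load, SExp.eval_var, rd_pair, h1, h2]
    · rintro m' ⟨hr, -, hm'⟩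
      refine ⟨hr, st, hF, hst.congr fun x hx => ?_⟩
      rw [rd, eval_baseView hx, hm', Nat.pair_unpair]
      split_ifs with hex
      · rfl
      -- A cell that is not copied is not in the log, so the new view agrees there with the memory.
      · rw [← eval_baseView hx n m]
        by_contra hne
        obtain ⟨-, e, he, i, hi, hit⟩ := hlog x (Ne.symm hne)
        obtain ⟨l, hl, rfl⟩ := List.getElem_of_mem he
        refine hex ⟨_, List.mem_map.2 ⟨⟨l, hl⟩, List.mem_finRange _, rfl⟩, ?_, i, ?_, ?_⟩
        · rw [← hit, Nat.unpair_pair]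
          rfl
        · exact ⟨hi, one_ne_zero⟩
        · rw [SExp.eval_load, SExp.eval_var, (htab ⟨l, hl⟩ i hi).1, ← hit, Nat.unpair_pair]
          rfl

end

/-! ### The programs for a single update rule and a single query rule -/

section
variable {I : Interface} {aux : Schema} {k : ℕ} {J : Fin k → Interface}
  {sub : (i : Fin k) → Prog (J i)}
  {upd : (δ : Fin I.chg) → (s : Srt) → (f : Fin (aux.num s)) →
    Option (UpdRule aux J (I.chgArity δ) s f)}
  {qry : (s : Srt) → (q : Fin (I.qry.num s)) → QryRule aux J (I.qry.arity s q) s}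

/-- For the symbols that the rule does not update, the view is literally the old one, as their banks
lie outside of `r.dom c`. -/
theorem UpdRule.Post.repS {p n : ℕ} {s : Srt} {f : Fin (aux.num s)} {r : UpdRule aux J p s f}
    {SV : ℕ → SExp} {w : ℕ → ℕ} {ctr c : ℕ} {d : Delta} (hd : d.Good SV (r.dom c) w ctr)
    {g : QGhost (Prog.mk aux k J sub upd qry) p n} {m : BMem}
    (hold : RepS (Prog.mk aux k J sub upd qry) c g.st SV m) (h : r.Post c SV d g m)
    (h0 : g.act 0) : ∃ st', r.apply (fun i => (sub i).sem n) g.st (g.env 0) = some st' ∧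
      RepS (Prog.mk aux k J sub upd qry) c st' d.SV m := by
  classical
  obtain ⟨y, hy, h1, h2⟩ := h.1 h0
  refine ⟨_, by rw [UpdRule.apply, hy]; rfl, repS_mk.2 ⟨fun s' f' a => ?_, h2⟩⟩
  by_cases hx : (⟨s', f'⟩ : (s : Srt) × Fin (aux.num s)) = ⟨s, f⟩
  · cases hx
    have hval : Function.update g.st.1 s (Function.update (g.st.1 s) f y.1) s f = y.1 :=
      (congrFun (Function.update_self ..) f).trans (Function.update_self ..)
    rw [h1, ← hval]
  · have hval : Function.update g.st.1 s (Function.update (g.st.1 s) f y.1) s' f' =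
        g.st.1 s' f' := by
      by_cases hs : s' = s
      · subst hs
        have hf : f' ≠ f := fun hf => hx (by rw [hf])
        exact (congrFun (Function.update_self ..) f').trans (Function.update_of_ne hf _ _)
      · exact congrFun (Function.update_of_ne hs _ _) f'
    have hb : ¬ r.dom c (symBank c s' f') := by
      rintro (hb | ⟨i, -, hb⟩)
      · obtain ⟨-, rfl, hf⟩ := symBank_inj.1 hb
        exact hx (by rw [Fin.ext hf])
      · exact not_bankIn_child _ _ _ _ hb
    have h3 := (repS_mk.1 hold).1 s' f' a
    rw [symAddr_eq, rd_pair] at h3 ⊢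
    rw [hd.eq _ hb, h3, ← hval]

theorem UpdRule.exists_cram (hP : (Prog.mk aux k J sub upd qry).WellFormed) {p : ℕ} {s : Srt}
    {f : Fin (aux.num s)} (r : UpdRule aux J p s f) :
    ∃ (M : CRAM) (T C : ℕ), ∀ n : ℕ, 1 ≤ n →
      ∀ (st st' : (Prog.mk aux k J sub upd qry).State n) (a : Fin p → Fin n),
        r.apply (fun i => (sub i).sem n) st a = some st' →
        ∀ mem : ℕ → ℕ, (Prog.mk aux k J sub upd qry).Input st a mem →
          ∃ mem' : ℕ → ℕ,
            M.Computes n mem mem' T (C * r.work n (fun i => (sub i).work n)) ∧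
            (Prog.mk aux k J sub upd qry).Stores st' mem' := by
  have hv : ∀ i : Fin p, (SExp.load 0 (.lit (i + 1))).Below 1 :=
    fun i => ⟨fun k _ => zero_ne_tmpBank k, trivial⟩
  have hm : (SExp.op .lt (.var 0) (.lit 1)).Below 1 := ⟨trivial, trivial⟩
  have hst : Stable 1 fun n (g : QGhost (Prog.mk aux k J sub upd qry) p n) m =>
      (VecRep (.lit 1) (.op .lt (.var 0) (.lit 1)) (fun i : Fin p => .load 0 (.lit (i + 1)))
        g.act g.env m ∧ RepS (Prog.mk aux k J sub upd qry) 0 g.st baseView m ∧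
        (g.act 0 → (r.eval (fun i => (sub i).sem n) g.st.1 g.st.2 (g.env 0)).isSome)) ∧ g.act 0 :=
    fun n g m m' ha hp => ⟨⟨hp.1.1.agree hm hv ha, hp.1.2.1.agree (below_baseView 1) ha, hp.1.2.2⟩,
      hp.2⟩
  have hblk := (ruleBlk (upd := upd) (qry := qry) (fun i => qClaim (sub i))
    (fun i => chgClaim (sub i) (hP.2 i)) r hm hv (below_baseView 1)).conseq (fun _ g => g) hst
    (Good := fun c d => d.Good baseView (BankIn 0) (fun n => r.work n fun i => (sub i).work n) c)
    (Post := fun d n g m => (∃ st', r.apply (fun i => (sub i).sem n) g.st (g.env 0) = some st' ∧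
      RepS (Prog.mk aux k J sub upd qry) 0 st' d.SV m) ∧ d.Logged baseView n m True)
    (fun _ _ _ _ hp => hp.1) 1 (fun n => by rw [one_mul]) (fun d => d)
    (fun c d _ hd => hd.mono (fun b hb => hb.bankIn) (fun _ => le_rfl) le_rfl)
    (fun c d _ hd n g m m' ha h => ⟨h.1.imp fun st' h => ⟨h.1, h.2.agree hd.below ha⟩,
      hd.stable (fun b => below_baseView c b) (fun _ _ => True) n g m m' ha h.2⟩)
    (fun d c n g m _ _ hd hp h => ⟨h.repS hd hp.1.2.1 hp.2, fun x hx => ⟨trivial, (h.2 x hx).2⟩⟩)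
  obtain ⟨M, T, C, hM⟩ := Blk.exists_cram_commit
    (P := Prog.mk aux k J sub upd qry)
    (F := fun n g st' => r.apply (fun i => (sub i).sem n) g.st (g.env 0) = some st') hst hblk
  refine ⟨M, T, C, fun n hn st st' a h mem hin => ?_⟩
  have heval : (r.eval (fun i => (sub i).sem n) st.1 st.2 a).isSome := by
    rw [UpdRule.apply] at h
    by_contra hne
    simp [Option.not_isSome_iff_eq_none.1 hne] at h
  -- The program is run in the single context `0`, whose variables are read from the parameter
  -- cells.
  obtain ⟨m', h1, st'', h2, h3⟩ := hM n ⟨hn, st, fun j => j = 0, fun _ => a⟩ mem hn hin.tmpBank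
    ⟨⟨hin.vecRep, repS_baseView hin.1, fun _ => heval⟩, rfl⟩
  rw [h, Option.some_inj] at h2
  subst h2
  exact ⟨_, h1, stores_of_repS h3⟩

theorem QryRule.exists_cram (s : Srt) (q : Fin (I.qry.num s)) :
    ∃ (M : CRAM) (T C : ℕ), ∀ n : ℕ, 1 ≤ n →
      ∀ (st : (Prog.mk aux k J sub upd qry).State n) (a : Fin (I.qry.arity s q) → Fin n)
        (v : Val n s),
        (qry s q).eval (fun i => (sub i).sem n) st a = some v →
        ∀ mem : ℕ → ℕ, (Prog.mk aux k J sub upd qry).Input st a mem →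
          ∃ mem' : ℕ → ℕ,
            M.Computes n mem mem' T (C * (qry s q).work n (fun i => (sub i).work n)) ∧
            (Prog.mk aux k J sub upd qry).Stores st mem' ∧ mem' outAddr = v.code := by
  have hv : ∀ i : Fin (I.qry.arity s q), (SExp.load 0 (.lit (i + 1))).Below 1 :=
    fun i => ⟨fun k _ => zero_ne_tmpBank k, trivial⟩
  have hm : (SExp.op .lt (.var 0) (.lit 1)).Below 1 := ⟨trivial, trivial⟩
  have hst : Stable 1 fun n (g : QGhost (Prog.mk aux k J sub upd qry) (I.qry.arity s q) n) m =>
      (VecRep (.lit 1) (.op .lt (.var 0) (.lit 1))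
        (fun i : Fin (I.qry.arity s q) => .load 0 (.lit (i + 1))) g.act g.env m ∧
        RepS (Prog.mk aux k J sub upd qry) 0 g.st baseView m ∧
        ∀ j, g.act j →
          (((Prog.mk aux k J sub upd qry).sem n).query g.st s q (g.env j)).isSome) ∧ g.act 0 :=
    fun n g m m' ha hp => ⟨⟨hp.1.1.agree hm hv ha, hp.1.2.1.agree (below_baseView 1) ha, hp.1.2.2⟩,
      hp.2⟩
  have hstPost : ∀ c (R : SExp), R.Below c →
      Stable c fun n (g : QGhost (Prog.mk aux k J sub upd qry) (I.qry.arity s q) n) m =>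
        RepS (Prog.mk aux k J sub upd qry) 0 g.st baseView m ∧
        ∃ v, ((Prog.mk aux k J sub upd qry).sem n).query g.st s q (g.env 0) = some v ∧
          R.eval n m (fun _ => 0) = v.code :=
    fun c R hR n g m m' ha h => ⟨h.1.agree (below_baseView c) ha,
      h.2.imp fun v h => ⟨h.1, by rw [← h.2, hR.eval_eq ha]⟩⟩
  have hblk := (qClaim (Prog.mk aux k J sub upd qry) s q 1 (.lit 1) 0 baseView _ _ hm hv
    (below_baseView 1)).conseq (fun _ g => g) hst
    (W := fun n => (qry s q).work n fun i => (sub i).work n) (Good := fun c R => R.Below c)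
    (Post := fun R n (g : QGhost (Prog.mk aux k J sub upd qry) (I.qry.arity s q) n) m =>
      RepS (Prog.mk aux k J sub upd qry) 0 g.st baseView m ∧
      ∃ v, ((Prog.mk aux k J sub upd qry).sem n).query g.st s q (g.env 0) = some v ∧
        R.eval n m (fun _ => 0) = v.code)
    (fun _ _ _ _ hp => hp.1) 1
    (fun n => by rw [one_mul, Prog.work, NumExpr.eval, one_mul]) (fun R => R)
    (fun _ _ _ h => h) (fun c R _ hR => hstPost c R hR)
    (fun R c n g m _ _ _ hp h => ⟨hp.1.2.1, h 0 hp.2⟩)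
  have hfin : ∀ c (R : SExp), R.Below c → ∃ ks : List Kernel, (∀ k ∈ ks, k.b ≠ tmpBank 0) ∧
      (∀ k ∈ ks, ∃ C, ∀ n, k.N.eval n ≤ C * (qry s q).work n fun i => (sub i).work n) ∧
      ∀ n (g : QGhost (Prog.mk aux k J sub upd qry) (I.qry.arity s q) n) p m, 1 ≤ n →
        (∀ k ∈ ks, k.N.eval n ≤ p) →
        (RepS (Prog.mk aux k J sub upd qry) 0 g.st baseView m ∧
          ∃ v, ((Prog.mk aux k J sub upd qry).sem n).query g.st s q (g.env 0) = some v ∧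
            R.eval n m (fun _ => 0) = v.code) →
        ∃ m', Runs p n ks m m' ∧ RepS (Prog.mk aux k J sub upd qry) 0 g.st baseView m' ∧
          ∃ v, ((Prog.mk aux k J sub upd qry).sem n).query g.st s q (g.env 0) = some v ∧
            m' 0 0 = v.code := by
    intro c R hR
    -- One processor stores the answer in the output cell; bank `0` is not part of the state, which
    -- therefore stays as it is.
    refine ⟨[⟨0, .lit 1, .lit 1, .lit 0, R⟩], by simpa using zero_ne_tmpBank 0, fun k hk => ?_, ?_⟩
    · obtain rfl := List.mem_singleton.1 hk
      refine ⟨1, fun n => ?_⟩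
      rw [one_mul]
      exact Body.one_le_work (Γ := ⟨aux, (qry s q).tmp, k, J⟩) n _ _
    · rintro n g p m hn hp ⟨hst, v, hv, hR⟩
      have hp : 1 ≤ p := by simpa [NumExpr.eval] using hp
      refine ⟨fun b x => if b = 0 ∧ x = 0 then v.code else m b x, ⟨_, ⟨fun i _ hi => ?_,
        fun b x hx => if_neg ?_⟩, rfl⟩, ?_, v, hv, by simp⟩
      · obtain rfl : i = 0 := by simpa [NumExpr.eval] using hi.1
        simpa using hR.symm
      · rintro ⟨rfl, rfl⟩
        exact hx rfl 0 hp ⟨Nat.zero_lt_one, one_ne_zero⟩ rfl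
      · refine hst.congr fun x hx => ?_
        have hb : x.unpair.1 ≠ 0 := by
          obtain ⟨d, t, e, -, h⟩ := hx
          rw [h]
          exact Nat.succ_ne_zero _
        rw [rd, rd, eval_baseView hx, eval_baseView hx]
        simp [hb]
  obtain ⟨M, T, C, hM⟩ := hblk.exists_cram hfin
  refine ⟨M, T, C, fun n hn st a v h mem hin => ?_⟩
  have heval : ((Prog.mk aux k J sub upd qry).sem n).query st s q a = some v := h
  obtain ⟨m', h1, h2, v', h3, h4⟩ := hM n ⟨hn, st, fun j => j = 0, fun _ => a⟩ mem hn
    hin.tmpBank ⟨⟨hin.vecRep, repS_baseView hin.1, fun _ _ => by rw [heval]; rfl⟩, rfl⟩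
  rw [heval, Option.some_inj] at h3
  subst h3
  exact ⟨_, h1, stores_of_repS h2, by simpa [outAddr] using h4⟩

end

theorem mainTheorem10 {I : Interface} (aux : Schema) (k : ℕ) (J : Fin k → Interface)
    (sub : (i : Fin k) → Prog (J i))
    (upd : (δ : Fin I.chg) → (s : Srt) → (f : Fin (aux.num s)) →
      Option (UpdRule aux J (I.chgArity δ) s f))
    (qry : (s : Srt) → (q : Fin (I.qry.num s)) → QryRule aux J (I.qry.arity s q) s)
    (hP : (Prog.mk aux k J sub upd qry).WellFormed) :
    (∀ (δ : Fin I.chg) (s : Srt) (f : Fin (aux.num s)) (r : UpdRule aux J (I.chgArity δ) s f),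
      upd δ s f = some r →
      ∃ (M : CRAM) (T C : ℕ), ∀ n : ℕ, 1 ≤ n →
        ∀ (st st' : (Prog.mk aux k J sub upd qry).State n) (a : Fin (I.chgArity δ) → Fin n),
          r.apply (fun i => (sub i).sem n) st a = some st' →
          ∀ mem : ℕ → ℕ, (Prog.mk aux k J sub upd qry).Input st a mem →
            ∃ mem' : ℕ → ℕ,
              M.Computes n mem mem' T (C * r.work n (fun i => (sub i).work n)) ∧
              (Prog.mk aux k J sub upd qry).Stores st' mem') ∧
    (∀ (s : Srt) (q : Fin (I.qry.num s)),
      ∃ (M : CRAM) (T C : ℕ), ∀ n : ℕ, 1 ≤ n →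
        ∀ (st : (Prog.mk aux k J sub upd qry).State n) (a : Fin (I.qry.arity s q) → Fin n)
          (v : Val n s),
          (qry s q).eval (fun i => (sub i).sem n) st a = some v →
          ∀ mem : ℕ → ℕ, (Prog.mk aux k J sub upd qry).Input st a mem →
            ∃ mem' : ℕ → ℕ,
              M.Computes n mem mem' T (C * (qry s q).work n (fun i => (sub i).work n)) ∧
              (Prog.mk aux k J sub upd qry).Stores st mem' ∧ mem' outAddr = v.code) :=
  ⟨fun _ _ _ r _ => r.exists_cram hP, fun s q => QryRule.exists_cram s q⟩
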